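/- **Setting.** Let $d\in\{2,3\}$ and let $\mathcal D\subset\mathbb R^d$ be a bounded open polyhedral set tessellated by a conformal mesh of finitely many simplices $K_1,\dots,K_{N_K}$ (that is, $\mathcal D$ is the interior of $\bigcup_k K_k$). Let $\mathrm{Re}\ge 0$, $\mathrm{Wi}>0$, $0\le\varepsilon<1$, $T>0$, $N_T\ge 1$, $\Delta t=T/N_T$, $t^n=n\Delta t$. Write $A:B=\operatorname{tr}(AB^T)$ and $(\nabla u)_{ij}=\partial_j u_i$. Let $\mathbb P_{m,disc}$ be the space of functions that are polynomials of degree $\le m$ in each element, $\mathbb P_0=\mathbb P_{0,disc}$, and let $\mathbb P_1$ be the space of continuous functions in $\mathbb P_{1,disc}$. Let $V_h$ be the space of continuous vector fields on $\overline{\mathcal D}$ that are polynomial of degree $\le 2$ in each element and vanish on $\partial\mathcal D$, and let $S_h$ be the space of symmetric $d\times d$ matrix fields with entries in $\mathbb P_{1,disc}$ (or with entries in $\mathbb P_1+\mathbb P_0$). Let $\pi_h\phi$ be the piecewise constant field equal on $K_k$ to the value of $\phi$ at the barycenter of $K_k$. **Schemes.** For $0\le n\le N_T$ let $(u_h^n,p_h^n,\psi_h^n)\in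 V_h\times\mathbb P_{1,disc}\times S_h$, with $\int_{\mathcal D} q\,\mathrm{div}\,u_h^0=0$ for all $q\in\mathbb P_{1,disc}$. For $0\le n<N_T$ let $$\nabla u_h^{n+1}=\Omega_h^{n+1}+B_h^{n+1}+N_h^{n+1}\,(\pi_h e^{\psi_h^{n+1}})^{-1}$$ in each element, where $\Omega_h^{n+1},B_h^{n+1},N_h^{n+1}$ have entries in $\mathbb P_{1,disc}$, $\Omega_h^{n+1},N_h^{n+1}$ are antisymmetric, and $B_h^{n+1}$ is symmetric and commutes with $\pi_h e^{\psi_h^{n+1}}$. The sequence is a solution of the log-formulation scheme if, for every $0\le n<N_T$ and all $(v,q,\phi)\in V_h\times\mathbb P_{1,disc}\times S_h$, $$\begin{aligned}0=\int_{\mathcal D}\Big[&\mathrm{Re}\Big(\tfrac{u_h^{n+1}-u_h^n}{\Delta t}+(u_h^n\cdot\nabla) u_h^{n+1}\Big)\cdot v-p_h^{n+1}\,\mathrm{div}\,v+q\,\mathrm{div}\,u_h^{n+1}+(1-\varepsilon)\nabla u_h^{n+1}:\nabla v\\&+\tfrac{\varepsilon}{\mathrm{Wi}}\,\pi_h e^{\psi_h^{n+1}}:\nabla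 v+\tfrac{\psi_h^{n+1}-\Psi^n}{\Delta t}:\phi-\big(\Omega_h^{n+1}\pi_h\psi_h^{n+1}-\pi_h\psi_h^{n+1}\,\Omega_h^{n+1}\big):\phi\\&-2B_h^{n+1}:\phi-\tfrac1{\mathrm{Wi}}\big(\pi_h e^{-\psi_h^{n+1}}-I\big):\phi\Big]+J^n(\phi),\end{aligned}$$ where * (characteristic method) $J^n=0$ and $\Psi^n=(\pi_h\psi_h^n)\circ X^n(t^n)$, with $X^n$ the backward flow of $u_h^n$: $\frac{d}{dt}X^n(t,x)=u_h^n(X^n(t,x))$ for $t\in[t^n,t^{n+1}]$ and $X^n(t^{n+1},x)=x$, for $x\in\mathcal D$; * (discontinuous Galerkin method) $\Psi^n=\pi_h\psi_h^n$ and $J^n(\phi)=\sum_E\int_E|u_h^n\cdot n_E|\,(\chi^+-\chi^-):\phi^+$ with $\chi=\pi_h\psi_h^{n+1}$. The sum runs over the internal edges (faces if $d=3$) $E$ of the mesh, $n_E$ is a unit normal to $E$, and $\phi^\pm(x)=\lim_{\delta\to0^\pm}\phi(x+\delta u_h^n(x))$, likewise for $\chi^\pm$. **Proposition.** For every solution of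 either scheme, the free energy $$F_h^n=F(u_h^n,e^{\pi_h\psi_h^n})=\frac{\mathrm{Re}}2\int_{\mathcal D}|u_h^n|^2+\frac{\varepsilon}{2\mathrm{Wi}}\int_{\mathcal D}\operatorname{tr}\big(e^{\pi_h\psi_h^n}-\pi_h\psi_h^n-I\big)$$ satisfies, for all $0\le n<N_T$, $$F_h^{n+1}-F_h^n+\int_{\mathcal D}\frac{\mathrm{Re}}2|u_h^{n+1}-u_h^n|^2+\Delta t\int_{\mathcal D}\Big[(1-\varepsilon)|\nabla u_h^{n+1}|^2+\frac{\varepsilon}{2\mathrm{Wi}^2}\operatorname{tr}\big(e^{\pi_h\psi_h^{n+1}}+e^{-\pi_h\psi_h^{n+1}}-2I\big)\Big]\le0.$$ In particular, the sequence $(F_h^n)_{0\le n\le N_T}$ is non-increasing. -/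

import Mathlib

open MeasureTheory Set Filter Topology

namespace OldroydB

noncomputable section

/-- Euclidean space `ℝ^d`. -/
abbrev Pt (d : ℕ) : Type := EuclideanSpace ℝ (Fin d)

/-- `d × d` real matrices. -/
abbrev Mat (d : ℕ) : Type := Matrix (Fin d) (Fin d) ℝ

/-- Double contraction `A : B = tr (A Bᵀ)`. -/
def ddot {d : ℕ} (A B : Mat d) : ℝ := (A * B.transpose).trace

/-! ### Meshes -/

/-- A conformal simplicial mesh of `ℝ^d` with `NK` elements: nondegenerate `d`-simplices with
pairwise distinct vertex sets, any two of which (as closed sets) meet exactly in the convex hull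
of their common vertices. -/
structure Mesh (d NK : ℕ) where
  /-- the elements -/
  elt : Fin NK → Affine.Simplex ℝ (Pt d) d
  distinct : ∀ k l, range (elt k).points = range (elt l).points → k = l
  conformal : ∀ k l,
    convexHull ℝ (range (elt k).points) ∩ convexHull ℝ (range (elt l).points) =
      convexHull ℝ (range (elt k).points ∩ range (elt l).points)

namespace Mesh

variable {d NK : ℕ} (T : Mesh d NK)

/-- The closed element `K_k`. -/
def closedElt (k : Fin NK) : Set (Pt d) := convexHull ℝ (range (T.elt k).points)

/-- The open element. -/
def openElt (k : Fin NK) : Set (Pt d) := interior (T.closedElt k)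

/-- The open polyhedral set `𝒟` tessellated by the mesh. -/
def domain : Set (Pt d) := interior (⋃ k, T.closedElt k)

/-- The barycenter `θ_k` of `K_k`. -/
def barycenter (k : Fin NK) : Pt d := ((d : ℝ) + 1)⁻¹ • ∑ i, (T.elt k).points i

/-- The `(d-1)`-dimensional face of `K_k` opposite to its `i`-th vertex. -/
def face (k : Fin NK) (i : Fin (d + 1)) : Set (Pt d) := convexHull ℝ ((T.elt k).points '' {i}ᶜ)

/-- The internal edges (`d = 2`) or faces (`d = 3`): the faces shared by two distinct elements. -/
def internalFaces : Set (Set (Pt d)) :=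
  {F | ∃ k l, k ≠ l ∧ (∃ i, F = T.face k i) ∧ ∃ j, F = T.face l j}

/-- The piecewise constant interpolation `π_h φ` at the barycenters: `π_h φ = φ(θ_k)` in the
open element `K_k` (and, by convention, `0` off the open elements). -/
def interp {M : Type*} [AddCommMonoid M] (φ : Pt d → M) (x : Pt d) : M :=
  ∑ k, (T.openElt k).indicator (fun _ => φ (T.barycenter k)) x

/-! ### Finite element spaces -/

/-- `f` agrees on `s` with a polynomial of total degree at most `m`. -/
def IsPolyOn (m : ℕ) (f : Pt d → ℝ) (s : Set (Pt d)) : Prop :=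
  ∃ P : MvPolynomial (Fin d) ℝ, P.totalDegree ≤ m ∧
    ∀ x ∈ s, f x = MvPolynomial.eval (fun i => x i) P

/-- `ℙ_{m,disc}`: polynomials of degree at most `m` in each open element (the values off the open
elements, which form a null set of the domain, are irrelevant). -/
def polyDisc (m : ℕ) : Set (Pt d → ℝ) := {f | ∀ k, IsPolyOn m f (T.openElt k)}

/-- Continuous piecewise affine functions `ℙ₁`. -/
def polyCont1 : Set (Pt d → ℝ) :=
  {f | ContinuousOn f (closure T.domain) ∧ f ∈ T.polyDisc 1}

/-- `ℙ₁ + ℙ₀`. -/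
def polyCont1AddConst : Set (Pt d → ℝ) :=
  {f | ∃ g ∈ T.polyCont1, ∃ c ∈ T.polyDisc 0, ∀ x, f x = g x + c x}

/-- The velocity space: continuous vector fields, componentwise polynomial of degree at most `2`
in each element, that vanish on the boundary of the domain; they are extended by `0` outside. -/
def velocitySpace : Set (Pt d → Pt d) :=
  {v | Continuous v ∧ (∀ k i, IsPolyOn 2 (fun x => v x i) (T.closedElt k)) ∧
    ∀ x, x ∉ T.domain → v x = 0}

/-- Matrix fields with all entries in `V`. -/
def matrixFields (V : Set (Pt d → ℝ)) : Set (Pt d → Mat d) :=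
  {φ | ∀ i j, (fun x => φ x i j) ∈ V}

/-- Symmetric matrix fields with all entries in `V`, i.e. `V^{d(d+1)/2}`. -/
def symFields (V : Set (Pt d → ℝ)) : Set (Pt d → Mat d) :=
  {φ | φ ∈ matrixFields V ∧ ∀ x, (φ x).IsSymm}

end Mesh

variable {d NK : ℕ}

/-! ### Differential operators, jumps, flow -/

/-- The velocity gradient, `(∇v)_{ij} = ∂_j v_i`. -/
def grad (v : Pt d → Pt d) (x : Pt d) : Mat d :=
  Matrix.of fun i j => fderiv ℝ v x (EuclideanSpace.single j 1) i

/-- The divergence `div v = tr ∇v`. -/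
def divg (v : Pt d → Pt d) (x : Pt d) : ℝ := (grad v x).trace

/-- Downstream value `φ⁺(x) = lim_{δ → 0⁺} φ(x + δ w(x))`. -/
def downstream (w : Pt d → Pt d) (φ : Pt d → Mat d) (x : Pt d) : Mat d :=
  limUnder (𝓝[>] (0 : ℝ)) fun δ => φ (x + δ • w x)

/-- Upstream value `φ⁻(x) = lim_{δ → 0⁻} φ(x + δ w(x))`. -/
def upstream (w : Pt d → Pt d) (φ : Pt d → Mat d) (x : Pt d) : Mat d :=
  limUnder (𝓝[<] (0 : ℝ)) fun δ => φ (x + δ • w x)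

/-- The jump `⟦φ⟧ = φ⁺ - φ⁻`. -/
def jump (w : Pt d → Pt d) (φ : Pt d → Mat d) (x : Pt d) : Mat d :=
  downstream w φ x - upstream w φ x

/-- A unit vector orthogonal to the face `F` (unique up to sign for a `(d-1)`-simplex). -/
def unitNormal (F : Set (Pt d)) : Pt d :=
  Classical.epsilon fun n => ‖n‖ = 1 ∧ ∀ x ∈ F, ∀ y ∈ F, inner ℝ n (x - y) = 0

/-- `∑_j ∫_{E_j} |w·n| ⟦ψ⟧ : φ⁺` over the internal faces, with their `(d-1)`-dimensional
surface measure. -/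
def jumpForm (T : Mesh d NK) (w : Pt d → Pt d) (ψ φ : Pt d → Mat d) : ℝ :=
  ∑ᶠ F ∈ T.internalFaces,
    ∫ x in F, |inner ℝ (w x) (unitNormal F)| * ddot (jump w ψ x) (downstream w φ x) ∂μHE[d - 1]

/-- `X` is the backward flow of `w` on `[a, b]`: for all `x` in the domain,
`dX/dt (t, x) = w (X (t, x))` on `[a, b]`, and `X (b, x) = x`. -/
def IsBackwardFlow (T : Mesh d NK) (w : Pt d → Pt d) (a b : ℝ) (X : ℝ → Pt d → Pt d) : Prop :=
  ∀ x ∈ T.domain, X b x = x ∧ ∀ t ∈ Icc a b, X t x ∈ T.domain ∧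
    HasDerivWithinAt (fun s => X s x) (w (X t x)) (Icc a b) t

/-! ### The schemes -/

/-- `∇u = Ω + B + N (π_h e^ψ)⁻¹` in every element, where `Ω, B, N` are elementwise affine, `Ω, N`
are antisymmetric, and `B` is symmetric and commutes with `π_h e^ψ`. -/
def IsDecomposition (T : Mesh d NK) (u : Pt d → Pt d) (ψ Ω B N : Pt d → Mat d) : Prop :=
  Ω ∈ Mesh.matrixFields (T.polyDisc 1) ∧ B ∈ Mesh.matrixFields (T.polyDisc 1) ∧
  N ∈ Mesh.matrixFields (T.polyDisc 1) ∧
  ∀ k, ∀ x ∈ T.openElt k,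
    (Ω x).transpose = -Ω x ∧ (N x).transpose = -N x ∧ (B x).transpose = B x ∧
    Commute (B x) (T.interp (fun y => NormedSpace.exp (ψ y)) x) ∧
    grad u x = Ω x + B x + N x * (T.interp (fun y => NormedSpace.exp (ψ y)) x)⁻¹

/-- The sum of the volume integrals of the schemes. `u₀` is the velocity at the previous time,
`Ψ₀` is the transported (or untransported) interpolated log-conformation at the previous time,
`(u, p, ψ)` are the unknowns and `(v, q, φ)` the test functions. -/
def volumeForm (T : Mesh d NK) (Re Wi ε dt : ℝ)
    (u₀ : Pt d → Pt d) (Ψ₀ : Pt d → Mat d)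
    (u : Pt d → Pt d) (p : Pt d → ℝ) (ψ Ω B : Pt d → Mat d)
    (v : Pt d → Pt d) (q : Pt d → ℝ) (φ : Pt d → Mat d) : ℝ :=
  ∫ x in T.domain,
    (Re * inner ℝ (dt⁻¹ • (u x - u₀ x) + fderiv ℝ u x (u₀ x)) (v x)
      - p x * divg v x + q x * divg u x
      + (1 - ε) * ddot (grad u x) (grad v x)
      + ε / Wi * ddot (T.interp (fun y => NormedSpace.exp (ψ y)) x) (grad v x)
      + ddot (dt⁻¹ • (ψ x - Ψ₀ x)) (φ x)
      - ddot (Ω x * T.interp ψ x - T.interp ψ x * Ω x) (φ x)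
      - 2 * ddot (B x) (φ x)
      - 1 / Wi * ddot (T.interp (fun y => NormedSpace.exp (-ψ y)) x - 1) (φ x))

/-- The sequences live in the finite element spaces (`S` for the log-conformation), and the
initial velocity satisfies the discrete incompressibility constraint. -/
def IsDiscreteSequence (T : Mesh d NK) (S : Set (Pt d → Mat d)) (NT : ℕ)
    (u : ℕ → Pt d → Pt d) (p : ℕ → Pt d → ℝ) (ψ : ℕ → Pt d → Mat d) : Prop :=
  (∀ n ≤ NT, u n ∈ T.velocitySpace ∧ p n ∈ T.polyDisc 1 ∧ ψ n ∈ S) ∧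
  ∀ q ∈ T.polyDisc 1, ∫ x in T.domain, q x * divg (u 0) x = 0

/-- Solutions of the log-formulation scheme with the characteristic method
(`t^n = n * dt`). -/
def IsCharacteristicSolution (T : Mesh d NK) (S : Set (Pt d → Mat d)) (Re Wi ε dt : ℝ) (NT : ℕ)
    (u : ℕ → Pt d → Pt d) (p : ℕ → Pt d → ℝ) (ψ : ℕ → Pt d → Mat d) : Prop :=
  IsDiscreteSequence T S NT u p ψ ∧
  ∀ n < NT, ∃ X : ℝ → Pt d → Pt d, ∃ Ω B N : Pt d → Mat d,
    IsBackwardFlow T (u n) (n * dt) ((n + 1) * dt) X ∧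
    IsDecomposition T (u (n + 1)) (ψ (n + 1)) Ω B N ∧
    ∀ v ∈ T.velocitySpace, ∀ q ∈ T.polyDisc 1, ∀ φ ∈ S,
      0 = volumeForm T Re Wi ε dt (u n) (fun x => T.interp (ψ n) (X (n * dt) x))
        (u (n + 1)) (p (n + 1)) (ψ (n + 1)) Ω B v q φ

/-- Solutions of the log-formulation scheme with the discontinuous Galerkin method. -/
def IsDGSolution (T : Mesh d NK) (S : Set (Pt d → Mat d)) (Re Wi ε dt : ℝ) (NT : ℕ)
    (u : ℕ → Pt d → Pt d) (p : ℕ → Pt d → ℝ) (ψ : ℕ → Pt d → Mat d) : Prop :=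
  IsDiscreteSequence T S NT u p ψ ∧
  ∀ n < NT, ∃ Ω B N : Pt d → Mat d,
    IsDecomposition T (u (n + 1)) (ψ (n + 1)) Ω B N ∧
    ∀ v ∈ T.velocitySpace, ∀ q ∈ T.polyDisc 1, ∀ φ ∈ S,
      0 = volumeForm T Re Wi ε dt (u n) (T.interp (ψ n))
          (u (n + 1)) (p (n + 1)) (ψ (n + 1)) Ω B v q φ
        + jumpForm T (u n) (T.interp (ψ (n + 1))) φ

/-! ### Free energy -/

/-- `F(u, e^Ψ) = Re/2 ∫ |u|² + ε/(2 Wi) ∫ tr(e^Ψ - Ψ - I)`. -/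
def freeEnergy (T : Mesh d NK) (Re Wi ε : ℝ) (u : Pt d → Pt d) (Ψ : Pt d → Mat d) : ℝ :=
  Re / 2 * (∫ x in T.domain, ‖u x‖ ^ 2)
    + ε / (2 * Wi) * (∫ x in T.domain, (NormedSpace.exp (Ψ x) - Ψ x - 1).trace)

/-- The free energy `F_h^n = F(u_h^n, e^{π_h ψ_h^n})`. -/
def discreteEnergy (T : Mesh d NK) (Re Wi ε : ℝ)
    (u : ℕ → Pt d → Pt d) (ψ : ℕ → Pt d → Mat d) (n : ℕ) : ℝ :=
  freeEnergy T Re Wi ε (u n) (T.interp (ψ n))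

/-- The discrete free energy inequality at every time step, and monotonicity of the free
energy. -/
def FreeEnergyEstimate (T : Mesh d NK) (Re Wi ε dt : ℝ) (NT : ℕ)
    (u : ℕ → Pt d → Pt d) (ψ : ℕ → Pt d → Mat d) : Prop :=
  (∀ n < NT,
    discreteEnergy T Re Wi ε u ψ (n + 1) - discreteEnergy T Re Wi ε u ψ n
      + (∫ x in T.domain, Re / 2 * ‖u (n + 1) x - u n x‖ ^ 2)
      + dt * (∫ x in T.domain,
          ((1 - ε) * ddot (grad (u (n + 1)) x) (grad (u (n + 1)) x)
            + ε / (2 * Wi ^ 2) *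
              (NormedSpace.exp (T.interp (ψ (n + 1)) x)
                + NormedSpace.exp (-T.interp (ψ (n + 1)) x) - (2 : ℝ) • (1 : Mat d)).trace))
      ≤ 0) ∧
  ∀ m n, m ≤ n → n ≤ NT → discreteEnergy T Re Wi ε u ψ n ≤ discreteEnergy T Re Wi ε u ψ m

end

end OldroydB

/-! Everything comes from one choice of test functions: `v = u^{n+1}`, `q = p^{n+1}` and `φ =
ε/(2Wi) (π_h e^ψ - I)` with `ψ = ψ^{n+1}`. The last is constant and symmetric on each element, hence
admissible in both stress spaces. A preliminary test with `v = 0`, `φ = 0` and `q` free gives `div u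
= 0` on every open element, because `div u` is itself elementwise affine and may be used as `q`
(`divg_eq_zero_of_integral_eq_zero`).

With these tests the pressure terms cancel. The difference quotient of `u` gives the kinetic terms
by polarisation. The convection term is half the integral of `div (|u^{n+1}|² u^n)`, which vanishes
because its argument is continuous and zero off the domain (`integral_advection_eq_zero`). The work
of the extra stress cancels against the `Ω` and `B` terms (`stress_cancellation`), and the
relaxation term is the trace of `e^ψ + e^{-ψ} - 2I` (`ddot_exp_neg_sub_one`).

There remains the increment of `ψ`. Since `φ` is elementwise constant and `ψ` elementwise affine,
exactness of the barycenter rule on affine functions replaces `ψ` by `π_h ψ`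
(`integral_ddot_sub_interp_eq_zero`). The function `a ↦ tr (e^a - a - I)` is convex with gradient
`e^a - I`; its tangent inequality `entropy_sub_le`, a form of Klein's inequality, bounds the term
below by the increment of entropy from `Ψ^n` to `π_h ψ^{n+1}`. This much is common to both schemes
(`le_volumeForm`).

For characteristics, the entropy of `π_h ψ^n ∘ X` must not exceed that of `π_h ψ^n`. As the entropy
is nonnegative, it suffices that preimages under `X` are no larger than the original sets. The
velocity is only Lipschitz across faces, so this is obtained from explicit Euler steps: each has
Jacobian at least `1 - O(h²)` when the divergence vanishes, and `N` steps of size `τ/N` lose only a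
factor `1 - O(1/N)`.

For discontinuous Galerkin, the jump form must be nonnegative (`jumpForm_nonneg`). The tangent
inequality on each internal face, with the test function on the downstream side, bounds it below by
a sum over elements of the entropy times the total flux through the boundary of the element. That
flux is zero by the divergence theorem on a simplex, and faces that are not shared carry no flux
since the velocity vanishes there. -/

namespace OldroydB
noncomputable section

/-! ### Geometry of the mesh: elements, barycenters, null boundaries. -/

namespace Mesh

variable {d NK : ℕ} (T : Mesh d NK)

/-- The vertices of `K_k`, as an affine basis. -/
def basis (k : Fin NK) : AffineBasis (Fin (d + 1)) ℝ (Pt d) :=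
  ⟨(T.elt k).points, (T.elt k).independent, by
    rw [(T.elt k).independent.affineSpan_eq_top_iff_card_eq_finrank_add_one]; simp⟩

lemma basis_apply (k : Fin NK) (i : Fin (d + 1)) : T.basis k i = (T.elt k).points i := rfl

lemma coe_basis (k : Fin NK) : (T.basis k : Fin (d + 1) → Pt d) = (T.elt k).points := rfl

lemma closedElt_eq (k : Fin NK) :
    T.closedElt k = {x | ∀ i, 0 ≤ (T.basis k).coord i x} :=
  (T.basis k).convexHull_eq_nonneg_coord

lemma openElt_eq (k : Fin NK) :
    T.openElt k = {x | ∀ i, 0 < (T.basis k).coord i x} :=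
  (T.basis k).interior_convexHull

lemma isOpen_openElt (k : Fin NK) : IsOpen (T.openElt k) := isOpen_interior

lemma openElt_subset (k : Fin NK) : T.openElt k ⊆ T.closedElt k := interior_subset

lemma isCompact_closedElt (k : Fin NK) : IsCompact (T.closedElt k) :=
  (finite_range _).isCompact_convexHull ℝ

lemma convex_closedElt (k : Fin NK) : Convex ℝ (T.closedElt k) := convex_convexHull _ _

lemma isClosed_closedElt (k : Fin NK) : IsClosed (T.closedElt k) :=
  (T.isCompact_closedElt k).isClosed

lemma isOpen_domain : IsOpen T.domain := isOpen_interior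

lemma isCompact_iUnion_closedElt : IsCompact (⋃ k, T.closedElt k) :=
  isCompact_iUnion T.isCompact_closedElt

lemma domain_subset : T.domain ⊆ ⋃ k, T.closedElt k := interior_subset

lemma openElt_subset_domain (k : Fin NK) : T.openElt k ⊆ T.domain :=
  interior_mono (subset_iUnion T.closedElt k)

lemma barycenter_eq (k : Fin NK) :
    T.barycenter k = Finset.univ.centroid ℝ (T.basis k) := by
  rw [Finset.centroid_def, Finset.affineCombination_eq_linear_combination _ _ _
    (Finset.sum_centroidWeights_eq_one_of_nonempty _ _ Finset.univ_nonempty)]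
  simp [barycenter, Finset.centroidWeights, Finset.smul_sum, coe_basis]

lemma barycenter_mem (k : Fin NK) : T.barycenter k ∈ T.openElt k := by
  rw [barycenter_eq]
  exact (T.basis k).centroid_mem_interior_convexHull

/-- By conformity `x` lies in the hull of the common vertices, and the `i`-th barycentric coordinate
vanishes there unless vertex `i` is common. -/
lemma point_mem_of_coord_pos {k l : Fin NK} {x : Pt d} {i : Fin (d + 1)}
    (hk : x ∈ T.closedElt k) (hl : x ∈ T.closedElt l) (hi : 0 < (T.basis k).coord i x) :
    (T.elt k).points i ∈ range (T.elt l).points := by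
  by_contra hc
  have hx : x ∈ convexHull ℝ (range (T.elt k).points ∩ range (T.elt l).points) := by
    rw [← T.conformal k l]; exact ⟨hk, hl⟩
  have hsub : convexHull ℝ (range (T.elt k).points ∩ range (T.elt l).points) ⊆
      (T.basis k).coord i ⁻¹' {0} := by
    apply convexHull_min
    · rintro y ⟨⟨j, rfl⟩, hj⟩
      have hij : i ≠ j := by rintro rfl; exact hc hj
      simp [← T.basis_apply, (T.basis k).coord_apply_ne hij]
    · exact (convex_singleton (0 : ℝ)).affine_preimage _
  exact hi.ne' (hsub hx)

lemma eq_of_points_subset {k l : Fin NK}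
    (h : range (T.elt k).points ⊆ range (T.elt l).points) : k = l := by
  apply T.distinct
  apply Set.eq_of_subset_of_ncard_le h
  rw [← image_univ, ← image_univ, ncard_image_of_injective _ (T.elt k).independent.injective,
    ncard_image_of_injective _ (T.elt l).independent.injective]

/-- All barycentric coordinates are positive inside, so every vertex of `K_k` is a vertex of `K_l`;
both have `d + 1` vertices, and distinct elements have distinct vertex sets. -/
lemma eq_of_mem_openElt_of_mem_closedElt {k l : Fin NK} {x : Pt d}
    (hk : x ∈ T.openElt k) (hl : x ∈ T.closedElt l) : k = l := by
  apply T.eq_of_points_subset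
  rintro _ ⟨i, rfl⟩
  have := hk
  rw [openElt_eq] at this
  exact T.point_mem_of_coord_pos (T.openElt_subset k hk) hl (this i)

lemma disjoint_openElt {k l : Fin NK} (h : k ≠ l) : Disjoint (T.openElt k) (T.openElt l) :=
  Set.disjoint_left.2 fun _ hk hl =>
    h (T.eq_of_mem_openElt_of_mem_closedElt hk (T.openElt_subset l hl))

lemma interp_of_mem {M : Type*} [AddCommMonoid M] (φ : Pt d → M) {k : Fin NK} {x : Pt d}
    (hx : x ∈ T.openElt k) : T.interp φ x = φ (T.barycenter k) := by
  unfold interp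
  rw [Finset.sum_eq_single k]
  · simp [hx]
  · intro l _ hl
    rw [indicator_of_notMem]
    intro h
    exact Set.disjoint_left.1 (T.disjoint_openElt hl) h hx
  · simp

lemma interp_of_notMem {M : Type*} [AddCommMonoid M] (φ : Pt d → M) {x : Pt d}
    (hx : ∀ k, x ∉ T.openElt k) : T.interp φ x = 0 :=
  Finset.sum_eq_zero fun k _ => indicator_of_notMem (hx k) _

lemma volume_closedElt_diff (k : Fin NK) : volume (T.closedElt k \ T.openElt k) = 0 :=
  measure_mono_null (sdiff_subset_sdiff_left subset_closure)
    ((T.convex_closedElt k).addHaar_frontier volume)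

lemma ae_mem_openElt_or : ∀ᵐ x : Pt d, (∃ k, x ∈ T.openElt k) ∨ x ∉ ⋃ k, T.closedElt k := by
  have h : ∀ᵐ x : Pt d, ∀ k, x ∉ T.closedElt k \ T.openElt k := by
    rw [ae_all_iff]
    exact fun k => measure_eq_zero_iff_ae_notMem.1 (T.volume_closedElt_diff k)
  filter_upwards [h] with x hx
  by_cases hm : x ∈ ⋃ k, T.closedElt k
  · left
    obtain ⟨k, hk⟩ := mem_iUnion.1 hm
    by_contra! hc
    exact hx k ⟨hk, hc k⟩
  · exact Or.inr hm

/-- The frontier of a convex set is null, so integrals over the domain may be computed element by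
element. -/
lemma domain_ae_eq : T.domain =ᵐ[volume] ⋃ k, T.openElt k := by
  filter_upwards [T.ae_mem_openElt_or] with x hx
  apply propext
  constructor
  · intro h
    rcases hx with h' | h'
    · exact mem_iUnion.2 h'
    · exact absurd (T.domain_subset h) h'
  · intro h
    obtain ⟨k, hk⟩ := mem_iUnion.1 h
    exact T.openElt_subset_domain k hk

lemma measurableSet_domain : MeasurableSet T.domain := T.isOpen_domain.measurableSet

lemma measurableSet_openElt (k : Fin NK) : MeasurableSet (T.openElt k) :=
  (T.isOpen_openElt k).measurableSet

lemma restrict_domain : (volume : Measure (Pt d)).restrict T.domain =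
    volume.restrict (⋃ k, T.openElt k) := Measure.restrict_congr_set T.domain_ae_eq

lemma ae_domain_mem_openElt : ∀ᵐ x ∂(volume.restrict T.domain), ∃ k, x ∈ T.openElt k := by
  rw [restrict_domain, ae_restrict_iff' (MeasurableSet.iUnion T.measurableSet_openElt)]
  exact Eventually.of_forall fun x hx => mem_iUnion.1 hx

lemma integrableOn_domain_iff {E : Type*} [NormedAddCommGroup E] {f : Pt d → E} :
    IntegrableOn f T.domain ↔ ∀ k, IntegrableOn f (T.openElt k) := by
  unfold IntegrableOn
  rw [restrict_domain]
  exact integrableOn_finite_iUnion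

lemma integral_domain {E : Type*} [NormedAddCommGroup E] [NormedSpace ℝ E] {f : Pt d → E}
    (hf : ∀ k, IntegrableOn f (T.openElt k)) :
    ∫ x in T.domain, f x = ∑ k, ∫ x in T.openElt k, f x := by
  rw [restrict_domain]
  exact integral_iUnion_fintype T.measurableSet_openElt
    (fun _ _ h => T.disjoint_openElt h) hf

end Mesh
end
end OldroydB

/-! ### Gluing Lipschitz bounds; calculus of polynomials on Euclidean space. -/

namespace OldroydB
noncomputable section

/-- Along the segment from `x` to `y` the distance of `f` to `f x` has lower right slope at most `C
* dist x y`; a mean value inequality needing only lower right slopes then applies. No regularity of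
the way the segment crosses the pieces is required. -/
lemma lipschitzWith_of_finite_isClosed_cover {ι E F : Type*} [Finite ι] [NormedAddCommGroup E]
    [NormedSpace ℝ E] [PseudoMetricSpace F] {f : E → F} {C : NNReal} (hf : Continuous f)
    {A : ι → Set E} (hA : ∀ i, IsClosed (A i)) (hcov : ∀ x, ∃ i, x ∈ A i)
    (hLip : ∀ i, LipschitzOnWith C f (A i)) : LipschitzWith C f := by
  apply LipschitzWith.of_dist_le_mul
  intro x y
  set γ : ℝ → E := fun t => AffineMap.lineMap x y t with hγ
  have hγc : Continuous γ := AffineMap.lineMap_continuous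
  have key := image_le_of_liminf_slope_right_le_deriv_boundary
    (f := fun t => dist (f (γ t)) (f x)) (a := 0) (b := 1)
    (B := fun t => C * dist x y * t) (B' := fun _ => C * dist x y)
    (by fun_prop) (by simp [hγ]) (by fun_prop)
    (fun t _ => by simpa using ((hasDerivAt_id t).const_mul (C * dist x y)).hasDerivWithinAt)
    (fun t _ r hr => by
      -- Finitely many pieces: one of them is visited at times arbitrarily close to `t` from the
      -- right, and being closed it also contains `γ t`.
      have h1 : ∃ i, ∃ᶠ z in 𝓝[>] t, γ z ∈ A i := by
        by_contra! hc
        have := (eventually_all.2 hc).exists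
        obtain ⟨z, hz⟩ := this
        obtain ⟨i, hi⟩ := hcov (γ z)
        exact hz i hi
      obtain ⟨i, hi⟩ := h1
      have ht : γ t ∈ A i :=
        (hA i).mem_of_frequently_of_tendsto hi (hγc.continuousAt.mono_left nhdsWithin_le_nhds)
      refine (hi.and_eventually self_mem_nhdsWithin).mono ?_
      rintro z ⟨hz, htz⟩
      have htz : t < z := htz
      have hd : dist (γ z) (γ t) = (z - t) * dist x y := by
        rw [hγ]
        simp only [dist_lineMap_lineMap, Real.dist_eq, abs_of_pos (sub_pos.2 htz)]
      have h2 : dist (f (γ z)) (f (γ t)) ≤ C * ((z - t) * dist x y) := by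
        rw [← hd]; exact (hLip i).dist_le_mul _ hz _ ht
      have h3 := dist_triangle (f (γ z)) (f (γ t)) (f x)
      rw [slope_def_field]
      refine lt_of_le_of_lt ?_ hr
      rw [div_le_iff₀ (sub_pos.2 htz)]
      linarith) (right_mem_Icc.2 zero_le_one)
  simpa [hγ, dist_comm] using key

section poly
variable {d : ℕ}

lemma contDiff_eval (P : MvPolynomial (Fin d) ℝ) {n : WithTop ℕ∞} :
    ContDiff ℝ n (fun x : Pt d => MvPolynomial.eval (fun i => x i) P) := by
  induction P using MvPolynomial.induction_on with
  | C a => simpa using contDiff_const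
  | add p q hp hq => simpa using hp.add hq
  | mul_X p i hp =>
    simp only [map_mul, MvPolynomial.eval_X]
    exact hp.mul (by fun_prop)

lemma fderiv_eval (P : MvPolynomial (Fin d) ℝ) (x : Pt d) (j : Fin d) :
    fderiv ℝ (fun x : Pt d => MvPolynomial.eval (fun i => x i) P) x (EuclideanSpace.single j 1) =
      MvPolynomial.eval (fun i => x i) (MvPolynomial.pderiv j P) := by
  have hd (q : MvPolynomial (Fin d) ℝ) :
      DifferentiableAt ℝ (fun x : Pt d => MvPolynomial.eval (fun i => x i) q) x :=
    (contDiff_eval q (n := 1)).differentiable one_ne_zero x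
  induction P using MvPolynomial.induction_on with
  | C a => simp
  | add p q hp hq =>
    simp only [map_add]
    rw [fderiv_fun_add (hd p) (hd q)]
    simp [hp, hq]
  | mul_X p i hp =>
    simp only [map_mul, MvPolynomial.eval_X, Derivation.leibniz, map_add, smul_eq_mul]
    have hi : HasFDerivAt (fun y : Pt d => y i) (EuclideanSpace.proj i : Pt d →L[ℝ] ℝ) x :=
      (EuclideanSpace.proj i : Pt d →L[ℝ] ℝ).hasFDerivAt
    rw [fderiv_fun_mul (hd p) hi.differentiableAt, hi.fderiv]
    simp only [add_apply, smul_apply, hp, smul_eq_mul, MvPolynomial.pderiv_X,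
      PiLp.proj_apply]
    rcases eq_or_ne i j with rfl | h
    · simp
    · simp [h]

lemma totalDegree_pderiv_le {m : ℕ} (P : MvPolynomial (Fin d) ℝ) (hP : P.totalDegree ≤ m + 1)
    (j : Fin d) : (MvPolynomial.pderiv j P).totalDegree ≤ m := by
  classical
  rw [P.as_sum, map_sum]
  refine MvPolynomial.totalDegree_finsetSum_le fun s hs => ?_
  rw [MvPolynomial.pderiv_monomial]
  rcases eq_or_ne (s j) 0 with h | h
  · simp [h]
  · refine (MvPolynomial.totalDegree_monomial_le _ _).trans ?_
    have h1 := (MvPolynomial.le_totalDegree hs).trans hP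
    have h2 : Finsupp.single j 1 ≤ s := by
      rw [Finsupp.single_le_iff]; omega
    have h3 := congrArg Finsupp.degree (tsub_add_cancel_of_le h2)
    rw [map_add, Finsupp.degree_single] at h3
    have h4 : s.degree ≤ m + 1 := h1
    have : (s - Finsupp.single j 1).degree ≤ m := by omega
    exact this

end poly

variable {d NK : ℕ}

lemma differentiableAt_eval (P : MvPolynomial (Fin d) ℝ) (x : Pt d) :
    DifferentiableAt ℝ (fun x : Pt d => MvPolynomial.eval (fun i => x i) P) x :=
  (contDiff_eval P (n := 1)).differentiable one_ne_zero x

lemma grad_apply {v : Pt d → Pt d} {x : Pt d} (hv : DifferentiableAt ℝ v x) (i j : Fin d) :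
    grad v x i j = fderiv ℝ (fun y => v y i) x (EuclideanSpace.single j 1) := by
  have h := (EuclideanSpace.proj i : Pt d →L[ℝ] ℝ).hasFDerivAt.comp x hv.hasFDerivAt
  have h2 : fderiv ℝ (fun y => v y i) x = (EuclideanSpace.proj i : Pt d →L[ℝ] ℝ).comp (fderiv ℝ v x) :=
    h.fderiv
  rw [h2]; rfl

lemma differentiableAt_of_eqOn_eval {v : Pt d → Pt d} {s : Set (Pt d)} (hs : IsOpen s)
    {P : Fin d → MvPolynomial (Fin d) ℝ}
    (h : ∀ y ∈ s, ∀ i, v y i = MvPolynomial.eval (fun i => y i) (P i)) {x : Pt d} (hx : x ∈ s) :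
    DifferentiableAt ℝ v x := by
  rw [differentiableAt_euclidean]
  intro i
  refine (differentiableAt_eval (P i) x).congr_of_eventuallyEq ?_
  filter_upwards [hs.mem_nhds hx] with y hy using h y hy i

lemma grad_of_eqOn_eval {v : Pt d → Pt d} {s : Set (Pt d)} (hs : IsOpen s)
    {P : Fin d → MvPolynomial (Fin d) ℝ}
    (h : ∀ y ∈ s, ∀ i, v y i = MvPolynomial.eval (fun i => y i) (P i)) {x : Pt d} (hx : x ∈ s)
    (i j : Fin d) :
    grad v x i j = MvPolynomial.eval (fun i => x i) (MvPolynomial.pderiv j (P i)) := by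
  rw [grad_apply (differentiableAt_of_eqOn_eval hs h hx), ← fderiv_eval]
  congr 1
  apply Filter.EventuallyEq.fderiv_eq
  filter_upwards [hs.mem_nhds hx] with y hy using h y hy i

/-! ### Piecewise polynomial fields, their integrability, and integration by parts over the mesh. -/

namespace Mesh
variable (T : Mesh d NK)

/-- Functions that agree in each open element with a function continuous on the whole space. -/
def PwCont (f : Pt d → ℝ) : Prop := ∀ k, ∃ g : Pt d → ℝ, Continuous g ∧ EqOn f g (T.openElt k)

variable {T}

lemma PwCont.add {f g : Pt d → ℝ} (hf : T.PwCont f) (hg : T.PwCont g) :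
    T.PwCont (fun x => f x + g x) := fun k => by
  obtain ⟨a, ha, hfa⟩ := hf k
  obtain ⟨b, hb, hgb⟩ := hg k
  exact ⟨_, ha.add hb, fun x hx => by simp [hfa hx, hgb hx]⟩

lemma PwCont.mul {f g : Pt d → ℝ} (hf : T.PwCont f) (hg : T.PwCont g) :
    T.PwCont (fun x => f x * g x) := fun k => by
  obtain ⟨a, ha, hfa⟩ := hf k
  obtain ⟨b, hb, hgb⟩ := hg k
  exact ⟨_, ha.mul hb, fun x hx => by simp [hfa hx, hgb hx]⟩

lemma PwCont.const (c : ℝ) : T.PwCont (fun _ => c) := fun _ =>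
  ⟨_, continuous_const, fun _ _ => rfl⟩

lemma PwCont.const_mul {f : Pt d → ℝ} (c : ℝ) (hf : T.PwCont f) :
    T.PwCont (fun x => c * f x) := (PwCont.const c).mul hf

lemma PwCont.sub {f g : Pt d → ℝ} (hf : T.PwCont f) (hg : T.PwCont g) :
    T.PwCont (fun x => f x - g x) := by
  simpa [sub_eq_add_neg] using hf.add (hg.const_mul (-1))

lemma PwCont.sum {ι : Type*} (s : Finset ι) {f : ι → Pt d → ℝ} (hf : ∀ i ∈ s, T.PwCont (f i)) :
    T.PwCont (fun x => ∑ i ∈ s, f i x) := by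
  classical
  induction s using Finset.induction_on with
  | empty => simpa using PwCont.const 0
  | insert a s ha ih =>
    simp only [Finset.sum_insert ha]
    exact (hf a (Finset.mem_insert_self _ _)).add
      (ih fun i hi => hf i (Finset.mem_insert_of_mem hi))

lemma PwCont.of_polyDisc {m : ℕ} {f : Pt d → ℝ} (hf : f ∈ T.polyDisc m) : T.PwCont f := fun k =>
  let ⟨P, _, hP⟩ := hf k
  ⟨_, (contDiff_eval P (n := 0)).continuous, hP⟩

lemma PwCont.of_eqOn_const {f : Pt d → ℝ} {c : Fin NK → ℝ} (h : ∀ k, ∀ x ∈ T.openElt k, f x = c k) :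
    T.PwCont f := fun k => ⟨_, continuous_const, h k⟩

lemma PwCont.integrableOn_openElt {f : Pt d → ℝ} (hf : T.PwCont f) (k : Fin NK) :
    IntegrableOn f (T.openElt k) := by
  obtain ⟨g, hg, hfg⟩ := hf k
  rw [integrableOn_congr_fun hfg (T.measurableSet_openElt k)]
  exact (hg.continuousOn.integrableOn_compact (T.isCompact_closedElt k)).mono_set
    (T.openElt_subset k)

lemma PwCont.integrableOn {f : Pt d → ℝ} (hf : T.PwCont f) : IntegrableOn f T.domain :=
  T.integrableOn_domain_iff.2 hf.integrableOn_openElt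

lemma PwCont.of_continuous {f : Pt d → ℝ} (hf : Continuous f) : T.PwCont f := fun _ =>
  ⟨f, hf, fun _ _ => rfl⟩

lemma velocitySpace.exists_poly {v : Pt d → Pt d} (hv : v ∈ T.velocitySpace) (k : Fin NK) :
    ∃ P : Fin d → MvPolynomial (Fin d) ℝ, (∀ i, (P i).totalDegree ≤ 2) ∧
      ∀ y ∈ T.closedElt k, ∀ i, v y i = MvPolynomial.eval (fun i => y i) (P i) := by
  choose P hP h using hv.2.1 k
  exact ⟨P, hP, fun y hy i => h i y hy⟩

lemma velocitySpace.grad_mem {v : Pt d → Pt d} (hv : v ∈ T.velocitySpace) (i j : Fin d) :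
    (fun x => grad v x i j) ∈ T.polyDisc 1 := fun k => by
  obtain ⟨P, hP, h⟩ := velocitySpace.exists_poly hv k
  exact ⟨_, totalDegree_pderiv_le (P i) (hP i) j, fun x hx =>
    grad_of_eqOn_eval (T.isOpen_openElt k) (fun y hy => h y (T.openElt_subset k hy)) hx i j⟩

lemma velocitySpace.differentiableAt {v : Pt d → Pt d} (hv : v ∈ T.velocitySpace) {k : Fin NK}
    {x : Pt d} (hx : x ∈ T.openElt k) : DifferentiableAt ℝ v x := by
  obtain ⟨P, -, h⟩ := velocitySpace.exists_poly hv k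
  exact differentiableAt_of_eqOn_eval (T.isOpen_openElt k)
    (fun y hy => h y (T.openElt_subset k hy)) hx

lemma polyDisc.sum {m : ℕ} {ι : Type*} (s : Finset ι) {f : ι → Pt d → ℝ}
    (hf : ∀ i ∈ s, f i ∈ T.polyDisc m) : (fun x => ∑ i ∈ s, f i x) ∈ T.polyDisc m := fun k => by
  classical
  have h : ∀ i, ∃ P : MvPolynomial (Fin d) ℝ, i ∈ s → P.totalDegree ≤ m ∧
      ∀ x ∈ T.openElt k, f i x = MvPolynomial.eval (fun i => x i) P := fun i => by
    by_cases hi : i ∈ s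
    · obtain ⟨P, h1, h2⟩ := hf i hi k
      exact ⟨P, fun _ => ⟨h1, h2⟩⟩
    · exact ⟨0, fun h => absurd h hi⟩
  choose P hP using h
  refine ⟨∑ i ∈ s, P i, MvPolynomial.totalDegree_finsetSum_le fun i hi => (hP i hi).1,
    fun x hx => ?_⟩
  rw [map_sum]
  exact Finset.sum_congr rfl fun i hi => (hP i hi).2 x hx

lemma velocitySpace.divg_mem {v : Pt d → Pt d} (hv : v ∈ T.velocitySpace) :
    divg v ∈ T.polyDisc 1 :=
  polyDisc.sum Finset.univ fun i _ => velocitySpace.grad_mem hv i i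

variable (T) in
/-- Continuous functions that are polynomial on each element and vanish off the domain. -/
def contPoly : Set (Pt d → ℝ) :=
  {f | Continuous f ∧ (∀ k, ∃ m, IsPolyOn m f (T.closedElt k)) ∧ ∀ x, x ∉ T.domain → f x = 0}

lemma velocitySpace.apply_mem {v : Pt d → Pt d} (hv : v ∈ T.velocitySpace) (i : Fin d) :
    (fun x => v x i) ∈ T.contPoly :=
  ⟨by have := hv.1; fun_prop, fun k => ⟨2, hv.2.1 k i⟩, fun x hx => by simp [hv.2.2 x hx]⟩

lemma contPoly.mul {f g : Pt d → ℝ} (hf : f ∈ T.contPoly) (hg : g ∈ T.contPoly) :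
    (fun x => f x * g x) ∈ T.contPoly := by
  refine ⟨hf.1.mul hg.1, fun k => ?_, fun x hx => by simp [hf.2.2 x hx]⟩
  obtain ⟨_, P, _, hP⟩ := hf.2.1 k
  obtain ⟨_, Q, _, hQ⟩ := hg.2.1 k
  exact ⟨_, P * Q, le_rfl, fun x hx => by simp [hP x hx, hQ x hx]⟩

lemma contPoly.hasCompactSupport {f : Pt d → ℝ} (hf : f ∈ T.contPoly) : HasCompactSupport f := by
  refine HasCompactSupport.intro T.isCompact_iUnion_closedElt fun x hx => hf.2.2 x fun h => ?_
  exact hx (T.domain_subset h)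

/-- Smooth on each compact element and zero on the complement of the domain: together these closed
sets cover the space, and the Lipschitz bounds glue. The index `none` stands for the complement. -/
lemma contPoly.exists_lipschitzWith {f : Pt d → ℝ} (hf : f ∈ T.contPoly) :
    ∃ C, LipschitzWith C f := by
  have h : ∀ k, ∃ C, LipschitzOnWith C f (T.closedElt k) := fun k => by
    obtain ⟨_, P, _, hP⟩ := hf.2.1 k
    obtain ⟨C, hC⟩ := ((contDiff_eval P (n := 1)).locallyLipschitz.locallyLipschitzOn
      (s := T.closedElt k)).exists_lipschitzOnWith_of_compact (T.isCompact_closedElt k)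
    exact ⟨C, fun x hx y hy => by rw [hP x hx, hP y hy]; exact hC hx hy⟩
  choose C hC using h
  refine ⟨∑ k, C k, lipschitzWith_of_finite_isClosed_cover hf.1
    (A := fun o : Option (Fin NK) => o.elim T.domainᶜ T.closedElt) ?_ ?_ ?_⟩
  · rintro (_ | k)
    · exact T.isOpen_domain.isClosed_compl
    · exact T.isClosed_closedElt k
  · intro x
    by_cases hx : x ∈ T.domain
    · obtain ⟨k, hk⟩ := mem_iUnion.1 (T.domain_subset hx)
      exact ⟨some k, hk⟩
    · exact ⟨none, hx⟩
  · rintro (_ | k)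
    · intro x hx y hy
      rw [hf.2.2 x hx, hf.2.2 y hy]
      simp
    · exact (hC k).weaken (Finset.single_le_sum (fun _ _ => zero_le) (Finset.mem_univ k))

lemma contPoly.differentiableAt {f : Pt d → ℝ} (hf : f ∈ T.contPoly) {k : Fin NK}
    {x : Pt d} (hx : x ∈ T.openElt k) : DifferentiableAt ℝ f x := by
  obtain ⟨_, P, -, h⟩ := hf.2.1 k
  refine (differentiableAt_eval P x).congr_of_eventuallyEq ?_
  filter_upwards [(T.isOpen_openElt k).mem_nhds hx] with y hy using h y (T.openElt_subset k hy)

/-- Integration by parts against the constant `1`, valid for compactly supported Lipschitz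
functions, so no face terms between elements have to be tracked. -/
lemma contPoly.integral_fderiv_eq_zero {f : Pt d → ℝ} (hf : f ∈ T.contPoly) (e : Pt d) :
    ∫ x in T.domain, fderiv ℝ f x e = 0 := by
  obtain ⟨C, hC⟩ := contPoly.exists_lipschitzWith hf
  -- The formula reverses the direction when it moves the derivative, hence `-e` here.
  have h1 := LipschitzWith.integral_lineDeriv_mul_eq (μ := (volume : Measure (Pt d)))
    (LipschitzWith.const (1 : ℝ) (α := Pt d)) hC (contPoly.hasCompactSupport hf) (-e)
  simp only [neg_neg, mul_one] at h1
  have h2 : ∫ x in T.domain, fderiv ℝ f x e = ∫ x in T.domain, lineDeriv ℝ f x e := by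
    apply integral_congr_ae
    filter_upwards [T.ae_domain_mem_openElt] with x hx
    obtain ⟨k, hk⟩ := hx
    exact (contPoly.differentiableAt hf hk).lineDeriv_eq_fderiv.symm
  rw [h2, setIntegral_eq_integral_of_ae_compl_eq_zero, ← h1]
  · simp [lineDeriv]
  · filter_upwards [T.ae_mem_openElt_or] with x hx hxd
    have hx : x ∉ ⋃ k, T.closedElt k := by
      rcases hx with ⟨k, hk⟩ | h
      · exact absurd (T.openElt_subset_domain k hk) hxd
      · exact h
    have h0 : f =ᶠ[𝓝 x] fun _ => 0 := by
      filter_upwards [T.isCompact_iUnion_closedElt.isClosed.isOpen_compl.mem_nhds hx] with y hy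
      exact hf.2.2 y fun h => hy (T.domain_subset h)
    rw [h0.lineDeriv_eq]
    simp [lineDeriv]

lemma fderiv_apply_eq_sum_grad (v : Pt d → Pt d) (x w : Pt d) (i : Fin d) :
    (fderiv ℝ v x w) i = ∑ j, grad v x i j * w j := by
  have hw : w = ∑ j, w j • EuclideanSpace.single j (1 : ℝ) := by
    ext l
    simp [Finset.sum_apply, Pi.single_apply]
  conv_lhs => rw [hw, map_sum]
  simp [grad, mul_comm]

/-- Sum over `i, j` of `∂_j (u₀_j u_i²)`: each integrates to zero, and on an element the sum is `div
u₀ |u|² + 2 ((u₀ · ∇)u) · u`, whose first term vanishes. -/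
lemma velocitySpace.integral_advection_eq_zero {u₀ u : Pt d → Pt d} (hu₀ : u₀ ∈ T.velocitySpace)
    (hu : u ∈ T.velocitySpace) (hdiv : ∀ k, ∀ x ∈ T.openElt k, divg u₀ x = 0) :
    ∫ x in T.domain, inner ℝ (fderiv ℝ u x (u₀ x)) (u x) = 0 := by
  have hg : ∀ i j, (fun x => u₀ x j * (u x i * u x i)) ∈ T.contPoly := fun i j =>
    contPoly.mul (velocitySpace.apply_mem hu₀ j)
      (contPoly.mul (velocitySpace.apply_mem hu i) (velocitySpace.apply_mem hu i))
  have hderiv : ∀ i j, ∀ k, ∀ x ∈ T.openElt k,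
      fderiv ℝ (fun x => u₀ x j * (u x i * u x i)) x (EuclideanSpace.single j 1) =
        grad u₀ x j j * (u x i * u x i) + 2 * (grad u x i j * u₀ x j * u x i) := by
    intro i j k x hx
    have h0 := velocitySpace.differentiableAt hu₀ hx
    have h1 := velocitySpace.differentiableAt hu hx
    have h0j : DifferentiableAt ℝ (fun x => u₀ x j) x := differentiableAt_euclidean.1 h0 j
    have h1i : DifferentiableAt ℝ (fun x => u x i) x := differentiableAt_euclidean.1 h1 i
    rw [fderiv_fun_mul h0j (h1i.fun_mul h1i), fderiv_fun_mul h1i h1i]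
    simp only [add_apply, smul_apply, smul_eq_mul, ← grad_apply h0, ← grad_apply h1]
    ring
  have hint : ∀ i j, IntegrableOn (fun x => grad u₀ x j j * (u x i * u x i) +
      2 * (grad u x i j * u₀ x j * u x i)) T.domain := fun i j =>
    (((PwCont.of_polyDisc (velocitySpace.grad_mem hu₀ j j)).mul
      (.of_continuous (contPoly.mul (velocitySpace.apply_mem hu i)
        (velocitySpace.apply_mem hu i)).1)).add
      ((((PwCont.of_polyDisc (velocitySpace.grad_mem hu i j)).mul
        (.of_continuous (velocitySpace.apply_mem hu₀ j).1)).mul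
        (.of_continuous (velocitySpace.apply_mem hu i).1)).const_mul 2)).integrableOn
  have hzero : ∑ i, ∑ j, ∫ x in T.domain, (grad u₀ x j j * (u x i * u x i) +
      2 * (grad u x i j * u₀ x j * u x i)) = 0 := by
    refine Finset.sum_eq_zero fun i _ => Finset.sum_eq_zero fun j _ => ?_
    rw [← contPoly.integral_fderiv_eq_zero (hg i j) (EuclideanSpace.single j 1)]
    apply integral_congr_ae
    filter_upwards [T.ae_domain_mem_openElt] with x hx
    obtain ⟨k, hk⟩ := hx
    exact (hderiv i j k x hk).symm
  have h2 : 2 * ∫ x in T.domain, inner ℝ (fderiv ℝ u x (u₀ x)) (u x) = 0 := by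
    rw [← hzero, ← integral_const_mul]
    simp_rw [← integral_finsetSum _ (fun j _ => hint _ j)]
    rw [← integral_finsetSum _ (fun i _ => integrable_finsetSum _ fun j _ => hint i j)]
    apply integral_congr_ae
    filter_upwards [T.ae_domain_mem_openElt] with x hx
    obtain ⟨k, hk⟩ := hx
    have hd : ∑ j, grad u₀ x j j = 0 := hdiv k x hk
    simp_rw [Finset.sum_add_distrib, ← Finset.sum_mul, hd, zero_mul, Finset.sum_const_zero, zero_add,
      ← Finset.mul_sum]
    congr 1
    rw [PiLp.inner_apply]
    refine Finset.sum_congr rfl fun i _ => ?_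
    rw [fderiv_apply_eq_sum_grad, ← Finset.sum_mul]
    simp [mul_comm]
  linarith

end Mesh
end
end OldroydB

namespace OldroydB
noncomputable section

variable {d : ℕ}

/-! ### Symmetric matrices -/

lemma exists_orthogonal_diagonalization {A : Mat d} (hA : A.IsSymm) :
    ∃ (U : Mat d) (α : Fin d → ℝ), U * U.transpose = 1 ∧ U.transpose * U = 1 ∧
      A = U * Matrix.diagonal α * U.transpose := by
  have hH : A.IsHermitian := by
    rw [Matrix.IsHermitian, Matrix.conjTranspose_eq_transpose_of_trivial]; exact hA
  refine ⟨hH.eigenvectorUnitary, hH.eigenvalues, ?_, ?_, ?_⟩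
  · have := (Matrix.mem_unitaryGroup_iff (A := (hH.eigenvectorUnitary : Mat d))).1
      hH.eigenvectorUnitary.2
    rwa [Matrix.star_eq_conjTranspose, Matrix.conjTranspose_eq_transpose_of_trivial] at this
  · have := (Matrix.mem_unitaryGroup_iff' (A := (hH.eigenvectorUnitary : Mat d))).1
      hH.eigenvectorUnitary.2
    rwa [Matrix.star_eq_conjTranspose, Matrix.conjTranspose_eq_transpose_of_trivial] at this
  · have := hH.spectral_theorem
    rw [Unitary.conjStarAlgAut_apply] at this
    rw [Matrix.star_eq_conjTranspose, Matrix.conjTranspose_eq_transpose_of_trivial] at this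
    exact this

lemma exp_conj_diagonal {U : Mat d} (hU : U * U.transpose = 1) (α : Fin d → ℝ) :
    NormedSpace.exp (U * Matrix.diagonal α * U.transpose) =
      U * Matrix.diagonal (fun i => Real.exp (α i)) * U.transpose := by
  have hinv : U⁻¹ = U.transpose := Matrix.inv_eq_right_inv hU
  have hunit : IsUnit U := (Matrix.isUnit_iff_isUnit_det U).2
    (Matrix.isUnit_det_of_right_inverse hU)
  rw [← hinv, Matrix.exp_conj U _ hunit, Matrix.exp_diagonal]
  congr 3
  ext i
  rw [Pi.coe_exp, Real.exp_eq_exp_ℝ]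

/-- The squared overlaps of two orthonormal eigenbases act as nonnegative weights; through them an
inequality between traces of noncommuting matrices reduces to a scalar inequality for each pair of
eigenvalues. -/
lemma trace_conj_diagonal_mul (U V : Mat d) (α β : Fin d → ℝ) :
    ((U * Matrix.diagonal α * U.transpose) * (V * Matrix.diagonal β * V.transpose)).trace =
      ∑ i, ∑ j, α i * ((U.transpose * V) i j) ^ 2 * β j := by
  have h : ((U * Matrix.diagonal α * U.transpose) * (V * Matrix.diagonal β * V.transpose)).trace =
      (Matrix.diagonal α * (U.transpose * V) * Matrix.diagonal β *
        (U.transpose * V).transpose).trace := by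
    rw [Matrix.transpose_mul, Matrix.transpose_transpose]
    have : (U * Matrix.diagonal α * U.transpose) * (V * Matrix.diagonal β * V.transpose) =
      U * (Matrix.diagonal α * (U.transpose * V) * Matrix.diagonal β * V.transpose) := by
      simp only [Matrix.mul_assoc]
    rw [this, Matrix.trace_mul_comm]
    simp only [Matrix.mul_assoc]
  rw [h, Matrix.trace]
  refine Finset.sum_congr rfl fun i _ => ?_
  rw [Matrix.diag_apply, Matrix.mul_apply]
  refine Finset.sum_congr rfl fun j _ => ?_
  rw [Matrix.mul_diagonal, Matrix.diagonal_mul, Matrix.transpose_apply]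
  ring

/-- Klein's inequality for the exponential. -/
lemma trace_sub_mul_exp_le {a b : Mat d} (ha : a.IsSymm) (hb : b.IsSymm) :
    ((b - a) * NormedSpace.exp a).trace ≤
      (NormedSpace.exp b).trace - (NormedSpace.exp a).trace := by
  obtain ⟨U, α, hU, hU', rfl⟩ := exists_orthogonal_diagonalization ha
  obtain ⟨V, β, hV, hV', rfl⟩ := exists_orthogonal_diagonalization hb
  have h1U : (1 : Mat d) = U * Matrix.diagonal (fun _ => 1) * U.transpose := by
    simp [hU]
  have h1V : (1 : Mat d) = V * Matrix.diagonal (fun _ => 1) * V.transpose := by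
    simp [hV]
  have hmul : (U * Matrix.diagonal α * U.transpose) *
      (U * Matrix.diagonal (fun i => Real.exp (α i)) * U.transpose) =
      U * Matrix.diagonal (fun i => α i * Real.exp (α i)) * U.transpose := by
    rw [← Matrix.diagonal_mul_diagonal]
    calc _ = U * Matrix.diagonal α * (U.transpose * U) *
        Matrix.diagonal (fun i => Real.exp (α i)) * U.transpose := by simp only [Matrix.mul_assoc]
      _ = _ := by rw [hU', Matrix.mul_one]; simp only [Matrix.mul_assoc]
  rw [exp_conj_diagonal hU, exp_conj_diagonal hV, sub_mul, Matrix.trace_sub, hmul,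
    Matrix.trace_mul_comm (V * Matrix.diagonal β * V.transpose), trace_conj_diagonal_mul]
  -- Each trace involving one matrix only is multiplied by the identity written in the other
  -- eigenbasis, so that all terms become double sums with the same weights.
  rw [← Matrix.mul_one (U * Matrix.diagonal (fun i => α i * Real.exp (α i)) * U.transpose),
    ← Matrix.mul_one (U * Matrix.diagonal (fun i => Real.exp (α i)) * U.transpose),
    ← Matrix.one_mul (V * Matrix.diagonal (fun i => Real.exp (β i)) * V.transpose)]
  conv_lhs => rw [h1V]
  conv_rhs => arg 2; rw [h1V]
  conv_rhs => arg 1; rw [h1U]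
  simp only [trace_conj_diagonal_mul, ← Finset.sum_sub_distrib]
  refine Finset.sum_le_sum fun i _ => Finset.sum_le_sum fun j _ => ?_
  -- The scalar case is the tangent line of the exponential: `e^β ≥ e^α (1 + β - α)`.
  have h := Real.add_one_le_exp (β j - α i)
  have h2 : Real.exp (β j) = Real.exp (α i) * Real.exp (β j - α i) := by
    rw [← Real.exp_add]; ring_nf
  have h3 : 0 ≤ Real.exp (α i) * ((U.transpose * V) i j) ^ 2 := by positivity
  rw [h2]
  nlinarith [mul_le_mul_of_nonneg_left h h3]

/-- The free energy density `tr (e^a - a - I)`. -/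
def entropy (a : Mat d) : ℝ := (NormedSpace.exp a - a - 1).trace

/-- Klein's inequality based at the zero matrix. -/
lemma entropy_nonneg {a : Mat d} (ha : a.IsSymm) : 0 ≤ entropy a := by
  have h := trace_sub_mul_exp_le (a := 0) (b := a) Matrix.isSymm_zero ha
  simp only [sub_zero, NormedSpace.exp_zero, mul_one] at h
  simp only [entropy, Matrix.trace_sub]
  linarith

lemma ddot_comm (A B : Mat d) : ddot A B = ddot B A := by
  rw [ddot, ddot, ← Matrix.trace_transpose, Matrix.transpose_mul, Matrix.transpose_transpose]

lemma ddot_of_isSymm (A : Mat d) {B : Mat d} (hB : B.IsSymm) : ddot A B = (A * B).trace := by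
  rw [ddot, hB.eq]

lemma ddot_eq_sum (A B : Mat d) : ddot A B = ∑ i, ∑ j, A i j * B i j := by
  simp [ddot, Matrix.trace, Matrix.mul_apply]

lemma isSymm_exp {a : Mat d} (ha : a.IsSymm) : (NormedSpace.exp a).IsSymm := by
  rw [Matrix.IsSymm, ← Matrix.exp_transpose, ha.eq]

lemma exp_mul_exp_neg (a : Mat d) : NormedSpace.exp a * NormedSpace.exp (-a) = 1 := by
  rw [Matrix.exp_neg]
  exact Matrix.mul_nonsing_inv _ ((Matrix.isUnit_iff_isUnit_det _).1 (Matrix.isUnit_exp a))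

lemma commute_exp (a : Mat d) : Commute a (NormedSpace.exp a) :=
  (Commute.refl a).exp_right

/-- Convexity of the free energy density. -/
lemma entropy_sub_le {a b : Mat d} (ha : a.IsSymm) (hb : b.IsSymm) :
    entropy a - entropy b ≤ ddot (a - b) (NormedSpace.exp a - 1) := by
  have h := trace_sub_mul_exp_le ha hb
  rw [ddot_of_isSymm _ ((isSymm_exp ha).sub Matrix.isSymm_one), mul_sub, mul_one]
  simp only [entropy, Matrix.trace_sub, sub_mul] at h ⊢
  linarith

lemma trace_mul_eq_zero_of_transpose_eq_neg {A S : Mat d} (hA : A.transpose = -A)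
    (hS : S.IsSymm) : (A * S).trace = 0 := by
  have h : (A * S).trace = -(A * S).trace := by
    conv_lhs => rw [← Matrix.trace_transpose, Matrix.transpose_mul, hA, hS.eq]
    rw [Matrix.mul_neg, Matrix.trace_neg, Matrix.trace_mul_comm]
  linarith

lemma trace_eq_zero_of_transpose_eq_neg {A : Mat d} (hA : A.transpose = -A) : A.trace = 0 := by
  simpa using trace_mul_eq_zero_of_transpose_eq_neg hA Matrix.isSymm_one

/-- The cancellation between the work of the extra stress and the deformation terms. -/
lemma stress_cancellation {a G Ω B N : Mat d} (ha : a.IsSymm) (hΩ : Ω.transpose = -Ω)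
    (hN : N.transpose = -N) (hG : G = Ω + B + N * (NormedSpace.exp a)⁻¹) (htr : G.trace = 0)
    (c : ℝ) :
    2 * c * ddot (NormedSpace.exp a) G
      - ddot (Ω * a - a * Ω) (c • (NormedSpace.exp a - 1))
      - 2 * ddot B (c • (NormedSpace.exp a - 1)) = 0 := by
  set σ := NormedSpace.exp a with hσ
  have hs : σ.IsSymm := isSymm_exp ha
  have hunit : IsUnit σ.det := (Matrix.isUnit_iff_isUnit_det _).1 (Matrix.isUnit_exp a)
  have hsinv : (σ⁻¹).IsSymm := by rw [Matrix.IsSymm, Matrix.transpose_nonsing_inv, hs.eq]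
  have hφ : (c • (σ - 1)).IsSymm := (hs.sub Matrix.isSymm_one).smul c
  -- An antisymmetric `Ω` is orthogonal to the symmetric `σ`, and `N σ⁻¹ σ = N` is traceless: only
  -- `B` works against the stress.
  have h1 : ddot σ G = (B * σ).trace := by
    rw [ddot_comm, ddot_of_isSymm _ hs, hG, add_mul, add_mul, Matrix.trace_add, Matrix.trace_add,
      trace_mul_eq_zero_of_transpose_eq_neg hΩ hs, Matrix.mul_assoc, Matrix.nonsing_inv_mul _ hunit,
      Matrix.mul_one, trace_eq_zero_of_transpose_eq_neg hN]
    ring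
  -- `B` carries the whole trace of the gradient, so incompressibility removes the contribution of
  -- `-I` in the test function.
  have h2 : B.trace = 0 := by
    rw [hG, Matrix.trace_add, Matrix.trace_add, trace_eq_zero_of_transpose_eq_neg hΩ,
      trace_mul_eq_zero_of_transpose_eq_neg hN hsinv] at htr
    linarith
  -- Cyclicity of the trace moves `a` past `Ω`; it then meets `e^a - 1`, with which it commutes.
  have h3 : ((Ω * a - a * Ω) * (c • (σ - 1))).trace = 0 := by
    have hc : a * (σ - 1) = (σ - 1) * a := by
      rw [mul_sub, sub_mul, (commute_exp a).eq, mul_one, one_mul]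
    rw [Matrix.mul_smul, Matrix.trace_smul, sub_mul, Matrix.trace_sub, Matrix.mul_assoc,
      Matrix.mul_assoc a, Matrix.trace_mul_comm a, Matrix.mul_assoc Ω, ← hc, sub_self, smul_zero]
  rw [h1, ddot_of_isSymm _ hφ, ddot_of_isSymm _ hφ, h3]
  rw [Matrix.mul_smul, mul_sub, mul_one, Matrix.trace_smul, Matrix.trace_sub, h2, smul_eq_mul]
  ring

/-- Expand `(e^a - 1)(e^{-a} - 1) = 2 - e^a - e^{-a}`. -/
lemma ddot_exp_neg_sub_one {a : Mat d} (ha : a.IsSymm) (c : ℝ) :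
    ddot (NormedSpace.exp (-a) - 1) (c • (NormedSpace.exp a - 1)) =
      -c * (NormedSpace.exp a + NormedSpace.exp (-a) - (2 : ℝ) • (1 : Mat d)).trace := by
  rw [ddot_comm, ddot_of_isSymm _ ((isSymm_exp ha.neg).sub Matrix.isSymm_one), Matrix.smul_mul,
    sub_mul, mul_sub, exp_mul_exp_neg]
  simp only [Matrix.trace_smul, Matrix.trace_sub, Matrix.trace_add, mul_one, one_mul, smul_eq_mul]
  ring

/-- It is the sum of the entropies of `a` and `-a`, whose linear parts cancel. -/
lemma trace_exp_add_exp_neg_nonneg {a : Mat d} (ha : a.IsSymm) :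
    0 ≤ (NormedSpace.exp a + NormedSpace.exp (-a) - (2 : ℝ) • (1 : Mat d)).trace := by
  have h1 := entropy_nonneg ha
  have h2 := entropy_nonneg ha.neg
  simp only [entropy, Matrix.trace_sub, Matrix.trace_add, Matrix.trace_neg, Matrix.trace_smul,
    smul_eq_mul] at *
  linarith

lemma ddot_self_nonneg (A : Mat d) : 0 ≤ ddot A A := by
  rw [ddot_eq_sum]
  exact Finset.sum_nonneg fun i _ => Finset.sum_nonneg fun j _ => mul_self_nonneg _

end
end OldroydB

namespace OldroydB
noncomputable section

variable {d NK : ℕ}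

/-! ### Barycenter quadrature -/

lemma exists_affineMap_of_totalDegree_le_one {P : MvPolynomial (Fin d) ℝ}
    (hP : P.totalDegree ≤ 1) :
    ∃ f : Pt d →ᵃ[ℝ] ℝ, ∀ x : Pt d, MvPolynomial.eval (fun i => x i) P = f x := by
  have h : ∀ s ∈ P.support, ∃ g : Pt d →ᵃ[ℝ] ℝ, ∀ x : Pt d,
      P.coeff s * ∏ i, x i ^ s i = g x := by
    intro s hs
    have hdeg : s.degree ≤ 1 := (MvPolynomial.le_totalDegree hs).trans hP
    rcases Nat.le_one_iff_eq_zero_or_eq_one.1 hdeg with h0 | h1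
    · rw [Finsupp.degree_eq_zero_iff] at h0
      exact ⟨AffineMap.const ℝ _ (P.coeff s), fun x => by simp [h0]⟩
    · obtain ⟨i, rfl⟩ : ∃ i, s = Finsupp.single i 1 := by
        obtain ⟨i, hi⟩ : ∃ i, s i ≠ 0 := by
          by_contra! hc
          have : s = 0 := Finsupp.ext hc
          simp [this] at h1
        have h2 : Finsupp.single i 1 ≤ s := by rw [Finsupp.single_le_iff]; omega
        have h3 := congrArg Finsupp.degree (tsub_add_cancel_of_le h2)
        rw [map_add, Finsupp.degree_single, h1] at h3
        have h4 : (s - Finsupp.single i 1).degree = 0 := by omega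
        rw [Finsupp.degree_eq_zero_iff] at h4
        refine ⟨i, ?_⟩
        rw [← tsub_add_cancel_of_le h2, h4, zero_add]
      refine ⟨(P.coeff (Finsupp.single i 1) •
        (EuclideanSpace.proj i : Pt d →L[ℝ] ℝ).toLinearMap).toAffineMap, fun x => ?_⟩
      rw [Finset.prod_eq_single i]
      · simp
      · intro j _ hj
        simp [hj.symm]
      · simp
  choose! g hg using h
  refine ⟨∑ s ∈ P.support, g s, fun x => ?_⟩
  rw [MvPolynomial.eval_eq']
  have : ∀ t : Finset (Fin d →₀ ℕ), (∑ s ∈ t, g s) x = ∑ s ∈ t, g s x := fun t => by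
    classical
    induction t using Finset.induction_on with
    | empty => simp
    | insert a t ha ih => rw [Finset.sum_insert ha, Finset.sum_insert ha, ← ih]; rfl
  rw [this]
  exact Finset.sum_congr rfl fun s hs => hg s hs x

lemma hasFDerivAt_affineMap (f : Pt d →ᵃ[ℝ] ℝ) (x : Pt d) :
    HasFDerivAt f (LinearMap.toContinuousLinearMap f.linear) x := by
  have h : (f : Pt d → ℝ) = fun y => LinearMap.toContinuousLinearMap f.linear y + f 0 := by
    ext y
    exact congrFun (AffineMap.decomp f) y
  rw [h]
  exact (ContinuousLinearMap.hasFDerivAt _).add_const _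

/-- The affine reflection exchanging the vertices `i` and `j`. -/
def vertexSwap (b : AffineBasis (Fin (d + 1)) ℝ (Pt d)) (i j : Fin (d + 1)) (x : Pt d) : Pt d :=
  x + (b.coord i x - b.coord j x) • (b j - b i)

lemma coord_add_smul (b : AffineBasis (Fin (d + 1)) ℝ (Pt d)) (i j m : Fin (d + 1)) (x : Pt d)
    (c : ℝ) : b.coord m (x + c • (b j - b i)) =
      b.coord m x + c * ((if m = j then 1 else 0) - if m = i then 1 else 0) := by
  have h := (b.coord m).map_vadd x (c • (b j - b i))
  have h2 := (b.coord m).linearMap_vsub (b j) (b i)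
  rw [vsub_eq_sub, vsub_eq_sub] at h2
  rw [vadd_eq_add, vadd_eq_add] at h
  rw [add_comm x, h, map_smul, h2, b.coord_apply, b.coord_apply, smul_eq_mul, add_comm (_ * _)]

/-- In barycentric coordinates the reflection is a transposition, so it maps the open simplex to
itself. -/
lemma coord_vertexSwap (b : AffineBasis (Fin (d + 1)) ℝ (Pt d)) (i j m : Fin (d + 1)) (x : Pt d) :
    b.coord m (vertexSwap b i j x) = b.coord (Equiv.swap i j m) x := by
  rw [vertexSwap, coord_add_smul]
  rcases eq_or_ne m i with rfl | hi
  · rcases eq_or_ne m j with rfl | hj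
    · simp
    · simp [hj]
  · rcases eq_or_ne m j with rfl | hj
    · simp [hi]
    · simp [hi, hj, Equiv.swap_apply_of_ne_of_ne hi hj]

lemma vertexSwap_vertexSwap (b : AffineBasis (Fin (d + 1)) ℝ (Pt d)) (i j : Fin (d + 1))
    (x : Pt d) : vertexSwap b i j (vertexSwap b i j x) = x := by
  have h1 := coord_vertexSwap b i j i x
  have h2 := coord_vertexSwap b i j j x
  rw [Equiv.swap_apply_left] at h1
  rw [Equiv.swap_apply_right] at h2
  conv_lhs => rw [vertexSwap, h1, h2, vertexSwap]
  rw [add_assoc, ← add_smul]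
  simp

lemma hasFDerivAt_vertexSwap (b : AffineBasis (Fin (d + 1)) ℝ (Pt d)) (i j : Fin (d + 1))
    (x : Pt d) : HasFDerivAt (vertexSwap b i j) (ContinuousLinearMap.id ℝ (Pt d) +
      (LinearMap.toContinuousLinearMap ((b.coord i).linear) -
        LinearMap.toContinuousLinearMap ((b.coord j).linear)).smulRight (b j - b i)) x :=
  (hasFDerivAt_id x).add
    (((hasFDerivAt_affineMap (b.coord i) x).sub (hasFDerivAt_affineMap (b.coord j) x)).smul_const _)

/-- Change of variables by the vertex reflection. It is an involution, so its linear part `L`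
satisfies `L² = 1` and `|det L| = 1`. -/
lemma setIntegral_coord_eq (b : AffineBasis (Fin (d + 1)) ℝ (Pt d)) (i j : Fin (d + 1)) :
    ∫ x in {x | ∀ m, 0 < b.coord m x}, b.coord i x =
      ∫ x in {x | ∀ m, 0 < b.coord m x}, b.coord j x := by
  set s : Set (Pt d) := {x | ∀ m, 0 < b.coord m x} with hs
  have hmeas : MeasurableSet s := by
    rw [hs, ← b.interior_convexHull]; exact isOpen_interior.measurableSet
  have hmaps : ∀ x ∈ s, vertexSwap b i j x ∈ s := fun x hx m => by
    rw [coord_vertexSwap]; exact hx _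
  have himage : vertexSwap b i j '' s = s := by
    apply Subset.antisymm
    · rintro _ ⟨x, hx, rfl⟩; exact hmaps x hx
    · intro x hx
      exact ⟨_, hmaps x hx, vertexSwap_vertexSwap b i j x⟩
  have hinj : InjOn (vertexSwap b i j) s := fun x _ y _ h => by
    rw [← vertexSwap_vertexSwap b i j x, h, vertexSwap_vertexSwap]
  set L := ContinuousLinearMap.id ℝ (Pt d) +
      (LinearMap.toContinuousLinearMap ((b.coord i).linear) -
        LinearMap.toContinuousLinearMap ((b.coord j).linear)).smulRight (b j - b i) with hL
  have hLL : L.comp L = ContinuousLinearMap.id ℝ (Pt d) := by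
    have h1 : HasFDerivAt (fun x => vertexSwap b i j (vertexSwap b i j x)) (L.comp L) 0 :=
      (hasFDerivAt_vertexSwap b i j _).comp 0 (hasFDerivAt_vertexSwap b i j 0)
    simp only [vertexSwap_vertexSwap] at h1
    exact h1.unique (hasFDerivAt_id 0)
  have hdet : |L.det| = 1 := by
    have h1 : L.det * L.det = 1 := by
      have := congrArg ContinuousLinearMap.det hLL
      change LinearMap.det (L.toLinearMap ∘ₗ L.toLinearMap) = LinearMap.det LinearMap.id at this
      rwa [LinearMap.det_comp, LinearMap.det_id] at this
    rcases mul_self_eq_one_iff.1 h1 with h | h <;> simp [h]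
  have h := integral_image_eq_integral_abs_det_fderiv_smul volume hmeas
    (fun x _ => (hasFDerivAt_vertexSwap b i j x).hasFDerivWithinAt) hinj (b.coord i)
  rw [himage] at h
  rw [h, ← hL, hdet]
  simp [coord_vertexSwap]

/-- By symmetry the `d + 1` barycentric coordinates have equal integrals, and they sum to `1`: each
integral is the volume over `d + 1`. An affine function is a combination of them with its vertex
values as coefficients. -/
lemma Mesh.setIntegral_affineMap (T : Mesh d NK) (k : Fin NK) (f : Pt d →ᵃ[ℝ] ℝ) :
    ∫ x in T.openElt k, f x = volume.real (T.openElt k) * f (T.barycenter k) := by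
  set b := T.basis k with hb
  have hcont (g : Pt d →ᵃ[ℝ] ℝ) : IntegrableOn g (T.openElt k) :=
    (Mesh.PwCont.of_continuous (T := T)
      (continuous_iff_continuousAt.2 fun x => (hasFDerivAt_affineMap g x).continuousAt)
      ).integrableOn_openElt k
  have hrep : ∀ x, f x = ∑ i, b.coord i x * f (b i) := fun x => by
    conv_lhs => rw [← b.affineCombination_coord_eq_self x]
    rw [Finset.map_affineCombination _ _ _ (b.sum_coord_apply_eq_one x),
      Finset.affineCombination_eq_linear_combination _ _ _ (b.sum_coord_apply_eq_one x)]
    simp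
  have hm : ∀ i, ∫ x in T.openElt k, b.coord i x = ((d : ℝ) + 1)⁻¹ * volume.real (T.openElt k) := by
    intro i
    have h1 : ∑ j, ∫ x in T.openElt k, b.coord j x = volume.real (T.openElt k) := by
      rw [← integral_finsetSum _ fun j _ => hcont _]
      simp
    have h2 : ∀ j, ∫ x in T.openElt k, b.coord j x = ∫ x in T.openElt k, b.coord i x := fun j => by
      rw [T.openElt_eq]; exact setIntegral_coord_eq b j i
    rw [Finset.sum_congr rfl fun j _ => h2 j] at h1
    rw [← h1]
    have : ((d : ℝ) + 1) ≠ 0 := by positivity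
    simp [this]
  have hcoord : ∀ i, b.coord i (T.barycenter k) = ((d : ℝ) + 1)⁻¹ := fun i => by
    rw [T.barycenter_eq, b.coord_apply_centroid (Finset.mem_univ i)]
    simp
  rw [hrep (T.barycenter k), integral_congr_ae (Eventually.of_forall hrep),
    integral_finsetSum _ fun i _ => (hcont _).mul_const _, Finset.mul_sum]
  refine Finset.sum_congr rfl fun i _ => ?_
  rw [integral_mul_const, hm, hcoord]
  ring

lemma Mesh.integral_polyDisc_one (T : Mesh d NK) {f : Pt d → ℝ} (hf : f ∈ T.polyDisc 1)
    (k : Fin NK) :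
    ∫ x in T.openElt k, f x = volume.real (T.openElt k) * f (T.barycenter k) := by
  obtain ⟨P, hP, h⟩ := hf k
  obtain ⟨g, hg⟩ := exists_affineMap_of_totalDegree_le_one hP
  rw [h _ (T.barycenter_mem k), hg, ← T.setIntegral_affineMap]
  refine setIntegral_congr_fun (T.measurableSet_openElt k) fun x hx => ?_
  rw [h x hx, hg]

end
end OldroydB

namespace OldroydB
noncomputable section

variable {d NK : ℕ}

/-! ### Volume and the flow of a solenoidal Lipschitz field -/

/-- In the expansion of the determinant in `h` the linear coefficient is the trace, which is zero.
In dimension three the quadratic and cubic coefficients consist of six products of two, respectively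
three, entries, whence the constants; `h ≤ 1` absorbs the cubic term, and in dimension two the
constant is generous. -/
lemma one_sub_le_det_one_add_smul (hd : d = 2 ∨ d = 3) {C : ℝ} {G : Mat d}
    (hG : ∀ i j, |G i j| ≤ C) (htr : G.trace = 0) {h : ℝ} (h0 : 0 ≤ h) (h1 : h ≤ 1) :
    1 - (6 * C ^ 2 + 6 * C ^ 3) * h ^ 2 ≤ (1 + h • G).det := by
  have hmul : ∀ i j k l, |G i j * G k l| ≤ C ^ 2 := fun i j k l => by
    rw [abs_mul, sq]
    exact mul_le_mul (hG _ _) (hG _ _) (abs_nonneg _) ((abs_nonneg _).trans (hG i j))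
  have hmul3 : ∀ i j k l m n, |G i j * G k l * G m n| ≤ C ^ 3 := fun i j k l m n => by
    rw [abs_mul, pow_succ]
    exact mul_le_mul (hmul _ _ _ _) (hG _ _) (abs_nonneg _) (sq_nonneg C)
  have hsq : 0 ≤ h ^ 2 := sq_nonneg h
  rcases hd with rfl | rfl
  · have hC : 0 ≤ C := (abs_nonneg _).trans (hG 0 0)
    rw [Matrix.trace_fin_two] at htr
    rw [Matrix.det_fin_two]
    have e1 := abs_le.1 (hmul 0 0 1 1)
    have e2 := abs_le.1 (hmul 0 1 1 0)
    have hC3 : 0 ≤ C ^ 3 := by positivity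
    have key : -(6 * C ^ 2 + 6 * C ^ 3) ≤ G 0 0 * G 1 1 - G 0 1 * G 1 0 := by
      nlinarith [sq_nonneg C]
    have := mul_le_mul_of_nonneg_right key hsq
    have e : (1 + h • G) 0 0 * (1 + h • G) 1 1 - (1 + h • G) 0 1 * (1 + h • G) 1 0 =
        1 + h * (G 0 0 + G 1 1) + (G 0 0 * G 1 1 - G 0 1 * G 1 0) * h ^ 2 := by
      simp; ring
    rw [e, htr]
    linarith
  · have hC : 0 ≤ C := (abs_nonneg _).trans (hG 0 0)
    rw [Matrix.trace_fin_three] at htr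
    have hC3 : 0 ≤ C ^ 3 := by positivity
    have e : (1 + h • G).det = 1 + h * (G 0 0 + G 1 1 + G 2 2) +
        ((G 0 0 * G 1 1 - G 0 1 * G 1 0) + (G 0 0 * G 2 2 - G 0 2 * G 2 0) +
          (G 1 1 * G 2 2 - G 1 2 * G 2 1)) * h ^ 2 + G.det * h * h ^ 2 := by
      rw [Matrix.det_fin_three, Matrix.det_fin_three]
      simp; ring
    have k1 : -(6 * C ^ 2) ≤ (G 0 0 * G 1 1 - G 0 1 * G 1 0) + (G 0 0 * G 2 2 - G 0 2 * G 2 0) +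
          (G 1 1 * G 2 2 - G 1 2 * G 2 1) := by
      linarith [abs_le.1 (hmul 0 0 1 1), abs_le.1 (hmul 0 1 1 0), abs_le.1 (hmul 0 0 2 2),
        abs_le.1 (hmul 0 2 2 0), abs_le.1 (hmul 1 1 2 2), abs_le.1 (hmul 1 2 2 1)]
    have k2 : -(6 * C ^ 3) ≤ G.det := by
      rw [Matrix.det_fin_three]
      linarith [abs_le.1 (hmul3 0 0 1 1 2 2), abs_le.1 (hmul3 0 0 1 2 2 1),
        abs_le.1 (hmul3 0 1 1 0 2 2), abs_le.1 (hmul3 0 1 1 2 2 0),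
        abs_le.1 (hmul3 0 2 1 0 2 1), abs_le.1 (hmul3 0 2 1 1 2 0)]
    have k3 : -(6 * C ^ 3) ≤ G.det * h := by
      nlinarith [mul_le_mul_of_nonneg_right k2 h0]
    rw [e, htr]
    nlinarith [mul_le_mul_of_nonneg_right k1 hsq, mul_le_mul_of_nonneg_right k3 hsq]

lemma det_id_add_smul_fderiv (w : Pt d → Pt d) (x : Pt d) (h : ℝ) :
    (ContinuousLinearMap.id ℝ (Pt d) + h • fderiv ℝ w x).det = (1 + h • grad w x).det := by
  rw [ContinuousLinearMap.det, ← LinearMap.det_toMatrix (EuclideanSpace.basisFun (Fin d) ℝ).toBasis]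
  congr 1
  ext i j
  simp [LinearMap.toMatrix_apply, grad, Matrix.one_apply]

/-- One step of the explicit Euler method. -/
def eulerStep (w : Pt d → Pt d) (h : ℝ) (x : Pt d) : Pt d := x + h • w x

/-- Area formula for the Euler step on the preimage of `A`, whose image lies in `A`, together with
the lower bound on the Jacobian at almost every point. -/
lemma ofReal_mul_volume_preimage_eulerStep_le (hd : d = 2 ∨ d = 3) {w : Pt d → Pt d} {C : NNReal}
    (hw : LipschitzWith C w)
    (hdiv : ∀ᵐ x, DifferentiableAt ℝ w x ∧ divg w x = 0) {h : ℝ} (h0 : 0 ≤ h) (h1 : h ≤ 1)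
    (hC : h * C < 1) {A : Set (Pt d)} (hA : MeasurableSet A) :
    ENNReal.ofReal (1 - (6 * (C : ℝ) ^ 2 + 6 * (C : ℝ) ^ 3) * h ^ 2) *
      volume (eulerStep w h ⁻¹' A) ≤ volume A := by
  obtain ⟨s, hs, hsm, hgood⟩ := hdiv.exists_measurable_mem
  have hcont : Continuous (eulerStep w h) := continuous_id.add (hw.continuous.const_smul h)
  have hmeas : MeasurableSet (eulerStep w h ⁻¹' A ∩ s) := (hcont.measurable hA).inter hsm
  have hvol : volume (eulerStep w h ⁻¹' A) = volume (eulerStep w h ⁻¹' A ∩ s) :=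
    (measure_inter_conull hs).symm
  have hderiv : ∀ x ∈ eulerStep w h ⁻¹' A ∩ s, HasFDerivWithinAt (eulerStep w h)
      (ContinuousLinearMap.id ℝ (Pt d) + h • fderiv ℝ w x) (eulerStep w h ⁻¹' A ∩ s) x :=
    fun x hx => ((hasFDerivAt_id x).add
      ((hgood x hx.2).1.hasFDerivAt.const_smul h)).hasFDerivWithinAt
  -- For `h * C < 1` the step is the identity plus a strict contraction.
  have hinj : Function.Injective (eulerStep w h) := by
    intro x y hxy
    have e : x - y = -(h • (w x - w y)) := by
      unfold eulerStep at hxy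
      rw [smul_sub]
      have := congrArg (fun z => z - h • w x - y) hxy
      simp only [add_sub_cancel_right] at this
      rw [this]; abel
    have e2 : ‖x - y‖ ≤ h * C * ‖x - y‖ := by
      conv_lhs => rw [e]
      rw [norm_neg, norm_smul, Real.norm_of_nonneg h0, mul_assoc]
      exact mul_le_mul_of_nonneg_left (hw.norm_sub_le x y) h0
    have e3 : ‖x - y‖ ≤ 0 := by
      by_contra! hc
      nlinarith
    exact sub_eq_zero.1 (norm_le_zero_iff.1 e3)
  rw [hvol, ← setLIntegral_const]
  calc _ ≤ ∫⁻ x in eulerStep w h ⁻¹' A ∩ s,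
        ENNReal.ofReal |(ContinuousLinearMap.id ℝ (Pt d) + h • fderiv ℝ w x).det| := by
        refine setLIntegral_mono' hmeas fun x hx => ENNReal.ofReal_le_ofReal ?_
        rw [det_id_add_smul_fderiv]
        refine le_trans ?_ (le_abs_self _)
        refine one_sub_le_det_one_add_smul hd (fun i j => ?_) (hgood x hx.2).2 h0 h1
        calc |grad w x i j| = ‖(fderiv ℝ w x (EuclideanSpace.single j 1)) i‖ := rfl
          _ ≤ ‖fderiv ℝ w x (EuclideanSpace.single j 1)‖ := PiLp.norm_apply_le _ i
          _ ≤ ‖fderiv ℝ w x‖ * ‖(EuclideanSpace.single j 1 : Pt d)‖ :=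
            ContinuousLinearMap.le_opNorm _ _
          _ ≤ C := by simpa using norm_fderiv_le_of_lipschitz ℝ hw
    _ = volume (eulerStep w h '' (eulerStep w h ⁻¹' A ∩ s)) :=
        lintegral_abs_det_fderiv_eq_addHaar_image volume hmeas hderiv hinj.injOn
    _ ≤ volume A := measure_mono (by rintro _ ⟨x, hx, rfl⟩; exact hx.1)

lemma continuous_eulerStep {w : Pt d → Pt d} (hw : Continuous w) (h : ℝ) :
    Continuous (eulerStep w h) := continuous_id.add (hw.const_smul h)

lemma ofReal_mul_volume_preimage_eulerStep_iterate_le (hd : d = 2 ∨ d = 3) {w : Pt d → Pt d}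
    {C : NNReal} (hw : LipschitzWith C w)
    (hdiv : ∀ᵐ x, DifferentiableAt ℝ w x ∧ divg w x = 0) {h : ℝ} (h0 : 0 ≤ h) (h1 : h ≤ 1)
    (hC : h * C < 1) (N : ℕ) {A : Set (Pt d)} (hA : MeasurableSet A) :
    ENNReal.ofReal (1 - (6 * (C : ℝ) ^ 2 + 6 * (C : ℝ) ^ 3) * h ^ 2) ^ N *
      volume ((eulerStep w h)^[N] ⁻¹' A) ≤ volume A := by
  induction N generalizing A with
  | zero => simp
  | succ N ih =>
    have hm : MeasurableSet ((eulerStep w h)⁻¹' A) :=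
      (continuous_eulerStep hw.continuous h).measurable hA
    rw [Function.iterate_succ', preimage_comp, pow_succ', mul_assoc]
    exact (mul_le_mul_right (ih hm) _).trans
      (ofReal_mul_volume_preimage_eulerStep_le hd hw hdiv h0 h1 hC hA)

/-- Local error: within time `h` the trajectory moves by at most `B * h`, so its velocity varies by
at most `C * B * h`. -/
lemma norm_sub_eulerStep_le {w : Pt d → Pt d} {C : NNReal} (hw : LipschitzWith C w) {B : ℝ}
    (hB : ∀ x, ‖w x‖ ≤ B) {Y : ℝ → Pt d} {a b : ℝ}
    (hY : ∀ t ∈ Icc a b, HasDerivWithinAt Y (w (Y t)) (Icc a b) t) {s h : ℝ} (h0 : 0 ≤ h)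
    (hs : a ≤ s) (hsb : s + h ≤ b) :
    ‖Y (s + h) - eulerStep w h (Y s)‖ ≤ C * B * h ^ 2 := by
  have hB0 : 0 ≤ B := (norm_nonneg _).trans (hB 0)
  have hsub : Icc s (s + h) ⊆ Icc a b := Icc_subset_Icc hs hsb
  have hY' : ∀ t ∈ Icc s (s + h), HasDerivWithinAt Y (w (Y t)) (Icc s (s + h)) t :=
    fun t ht => (hY t (hsub ht)).mono hsub
  have h1 : ∀ t ∈ Icc s (s + h), ‖Y t - Y s‖ ≤ B * h := fun t ht =>
    (norm_image_sub_le_of_norm_deriv_le_segment' hY' (fun t _ => hB _) t ht).trans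
      (mul_le_mul_of_nonneg_left (by linarith [ht.2]) hB0)
  have h2 : ∀ t ∈ Icc s (s + h), HasDerivWithinAt (fun t => Y t - t • w (Y s))
      (w (Y t) - (1 : ℝ) • w (Y s)) (Icc s (s + h)) t := fun t ht =>
    (hY' t ht).sub ((hasDerivWithinAt_id t _).smul_const _)
  have h3 := norm_image_sub_le_of_norm_deriv_le_segment' h2 (C := C * (B * h)) (fun t ht => by
    rw [one_smul]
    exact (hw.norm_sub_le _ _).trans
      (mul_le_mul_of_nonneg_left (h1 t ⟨ht.1, ht.2.le⟩) C.coe_nonneg)) (s + h)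
    (right_mem_Icc.2 (by linarith))
  have e : Y (s + h) - eulerStep w h (Y s) =
      Y (s + h) - (s + h) • w (Y s) - (Y s - s • w (Y s)) := by
    rw [eulerStep, add_smul]; abel
  rw [e]
  refine h3.trans (le_of_eq ?_)
  ring

/-- Discrete Gronwall: a step amplifies the accumulated error by at most `1 + h * C` and adds one
local error. Charging all `k` local errors the full amplification is crude but enough for
convergence. -/
lemma norm_sub_eulerStep_iterate_le {w : Pt d → Pt d} {C : NNReal} (hw : LipschitzWith C w) {B : ℝ}
    (hB : ∀ x, ‖w x‖ ≤ B) {Y : ℝ → Pt d} {τ : ℝ}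
    (hY : ∀ t ∈ Icc 0 τ, HasDerivWithinAt Y (w (Y t)) (Icc 0 τ) t) {h : ℝ} (h0 : 0 ≤ h)
    (k : ℕ) (hk : k * h ≤ τ) :
    ‖Y (k * h) - (eulerStep w h)^[k] (Y 0)‖ ≤ k * (C * B * h ^ 2) * (1 + h * C) ^ k := by
  have hB0 : 0 ≤ B := (norm_nonneg _).trans (hB 0)
  induction k with
  | zero => simp
  | succ k ih =>
    have hk' : (k : ℝ) * h + h ≤ τ := by push_cast at hk; linarith
    have ih := ih (by linarith)
    have h1 := norm_sub_eulerStep_le hw hB hY h0 (s := k * h) (by positivity) hk'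
    rw [Function.iterate_succ_apply']
    set z := (eulerStep w h)^[k] (Y 0)
    have h2 : ‖eulerStep w h (Y (k * h)) - eulerStep w h z‖ ≤ (1 + h * C) * ‖Y (k * h) - z‖ := by
      have e : eulerStep w h (Y (k * h)) - eulerStep w h z =
          (Y (k * h) - z) + h • (w (Y (k * h)) - w z) := by
        rw [eulerStep, eulerStep, smul_sub]; abel
      rw [e]
      refine (norm_add_le _ _).trans ?_
      rw [norm_smul, Real.norm_of_nonneg h0]
      nlinarith [mul_le_mul_of_nonneg_left (hw.norm_sub_le (Y (k * h)) z) h0]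
    have h3 : ‖Y (k * h + h) - eulerStep w h z‖ ≤
        C * B * h ^ 2 + (1 + h * C) * (k * (C * B * h ^ 2) * (1 + h * C) ^ k) := by
      have := norm_sub_le_norm_sub_add_norm_sub (Y (k * h + h)) (eulerStep w h (Y (k * h)))
        (eulerStep w h z)
      have h4 : (1 + h * C) * ‖Y (k * h) - z‖ ≤
          (1 + h * C) * (k * (C * B * h ^ 2) * (1 + h * C) ^ k) :=
        mul_le_mul_of_nonneg_left ih (by positivity)
      linarith
    have h5 : C * B * h ^ 2 ≤ C * B * h ^ 2 * (1 + h * C) ^ (k + 1) := by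
      refine le_mul_of_one_le_right (by positivity) (one_le_pow₀ ?_)
      have : 0 ≤ h * C := by positivity
      linarith
    push_cast
    rw [add_mul (k : ℝ) 1 h, one_mul]
    refine h3.trans ?_
    calc _ ≤ C * B * h ^ 2 * (1 + h * C) ^ (k + 1) +
          (1 + h * C) * (k * (C * B * h ^ 2) * (1 + h * C) ^ k) := by linarith
      _ = _ := by ring

/-- Convergence of the explicit Euler method. -/
lemma tendsto_eulerStep_iterate {w : Pt d → Pt d} {C : NNReal} (hw : LipschitzWith C w) {B : ℝ}
    (hB : ∀ x, ‖w x‖ ≤ B) {Y : ℝ → Pt d} {τ : ℝ} (hτ : 0 ≤ τ)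
    (hY : ∀ t ∈ Icc 0 τ, HasDerivWithinAt Y (w (Y t)) (Icc 0 τ) t) :
    Tendsto (fun N : ℕ => (eulerStep w (τ / N))^[N] (Y 0)) atTop (𝓝 (Y τ)) := by
  have hB0 : 0 ≤ B := (norm_nonneg _).trans (hB 0)
  rw [tendsto_iff_norm_sub_tendsto_zero]
  have hlim : Tendsto (fun N : ℕ => (C * B * τ ^ 2 * Real.exp (τ * C)) / (N : ℝ)) atTop (𝓝 0) :=
    tendsto_const_div_atTop_nhds_zero_nat _
  refine squeeze_zero' (Eventually.of_forall fun _ => norm_nonneg _) ?_ hlim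
  filter_upwards [eventually_gt_atTop 0] with N hN
  have hN' : (0 : ℝ) < N := by exact_mod_cast hN
  have e : (N : ℝ) * (τ / N) = τ := by field_simp
  have h := norm_sub_eulerStep_iterate_le hw hB hY (h := τ / N) (by positivity) N e.le
  rw [e, norm_sub_rev] at h
  refine h.trans ?_
  have h2 : (1 + τ / N * C) ^ N ≤ Real.exp (τ * C) := by
    calc (1 + τ / N * C) ^ N ≤ (Real.exp (τ / N * C)) ^ N := by
          refine pow_le_pow_left₀ (by positivity) ?_ _
          linarith [Real.add_one_le_exp (τ / N * C)]
      _ = Real.exp (τ * C) := by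
          rw [← Real.exp_nat_mul]; congr 1; field_simp
  calc _ ≤ N * (C * B * (τ / N) ^ 2) * Real.exp (τ * C) :=
        mul_le_mul_of_nonneg_left h2 (by positivity)
    _ = _ := by field_simp

/-- A map that is the limit of Euler approximations of the flow of a solenoidal Lipschitz field
does not decrease volumes of preimages of open sets. -/
lemma volume_preimage_le_of_tendsto_eulerStep (hd : d = 2 ∨ d = 3) {w : Pt d → Pt d}
    {C : NNReal} (hw : LipschitzWith C w)
    (hdiv : ∀ᵐ x, DifferentiableAt ℝ w x ∧ divg w x = 0) {τ : ℝ} (hτ : 0 ≤ τ) {D : Set (Pt d)}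
    {Φ : Pt d → Pt d}
    (hΦ : ∀ x ∈ D, Tendsto (fun N : ℕ => (eulerStep w (τ / N))^[N] x) atTop (𝓝 (Φ x)))
    (A : Set (Pt d)) : volume (Φ ⁻¹' A ∩ D) ≤ volume A := by
  set M : ℝ := 6 * (C : ℝ) ^ 2 + 6 * (C : ℝ) ^ 3 with hM
  have hM0 : 0 ≤ M := by positivity
  -- Outer regularity of Lebesgue measure reduces arbitrary sets to open ones, for which convergence
  -- of points into the set is eventual membership.
  suffices hopen : ∀ U, IsOpen U → volume (Φ ⁻¹' U ∩ D) ≤ volume U by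
    rw [A.measure_eq_iInf_isOpen volume]
    refine le_iInf₂ fun U hU => le_iInf fun hUo => ?_
    exact (measure_mono (by gcongr)).trans (hopen U hUo)
  intro U hU
  -- `S n` collects the points whose Euler approximations lie in `U` from index `n` on; the union is
  -- increasing and contains the set to be measured.
  set S : ℕ → Set (Pt d) := fun n => ⋂ N ≥ n, (eulerStep w (τ / N))^[N] ⁻¹' U with hS
  have hsub : Φ ⁻¹' U ∩ D ⊆ ⋃ n, S n := by
    rintro x ⟨hxU, hxD⟩
    obtain ⟨n, hn⟩ := eventually_atTop.1 ((hΦ x hxD).eventually (hU.mem_nhds hxU))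
    exact mem_iUnion.2 ⟨n, mem_iInter₂.2 hn⟩
  have hmono : Monotone S := fun m n hmn =>
    biInter_subset_biInter_left fun N (hN : n ≤ N) => hmn.trans hN
  refine (measure_mono hsub).trans ?_
  rw [hmono.measure_iUnion]
  refine iSup_le fun n => ?_
  have hlim0 : Tendsto (fun N : ℕ => τ / N) atTop (𝓝 0) := tendsto_const_div_atTop_nhds_zero_nat _
  have hlim1 : Tendsto (fun N : ℕ => 1 - M * τ ^ 2 / N) atTop (𝓝 1) := by
    simpa using tendsto_const_nhds.sub (tendsto_const_div_atTop_nhds_zero_nat (M * τ ^ 2))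
  have hlim : Tendsto (fun N : ℕ => ENNReal.ofReal (1 - M * τ ^ 2 / N) * volume (S n)) atTop
      (𝓝 (ENNReal.ofReal 1 * volume (S n))) :=
    ENNReal.Tendsto.mul_const (ENNReal.tendsto_ofReal hlim1) (Or.inl (by simp))
  rw [ENNReal.ofReal_one, one_mul] at hlim
  refine le_of_tendsto hlim ?_
  have hCev : ∀ᶠ N : ℕ in atTop, τ / N * C < 1 := by
    have := hlim0.mul_const (C : ℝ)
    rw [zero_mul] at this
    exact this.eventually_lt_const one_pos
  have hMev : ∀ᶠ N : ℕ in atTop, M * (τ / N) ^ 2 ≤ 1 := by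
    have := (hlim0.pow 2).const_mul M
    rw [zero_pow two_ne_zero, mul_zero] at this
    exact this.eventually_le_const one_pos
  filter_upwards [hCev, hMev, hlim0.eventually_le_const one_pos, eventually_ge_atTop n,
    eventually_gt_atTop 0] with N h1 h2 h3 h4 h5
  have hN : (0 : ℝ) < N := by exact_mod_cast h5
  refine le_trans ?_ (ofReal_mul_volume_preimage_eulerStep_iterate_le hd hw hdiv
    (h := τ / N) (by positivity) h3 h1 N hU.measurableSet)
  refine mul_le_mul' ?_ (measure_mono (biInter_subset_of_mem h4))
  rw [← ENNReal.ofReal_pow (by linarith)]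
  refine ENNReal.ofReal_le_ofReal ?_
  -- Bernoulli: `(1 - M (τ/N)²)^N ≥ 1 - M τ²/N`, which tends to `1`.
  have hb := one_add_mul_le_pow (a := -(M * (τ / N) ^ 2)) (by linarith) N
  refine le_trans (le_of_eq ?_) (hb.trans (le_of_eq ?_))
  · field_simp
    ring
  · rw [← sub_eq_add_neg]

namespace Mesh
variable {T : Mesh d NK}

lemma velocitySpace.exists_lipschitzWith {v : Pt d → Pt d} (hv : v ∈ T.velocitySpace) :
    ∃ C, LipschitzWith C v := by
  choose C hC using fun i => contPoly.exists_lipschitzWith (velocitySpace.apply_mem hv i)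
  have h : LipschitzWith (∑ i, C i) fun x => WithLp.ofLp (v x) := by
    refine LipschitzWith.of_dist_le_mul fun x y => (dist_pi_le_iff (by positivity)).2 fun i => ?_
    exact ((hC i).weaken (Finset.single_le_sum (fun _ _ => zero_le)
      (Finset.mem_univ i))).dist_le_mul x y
  exact ⟨_, (PiLp.lipschitzWith_toLp 2 _).comp h⟩

lemma velocitySpace.hasCompactSupport {v : Pt d → Pt d} (hv : v ∈ T.velocitySpace) :
    HasCompactSupport v :=
  HasCompactSupport.intro T.isCompact_iUnion_closedElt fun x hx => hv.2.2 x fun h =>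
    hx (T.domain_subset h)

/-- The backward flow follows `-v`. Extension by zero makes this field divergence free almost
everywhere in the whole space, so Euler iterates may leave the domain harmlessly. -/
lemma velocitySpace.ae_divg_neg_eq_zero {v : Pt d → Pt d} (hv : v ∈ T.velocitySpace)
    (hdiv : ∀ k, ∀ x ∈ T.openElt k, divg v x = 0) :
    ∀ᵐ x, DifferentiableAt ℝ (fun x => -v x) x ∧ divg (fun x => -v x) x = 0 := by
  filter_upwards [T.ae_mem_openElt_or] with x hx
  rcases hx with ⟨k, hk⟩ | hx
  · have h := velocitySpace.differentiableAt hv hk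
    refine ⟨h.neg, ?_⟩
    have h0 := hdiv k x hk
    simp only [divg, grad, Matrix.trace, Matrix.diag_apply, Matrix.of_apply] at h0 ⊢
    rw [fderiv_fun_neg]
    simp [h0]
  · have h0 : (fun x => -v x) =ᶠ[𝓝 x] fun _ => 0 := by
      filter_upwards [T.isCompact_iUnion_closedElt.isClosed.isOpen_compl.mem_nhds hx] with y hy
      rw [hv.2.2 y fun h => hy (T.domain_subset h), neg_zero]
    refine ⟨(differentiableAt_const 0).congr_of_eventuallyEq h0, ?_⟩
    simp [divg, grad, Matrix.trace, h0.fderiv_eq]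

end Mesh

/-- The reversed trajectory `t ↦ X (b - t) x` solves the equation of `-v`, so `X a` is a pointwise
limit of continuous Euler iterates. This yields both its measurability and the volume bound; since
`X a` maps the domain to itself, the bound may be restricted to the domain. -/
lemma IsBackwardFlow.map_restrict_le (hd : d = 2 ∨ d = 3) {T : Mesh d NK} {v : Pt d → Pt d}
    (hv : v ∈ T.velocitySpace) (hdiv : ∀ k, ∀ x ∈ T.openElt k, divg v x = 0) {a b : ℝ}
    (hab : a ≤ b) {X : ℝ → Pt d → Pt d} (hX : IsBackwardFlow T v a b X) :
    AEMeasurable (X a) (volume.restrict T.domain) ∧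
      (volume.restrict T.domain).map (X a) ≤ volume.restrict T.domain := by
  obtain ⟨C, hC⟩ := Mesh.velocitySpace.exists_lipschitzWith hv
  obtain ⟨B, hB⟩ := (Mesh.velocitySpace.hasCompactSupport hv).exists_bound_of_continuous hv.1
  have hw : LipschitzWith C fun x => -v x := hC.neg
  have hlim : ∀ x ∈ T.domain, Tendsto
      (fun N : ℕ => (eulerStep (fun x => -v x) ((b - a) / N))^[N] x) atTop (𝓝 (X a x)) := by
    intro x hx
    have h := tendsto_eulerStep_iterate hw (B := B) (fun y => by rw [norm_neg]; exact hB y)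
      (Y := fun t => X (b - t) x) (τ := b - a) (sub_nonneg.2 hab) (fun t ht => by
        have h1 := ((hX x hx).2 (b - t) ⟨by linarith [ht.2], by linarith [ht.1]⟩).2
        have h2 := h1.scomp t ((hasDerivWithinAt_id t (Icc 0 (b - a))).const_sub b)
          (fun s hs => ⟨by linarith [hs.2], by linarith [hs.1]⟩)
        rw [neg_smul, one_smul] at h2
        exact h2)
    simpa [(hX x hx).1] using h
  have hmeas : AEMeasurable (X a) (volume.restrict T.domain) := by
    refine aemeasurable_of_tendsto_metrizable_ae atTop
      (f := fun (N : ℕ) x => (eulerStep (fun x => -v x) ((b - a) / N))^[N] x)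
      (fun N => ((continuous_eulerStep hw.continuous _).iterate N).aemeasurable) ?_
    rw [ae_restrict_iff' T.measurableSet_domain]
    exact Eventually.of_forall hlim
  refine ⟨hmeas, Measure.le_iff.2 fun A hA => ?_⟩
  rw [Measure.map_apply_of_aemeasurable hmeas hA, Measure.restrict_apply' T.measurableSet_domain,
    Measure.restrict_apply hA]
  refine (measure_mono ?_).trans (volume_preimage_le_of_tendsto_eulerStep hd hw
    (Mesh.velocitySpace.ae_divg_neg_eq_zero hv hdiv) (sub_nonneg.2 hab) hlim (A ∩ T.domain))
  rintro x ⟨hxA, hx⟩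
  exact ⟨⟨hxA, ((hX x hx).2 a (left_mem_Icc.2 hab)).1⟩, hx⟩

lemma IsBackwardFlow.setIntegral_comp_le (hd : d = 2 ∨ d = 3) {T : Mesh d NK} {v : Pt d → Pt d}
    (hv : v ∈ T.velocitySpace) (hdiv : ∀ k, ∀ x ∈ T.openElt k, divg v x = 0) {a b : ℝ}
    (hab : a ≤ b) {X : ℝ → Pt d → Pt d} (hX : IsBackwardFlow T v a b X) {g : Pt d → ℝ}
    (hg : IntegrableOn g T.domain) (hg0 : ∀ x, 0 ≤ g x) :
    ∫ x in T.domain, g (X a x) ≤ ∫ x in T.domain, g x := by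
  obtain ⟨hm, hle⟩ := hX.map_restrict_le hd hv hdiv hab
  rw [← integral_map hm (hg.1.mono_measure hle)]
  exact integral_mono_measure hle (Eventually.of_forall hg0) hg

lemma IsBackwardFlow.integrableOn_comp (hd : d = 2 ∨ d = 3) {T : Mesh d NK} {v : Pt d → Pt d}
    (hv : v ∈ T.velocitySpace) (hdiv : ∀ k, ∀ x ∈ T.openElt k, divg v x = 0) {a b : ℝ}
    (hab : a ≤ b) {X : ℝ → Pt d → Pt d} (hX : IsBackwardFlow T v a b X) {g : Pt d → ℝ}
    (hg : IntegrableOn g T.domain) : IntegrableOn (fun x => g (X a x)) T.domain := by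
  obtain ⟨hm, hle⟩ := hX.map_restrict_le hd hv hdiv hab
  exact (Integrable.mono_measure hg hle).comp_aemeasurable hm

end
end OldroydB

namespace OldroydB
noncomputable section

variable {d NK : ℕ}

/-! ### The energy balance of one time step -/

lemma ddot_sub_left (A B C : Mat d) : ddot (A - B) C = ddot A C - ddot B C := by
  rw [ddot, ddot, ddot, sub_mul, Matrix.trace_sub]

lemma ddot_smul_left (s : ℝ) (A B : Mat d) : ddot (s • A) B = s * ddot A B := by
  rw [ddot, ddot, Matrix.smul_mul, Matrix.trace_smul, smul_eq_mul]

lemma ddot_smul_right (s : ℝ) (A B : Mat d) : ddot A (s • B) = s * ddot A B := by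
  rw [ddot_comm, ddot_smul_left, ddot_comm]

namespace Mesh
variable {T : Mesh d NK}

lemma PwCont.ddot {A B : Pt d → Mat d} (hA : ∀ i j, T.PwCont fun x => A x i j)
    (hB : ∀ i j, T.PwCont fun x => B x i j) : T.PwCont fun x => ddot (A x) (B x) := by
  simp only [ddot_eq_sum]
  exact .sum _ fun i _ => .sum _ fun j _ => (hA i j).mul (hB i j)

lemma PwCont.interp {M : Type*} [AddCommMonoid M] (φ : Pt d → M) (g : M → ℝ) :
    T.PwCont fun x => g (T.interp φ x) :=
  .of_eqOn_const (c := fun k => g (φ (T.barycenter k))) fun k x hx => by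
    rw [T.interp_of_mem φ hx]

lemma interp_isSymm {φ : Pt d → Mat d} (h : ∀ x, (φ x).IsSymm) (x : Pt d) :
    (T.interp φ x).IsSymm := by
  by_cases hx : ∃ k, x ∈ T.openElt k
  · obtain ⟨k, hk⟩ := hx
    rw [T.interp_of_mem φ hk]; exact h _
  · push Not at hx
    rw [T.interp_of_notMem φ hx]; exact Matrix.isSymm_zero

/-- Take `q = div u`, which is elementwise affine: its square integrates to zero, and continuity on
an open element upgrades almost everywhere to everywhere. -/
lemma divg_eq_zero_of_integral_eq_zero {u : Pt d → Pt d} (hu : u ∈ T.velocitySpace)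
    (h : ∀ q ∈ T.polyDisc 1, ∫ x in T.domain, q x * divg u x = 0) (k : Fin NK) :
    ∀ x ∈ T.openElt k, divg u x = 0 := by
  have hmem := velocitySpace.divg_mem hu
  have h0 := h _ hmem
  rw [setIntegral_eq_zero_iff_of_nonneg_ae
    (Eventually.of_forall fun x => mul_self_nonneg (divg u x))
    ((PwCont.of_polyDisc hmem).mul (.of_polyDisc hmem)).integrableOn] at h0
  have h1 : (fun x => divg u x * divg u x) =ᵐ[volume.restrict (T.openElt k)] fun _ => 0 :=
    ae_restrict_of_ae_restrict_of_subset (T.openElt_subset_domain k) h0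
  obtain ⟨P, -, hP⟩ := hmem k
  have hcont : ContinuousOn (divg u) (T.openElt k) :=
    (contDiff_eval P (n := 0)).continuous.continuousOn.congr hP
  have h2 := Measure.eqOn_open_of_ae_eq h1 (T.isOpen_openElt k) (hcont.mul hcont)
    continuousOn_const
  exact fun x hx => mul_self_eq_zero.1 (h2 hx)

/-- Against a field constant on each element only the elementwise mean of `ψ` counts, and for an
affine field the mean is the value at the barycenter. -/
lemma integral_ddot_sub_interp_eq_zero {ψ : Pt d → Mat d}
    (hψ : ∀ i j, (fun x => ψ x i j) ∈ T.polyDisc 1) {φ : Pt d → Mat d} {c : Fin NK → Mat d}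
    (hφ : ∀ k, ∀ x ∈ T.openElt k, φ x = c k) :
    ∫ x in T.domain, ddot (ψ x - T.interp ψ x) (φ x) = 0 := by
  have hint : ∀ i j k, IntegrableOn (fun x => (ψ x i j - ψ (T.barycenter k) i j) * c k i j)
      (T.openElt k) := fun i j k =>
    (((PwCont.of_polyDisc (hψ i j)).sub (.const _)).mul (.const _)).integrableOn_openElt k
  have hEq : ∀ k, EqOn (fun x => ddot (ψ x - T.interp ψ x) (φ x))
      (fun x => ∑ i, ∑ j, (ψ x i j - ψ (T.barycenter k) i j) * c k i j) (T.openElt k) := by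
    intro k x hx
    simp [ddot_eq_sum, hφ k x hx, T.interp_of_mem ψ hx]
  rw [T.integral_domain fun k => (integrableOn_congr_fun (hEq k) (T.measurableSet_openElt k)).2
    (integrable_finsetSum _ fun i _ => integrable_finsetSum _ fun j _ => hint i j k)]
  refine Finset.sum_eq_zero fun k _ => ?_
  rw [setIntegral_congr_fun (T.measurableSet_openElt k) (hEq k),
    integral_finsetSum _ fun i _ => integrable_finsetSum _ fun j _ => hint i j k]
  refine Finset.sum_eq_zero fun i _ => ?_
  rw [integral_finsetSum _ fun j _ => hint i j k]
  refine Finset.sum_eq_zero fun j _ => ?_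
  rw [integral_mul_const, integral_sub ((PwCont.of_polyDisc (hψ i j)).integrableOn_openElt k)
    ((PwCont.const _).integrableOn_openElt k), T.integral_polyDisc_one (hψ i j)]
  simp

end Mesh

/-- The log-conformation test function `ε / (2 Wi) (π_h e^ψ - I)`. -/
def stressTest (T : Mesh d NK) (Wi ε : ℝ) (ψ : Pt d → Mat d) (x : Pt d) : Mat d :=
  (ε / (2 * Wi)) • (T.interp (fun y => NormedSpace.exp (ψ y)) x - 1)

lemma stressTest_of_mem {T : Mesh d NK} {k : Fin NK} {x : Pt d} (hx : x ∈ T.openElt k) (Wi ε : ℝ)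
    (ψ : Pt d → Mat d) : stressTest T Wi ε ψ x =
      (ε / (2 * Wi)) • (NormedSpace.exp (ψ (T.barycenter k)) - 1) := by
  rw [stressTest, T.interp_of_mem _ hx]

/-- The dissipation density of the scheme. -/
def dissipation (T : Mesh d NK) (Wi ε : ℝ) (u : Pt d → Pt d) (ψ : Pt d → Mat d) (x : Pt d) : ℝ :=
  (1 - ε) * ddot (grad u x) (grad u x) + ε / (2 * Wi ^ 2) *
    (NormedSpace.exp (T.interp ψ x) + NormedSpace.exp (-T.interp ψ x)
      - (2 : ℝ) • (1 : Mat d)).trace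

/-- The identities that hold pointwise, before any integration: polarisation, pressure cancellation,
stress cancellation and relaxation. What needs integration is left over: the convection term and the
increment of `ψ`, split at `π_h ψ` into an oscillation and a difference to which convexity applies.
-/
lemma volumeForm_integrand_eq {T : Mesh d NK} {Re Wi ε dt : ℝ} (hWi : 0 < Wi)
    {u₀ u : Pt d → Pt d} {Ψ₀ ψ Ω B N : Pt d → Mat d} (p : Pt d → ℝ) (hψ : ∀ x, (ψ x).IsSymm)
    (hdec : IsDecomposition T u ψ Ω B N) (hdiv : ∀ k, ∀ x ∈ T.openElt k, divg u x = 0)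
    {k : Fin NK} {x : Pt d} (hx : x ∈ T.openElt k) :
    Re * inner ℝ (dt⁻¹ • (u x - u₀ x) + fderiv ℝ u x (u₀ x)) (u x)
      - p x * divg u x + p x * divg u x
      + (1 - ε) * ddot (grad u x) (grad u x)
      + ε / Wi * ddot (T.interp (fun y => NormedSpace.exp (ψ y)) x) (grad u x)
      + ddot (dt⁻¹ • (ψ x - Ψ₀ x)) (stressTest T Wi ε ψ x)
      - ddot (Ω x * T.interp ψ x - T.interp ψ x * Ω x) (stressTest T Wi ε ψ x)
      - 2 * ddot (B x) (stressTest T Wi ε ψ x)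
      - 1 / Wi * ddot (T.interp (fun y => NormedSpace.exp (-ψ y)) x - 1) (stressTest T Wi ε ψ x) =
    (dt⁻¹ * (Re / 2 * ‖u x‖ ^ 2 - Re / 2 * ‖u₀ x‖ ^ 2 + Re / 2 * ‖u x - u₀ x‖ ^ 2)
      + Re * inner ℝ (fderiv ℝ u x (u₀ x)) (u x) + dissipation T Wi ε u ψ x
      + dt⁻¹ * ddot (ψ x - T.interp ψ x) (stressTest T Wi ε ψ x))
      + dt⁻¹ * ddot (T.interp ψ x - Ψ₀ x) (stressTest T Wi ε ψ x) := by
  obtain ⟨hΩ, hN, -, -, hG⟩ := hdec.2.2.2 k x hx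
  rw [T.interp_of_mem _ hx] at hG
  set a := ψ (T.barycenter k) with ha
  have hcancel := stress_cancellation (hψ (T.barycenter k)) hΩ hN hG (hdiv k x hx)
    (ε / (2 * Wi))
  have hexp := ddot_exp_neg_sub_one (hψ (T.barycenter k)) (ε / (2 * Wi))
  rw [dissipation, stressTest_of_mem hx, T.interp_of_mem ψ hx, T.interp_of_mem _ hx,
    T.interp_of_mem (fun y => NormedSpace.exp (-ψ y)) hx, hexp, ← ha]
  rw [← ha] at hcancel
  have h2c : 2 * (ε / (2 * Wi)) = ε / Wi := by field_simp
  rw [h2c] at hcancel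
  have hn : ‖u x - u₀ x‖ ^ 2 = ‖u x‖ ^ 2 - 2 * inner ℝ (u x) (u₀ x) + ‖u₀ x‖ ^ 2 :=
    norm_sub_sq_real _ _
  have hi : inner ℝ (dt⁻¹ • (u x - u₀ x) + fderiv ℝ u x (u₀ x)) (u x) =
      dt⁻¹ * (‖u x‖ ^ 2 - inner ℝ (u x) (u₀ x)) + inner ℝ (fderiv ℝ u x (u₀ x)) (u x) := by
    rw [inner_add_left, real_inner_smul_left, inner_sub_left, real_inner_self_eq_norm_sq,
      real_inner_comm (u x) (u₀ x)]
  have hc2 : 1 / Wi * (-(ε / (2 * Wi))) = -(ε / (2 * Wi ^ 2)) := by field_simp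
  rw [hi, hn, ddot_smul_left, ddot_sub_left (ψ x), ddot_sub_left (ψ x), ddot_sub_left a,
    ← mul_assoc (1 / Wi), hc2]
  linear_combination hcancel

/-- The lower bound shared by both schemes. The previous field `Ψ₀` enters only through its symmetry
and integrability, since along characteristics it is no longer piecewise constant on the mesh. -/
lemma le_volumeForm {T : Mesh d NK} {Re Wi ε dt : ℝ} (hWi : 0 < Wi) (hε : 0 ≤ ε) (hdt : 0 < dt)
    {u₀ u : Pt d → Pt d} {Ψ₀ ψ Ω B N : Pt d → Mat d} (p : Pt d → ℝ) (hψ : ∀ x, (ψ x).IsSymm)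
    (hψp : ∀ i j, (fun x => ψ x i j) ∈ T.polyDisc 1)
    (hu₀ : u₀ ∈ T.velocitySpace) (hu : u ∈ T.velocitySpace)
    (hdiv₀ : ∀ k, ∀ x ∈ T.openElt k, divg u₀ x = 0)
    (hdiv : ∀ k, ∀ x ∈ T.openElt k, divg u x = 0)
    (hdec : IsDecomposition T u ψ Ω B N) (hΨ₀ : ∀ x, (Ψ₀ x).IsSymm)
    (hΨ₀i : ∀ i j, IntegrableOn (fun x => Ψ₀ x i j) T.domain)
    (hΨ₀e : IntegrableOn (fun x => entropy (Ψ₀ x)) T.domain) :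
    dt⁻¹ * (Re / 2 * (∫ x in T.domain, ‖u x‖ ^ 2) - Re / 2 * (∫ x in T.domain, ‖u₀ x‖ ^ 2)
        + (∫ x in T.domain, Re / 2 * ‖u x - u₀ x‖ ^ 2)
        + ε / (2 * Wi) * ((∫ x in T.domain, entropy (T.interp ψ x))
          - ∫ x in T.domain, entropy (Ψ₀ x)))
      + ∫ x in T.domain, dissipation T Wi ε u ψ x ≤
    volumeForm T Re Wi ε dt u₀ Ψ₀ u p ψ Ω B u p (stressTest T Wi ε ψ) := by
  have hcu : T.PwCont fun x => ‖u x‖ ^ 2 := .of_continuous (hu.1.norm.pow 2)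
  have hcu₀ : T.PwCont fun x => ‖u₀ x‖ ^ 2 := .of_continuous (hu₀.1.norm.pow 2)
  have hcd : T.PwCont fun x => Re / 2 * ‖u x - u₀ x‖ ^ 2 :=
    .of_continuous (continuous_const.mul ((hu.1.sub hu₀.1).norm.pow 2))
  have hgrad : ∀ i j, T.PwCont fun x => grad u x i j := fun i j =>
    .of_polyDisc (Mesh.velocitySpace.grad_mem hu i j)
  have hadv : T.PwCont fun x => inner ℝ (fderiv ℝ u x (u₀ x)) (u x) := by
    simp only [PiLp.inner_apply, Mesh.fderiv_apply_eq_sum_grad]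
    exact .sum _ fun i _ => (Mesh.PwCont.of_continuous (Mesh.velocitySpace.apply_mem hu i).1).mul
      (.sum _ fun j _ => (hgrad i j).mul (.of_continuous (Mesh.velocitySpace.apply_mem hu₀ j).1))
  have hdis : T.PwCont (dissipation T Wi ε u ψ) :=
    ((Mesh.PwCont.ddot hgrad hgrad).const_mul _).add
      (.interp ψ fun a => ε / (2 * Wi ^ 2) * (NormedSpace.exp a + NormedSpace.exp (-a)
        - (2 : ℝ) • (1 : Mat d)).trace)
  have htest : ∀ i j, T.PwCont fun x => stressTest T Wi ε ψ x i j := fun i j =>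
    .interp (fun y => NormedSpace.exp (ψ y)) fun s => ((ε / (2 * Wi)) • (s - 1 : Mat d)) i j
  have hint : ∀ i j, T.PwCont fun x => T.interp ψ x i j := fun i j => .interp ψ fun s => s i j
  have hosc : T.PwCont fun x => ddot (ψ x - T.interp ψ x) (stressTest T Wi ε ψ x) :=
    .ddot (fun i j => (Mesh.PwCont.of_polyDisc (hψp i j)).sub (hint i j)) htest
  have hent : T.PwCont fun x => entropy (T.interp ψ x) := .interp ψ entropy
  have hΨint : IntegrableOn (fun x => ddot (T.interp ψ x - Ψ₀ x) (stressTest T Wi ε ψ x))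
      T.domain := by
    simp only [ddot_sub_left]
    refine Integrable.sub (Mesh.PwCont.ddot hint htest).integrableOn ?_
    simp only [ddot_eq_sum]
    refine integrable_finsetSum _ fun i _ => integrable_finsetSum _ fun j _ => ?_
    -- The test field takes finitely many values; the extra summand is its value off the open
    -- elements, where `π_h` is `0` by convention.
    have hb : ∃ c, ∀ x, ‖stressTest T Wi ε ψ x i j‖ ≤ c := by
      refine ⟨∑ k, ‖((ε / (2 * Wi)) • (NormedSpace.exp (ψ (T.barycenter k)) - 1 : Mat d)) i j‖
        + ‖((ε / (2 * Wi)) • (0 - 1 : Mat d)) i j‖, fun x => ?_⟩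
      by_cases hx : ∃ k, x ∈ T.openElt k
      · obtain ⟨k, hk⟩ := hx
        rw [stressTest_of_mem hk]
        exact (Finset.single_le_sum (f := fun k => ‖((ε / (2 * Wi)) •
          (NormedSpace.exp (ψ (T.barycenter k)) - 1 : Mat d)) i j‖)
          (fun _ _ => norm_nonneg _) (Finset.mem_univ k)).trans
          (le_add_of_nonneg_right (norm_nonneg _))
      · push Not at hx
        rw [stressTest, T.interp_of_notMem _ hx]
        exact le_add_of_nonneg_left (Finset.sum_nonneg fun _ _ => norm_nonneg _)
    obtain ⟨c, hc⟩ := hb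
    exact (hΨ₀i i j).mul_bdd (c := c) (htest i j).integrableOn.1 (Eventually.of_forall hc)
  have hvol : volumeForm T Re Wi ε dt u₀ Ψ₀ u p ψ Ω B u p (stressTest T Wi ε ψ) =
      (dt⁻¹ * (Re / 2 * (∫ x in T.domain, ‖u x‖ ^ 2) - Re / 2 * (∫ x in T.domain, ‖u₀ x‖ ^ 2)
        + (∫ x in T.domain, Re / 2 * ‖u x - u₀ x‖ ^ 2))
      + Re * (∫ x in T.domain, inner ℝ (fderiv ℝ u x (u₀ x)) (u x))
      + (∫ x in T.domain, dissipation T Wi ε u ψ x)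
      + dt⁻¹ * (∫ x in T.domain, ddot (ψ x - T.interp ψ x) (stressTest T Wi ε ψ x)))
      + dt⁻¹ * ∫ x in T.domain, ddot (T.interp ψ x - Ψ₀ x) (stressTest T Wi ε ψ x) := by
    have h1 := ((hcu.const_mul (Re / 2)).sub (hcu₀.const_mul (Re / 2)))
    have h2 := (h1.add hcd).const_mul dt⁻¹
    have h3 := h2.add (hadv.const_mul Re)
    have h4 := h3.add hdis
    have h5 := h4.add (hosc.const_mul dt⁻¹)
    rw [volumeForm, ← integral_const_mul, ← integral_const_mul (Re / 2), ← integral_sub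
      (hcu.const_mul _).integrableOn (hcu₀.const_mul _).integrableOn, ← integral_add
      h1.integrableOn hcd.integrableOn, ← integral_const_mul dt⁻¹, ← integral_const_mul Re,
      ← integral_add h2.integrableOn (hadv.const_mul Re).integrableOn,
      ← integral_add h3.integrableOn hdis.integrableOn, ← integral_const_mul dt⁻¹,
      ← integral_add h4.integrableOn (hosc.const_mul _).integrableOn, ← integral_const_mul dt⁻¹,
      ← integral_add h5.integrableOn (hΨint.const_mul _)]
    apply integral_congr_ae
    filter_upwards [T.ae_domain_mem_openElt] with x hx
    obtain ⟨k, hk⟩ := hx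
    exact volumeForm_integrand_eq hWi p hψ hdec hdiv hk
  have hentropy : ε / (2 * Wi) * ((∫ x in T.domain, entropy (T.interp ψ x))
        - ∫ x in T.domain, entropy (Ψ₀ x)) ≤
      ∫ x in T.domain, ddot (T.interp ψ x - Ψ₀ x) (stressTest T Wi ε ψ x) := by
    rw [← integral_sub hent.integrableOn hΨ₀e, ← integral_const_mul]
    refine integral_mono_ae ((Integrable.sub hent.integrableOn hΨ₀e).const_mul _) hΨint ?_
    filter_upwards [T.ae_domain_mem_openElt] with x hx
    obtain ⟨k, hk⟩ := hx
    rw [stressTest_of_mem hk, ddot_smul_right, T.interp_of_mem ψ hk]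
    exact mul_le_mul_of_nonneg_left (entropy_sub_le (hψ _) (hΨ₀ x)) (by positivity)
  rw [hvol, Mesh.velocitySpace.integral_advection_eq_zero hu₀ hu hdiv₀,
    Mesh.integral_ddot_sub_interp_eq_zero hψp
      (c := fun k => (ε / (2 * Wi)) • (NormedSpace.exp (ψ (T.barycenter k)) - 1))
      fun k x hx => stressTest_of_mem hx Wi ε ψ]
  have := mul_le_mul_of_nonneg_left hentropy (inv_pos.2 hdt).le
  linarith

end
end OldroydB

namespace OldroydB
noncomputable section

/-! ### Parametrized simplices -/

/-- The standard corner simplex `{s ≥ 0, ∑ s ≤ 1}` of `ℝ^k`. -/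
def cornerSimplex (k : ℕ) : Set (Fin k → ℝ) := {s | (∀ j, 0 ≤ s j) ∧ ∑ j, s j ≤ 1}

lemma isClosed_cornerSimplex (k : ℕ) : IsClosed (cornerSimplex k) := by
  have : cornerSimplex k = (⋂ j, {s | 0 ≤ s j}) ∩ {s | ∑ j, s j ≤ 1} := by
    ext; simp [cornerSimplex]
  rw [this]
  exact (isClosed_iInter fun j => isClosed_le continuous_const (continuous_apply j)).inter
    (isClosed_le (by fun_prop) continuous_const)

lemma cornerSimplex_subset (k : ℕ) : cornerSimplex k ⊆ Icc 0 1 := fun _ hs =>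
  ⟨fun j => hs.1 j, fun j =>
    (Finset.single_le_sum (fun i _ => hs.1 i) (Finset.mem_univ j)).trans hs.2⟩

lemma isCompact_cornerSimplex (k : ℕ) : IsCompact (cornerSimplex k) :=
  isCompact_Icc.of_isClosed_subset (isClosed_cornerSimplex k) (cornerSimplex_subset k)

lemma measurableSet_cornerSimplex (k : ℕ) : MeasurableSet (cornerSimplex k) :=
  (isClosed_cornerSimplex k).measurableSet

variable {k N m : ℕ}

/-- The affine parametrization `s ↦ c + ∑ s_j b_j`. -/
def param (c : Pt N) (b : Fin k → Pt N) (s : Fin k → ℝ) : Pt N := c + ∑ j, s j • b j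

lemma continuous_param (c : Pt N) (b : Fin k → Pt N) : Continuous (param c b) := by
  unfold param; fun_prop

lemma image_param_cornerSimplex (w : Fin (k + 1) → Pt N) :
    param (w 0) (fun j => w j.succ - w 0) '' cornerSimplex k = convexHull ℝ (range w) := by
  have hpar : ∀ s : Fin k → ℝ, param (w 0) (fun j => w j.succ - w 0) s =
      (1 - ∑ j, s j) • w 0 + ∑ j, s j • w j.succ := fun s => by
    simp only [param, smul_sub, Finset.sum_sub_distrib, ← Finset.sum_smul, sub_smul, one_smul]
    abel
  apply Subset.antisymm
  · rintro _ ⟨s, hs, rfl⟩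
    rw [hpar]
    have := (convex_convexHull ℝ (range w)).sum_mem (t := Finset.univ)
      (w := (Fin.cons (1 - ∑ j, s j) s : Fin (k + 1) → ℝ)) (z := w)
      (fun i _ => by
        refine Fin.cases ?_ (fun j => ?_) i
        · simpa using hs.2
        · simpa using hs.1 j)
      (by simp [Fin.sum_univ_succ]) (fun i _ => subset_convexHull _ _ (mem_range_self i))
    simpa [Fin.sum_univ_succ] using this
  · apply convexHull_min
    · rintro _ ⟨i, rfl⟩
      refine Fin.cases ⟨0, ⟨fun _ => le_rfl, by simp⟩, by simp [hpar]⟩ (fun j => ?_) i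
      refine ⟨Pi.single j 1, ⟨fun i => ?_, by simp⟩, ?_⟩
      · by_cases h : i = j <;> simp [h]
      · simp [hpar, Pi.single_apply]
    · rintro _ ⟨s, hs, rfl⟩ _ ⟨t, ht, rfl⟩ α β hα hβ hαβ
      refine ⟨α • s + β • t, ⟨fun j => ?_, ?_⟩, ?_⟩
      · have h1 := hs.1 j
        have h2 := ht.1 j
        simp only [Pi.add_apply, Pi.smul_apply, smul_eq_mul]
        positivity
      · simp only [Pi.add_apply, Pi.smul_apply, smul_eq_mul, Finset.sum_add_distrib,
          ← Finset.mul_sum]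
        nlinarith [mul_le_mul_of_nonneg_left hs.2 hα, mul_le_mul_of_nonneg_left ht.2 hβ]
      · have hc : w 0 = α • w 0 + β • w 0 := by rw [← add_smul, hαβ, one_smul]
        simp only [param, Pi.add_apply, Pi.smul_apply, smul_eq_mul, add_smul, mul_smul,
          Finset.sum_add_distrib, smul_add, Finset.smul_sum]
        nth_rewrite 1 [hc]
        abel

/-- The linear part of `param`, on Euclidean space. -/
def edgeMap (b : Fin k → Pt N) : EuclideanSpace ℝ (Fin k) →ₗ[ℝ] Pt N :=
  (Fintype.linearCombination ℝ b) ∘ₗ (WithLp.linearEquiv 2 ℝ (Fin k → ℝ)).toLinearMap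

lemma edgeMap_apply (b : Fin k → Pt N) (s : EuclideanSpace ℝ (Fin k)) :
    edgeMap b s = ∑ j, s j • b j := by
  simp [edgeMap, Fintype.linearCombination_apply]

lemma normDet_edgeMap_sq (b : Fin k → Pt N) :
    (edgeMap b).normDet ^ 2 = (Matrix.gram ℝ b).det := by
  have h := (edgeMap b).normDet_sq_eq_det_gram (EuclideanSpace.basisFun (Fin k) ℝ)
  have h2 : (fun i => edgeMap b (EuclideanSpace.basisFun (Fin k) ℝ i)) = b := by
    ext1 i
    simp [edgeMap_apply]
  rw [h2] at h
  simpa using h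

lemma normDet_edgeMap_pos {b : Fin k → Pt N} (hb : LinearIndependent ℝ b) :
    0 < (edgeMap b).normDet := by
  have h : (edgeMap b).normDet ≠ 0 ↔ Function.Injective (edgeMap b) :=
    (edgeMap b).normDet_ne_zero_tfae.out 0 4
  refine lt_of_le_of_ne (LinearMap.normDet_nonneg _) (Ne.symm (h.2 ?_))
  rw [edgeMap, LinearMap.coe_comp]
  exact (linearIndependent_iff_injective_fintypeLinearCombination.1 hb).comp
    (WithLp.linearEquiv 2 ℝ (Fin k → ℝ)).injective

/-- Translation invariance and the Jacobian formula for a linear map. Independence of the edges is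
not needed: in the degenerate case the Jacobian is zero. -/
lemma euclideanHausdorffMeasure_image_param (c : Pt N) (b : Fin k → Pt N) (S : Set (Fin k → ℝ)) :
    μHE[k] (param c b '' S) = ENNReal.ofReal (edgeMap b).normDet * volume S := by
  have h1 : param c b '' S = (fun x => c + x) '' (edgeMap b '' (WithLp.toLp 2 '' S)) := by
    rw [image_image, image_image]
    refine image_congr fun s _ => ?_
    rw [edgeMap_apply]; rfl
  have h2 := (edgeMap b).euclideanHausdorffMeasure_image_eq_normDet_mul_volume (WithLp.toLp 2 '' S)
  rw [finrank_euclideanSpace_fin] at h2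
  rw [h1, (isometry_add_left c).euclideanHausdorffMeasure_image, h2]
  congr 1
  have h3 : (WithLp.toLp 2 '' S : Set (EuclideanSpace ℝ (Fin k))) =
      (MeasurableEquiv.toLp 2 (Fin k → ℝ)).symm ⁻¹' S := by
    rw [← MeasurableEquiv.image_eq_preimage_symm]; rfl
  rw [h3]
  exact (PiLp.volume_preserving_ofLp (Fin k)).measure_preimage_equiv
    (f := (MeasurableEquiv.toLp 2 (Fin k → ℝ)).symm) S

lemma setIntegral_image_param (c : Pt N) (b : Fin k → Pt N) (S : Set (Fin k → ℝ)) {f : Pt N → ℝ} (hf : Continuous f) :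
    ∫ x in param c b '' S, f x ∂μHE[k] =
      (edgeMap b).normDet * ∫ s in S, f (param c b s) := by
  have h : (μHE[k] : Measure (Pt N)).restrict (param c b '' S) =
      ENNReal.ofReal (edgeMap b).normDet • (volume.restrict S).map (param c b) := by
    ext A hA
    rw [Measure.restrict_apply hA, Measure.smul_apply,
      Measure.map_apply (continuous_param c b).measurable hA, inter_comm, ← image_inter_preimage,
      euclideanHausdorffMeasure_image_param, Measure.restrict_apply
      ((continuous_param c b).measurable hA), inter_comm, smul_eq_mul]
  rw [h, integral_smul_measure, ENNReal.toReal_ofReal (LinearMap.normDet_nonneg _),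
    integral_map (continuous_param c b).aemeasurable hf.aestronglyMeasurable, smul_eq_mul]

/-- The fundamental theorem of calculus on the corner simplex, in the first direction. -/
lemma setIntegral_cornerSimplex_fderiv {G : (Fin (m + 1) → ℝ) → ℝ} (hG : ContDiff ℝ 1 G) :
    ∫ s in cornerSimplex (m + 1), fderiv ℝ G s (Pi.single 0 1) =
      (∫ s in cornerSimplex m, G (Fin.cons (1 - ∑ j, s j) s)) -
        ∫ s in cornerSimplex m, G (Fin.cons 0 s) := by
  set H : (Fin (m + 1) → ℝ) → ℝ := fun s => fderiv ℝ G s (Pi.single 0 1) with hH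
  have hHc : Continuous H := (hG.continuous_fderiv one_ne_zero).clm_apply continuous_const
  have hc1 : Continuous fun s : Fin m → ℝ =>
      (Fin.cons (1 - ∑ j, s j) s : Fin (m + 1) → ℝ) :=
    Continuous.finCons (by fun_prop) continuous_id
  have hc0 : Continuous fun s : Fin m → ℝ => (Fin.cons (0 : ℝ) s : Fin (m + 1) → ℝ) :=
    Continuous.finCons continuous_const continuous_id
  have hmp := (volume_preserving_piFinSuccAbove (fun _ : Fin (m + 1) => ℝ) 0).symm
  set e := (MeasurableEquiv.piFinSuccAbove (fun _ : Fin (m + 1) => ℝ) 0).symm with he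
  have happ : ∀ p : ℝ × (Fin m → ℝ), e p = Fin.cons p.1 p.2 := fun p => by
    rw [he]
    simp [MeasurableEquiv.piFinSuccAbove, Fin.insertNthEquiv]
  have hint : IntegrableOn H (cornerSimplex (m + 1)) :=
    hHc.continuousOn.integrableOn_compact (isCompact_cornerSimplex _)
  have hind : Integrable ((cornerSimplex (m + 1)).indicator H) :=
    hint.integrable_indicator (measurableSet_cornerSimplex _)
  have hind' := (hmp.integrable_comp_emb e.measurableEmbedding).2 hind
  have hi1 : IntegrableOn (fun s : Fin m → ℝ => G (Fin.cons (1 - ∑ j, s j) s))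
      (cornerSimplex m) :=
    (hG.continuous.comp hc1).continuousOn.integrableOn_compact (isCompact_cornerSimplex _)
  have hi0 : IntegrableOn (fun s : Fin m → ℝ => G (Fin.cons 0 s)) (cornerSimplex m) :=
    (hG.continuous.comp hc0).continuousOn.integrableOn_compact (isCompact_cornerSimplex _)
  rw [← integral_indicator (measurableSet_cornerSimplex _),
    ← hmp.integral_comp e.measurableEmbedding, ← integral_sub hi1 hi0,
    ← integral_indicator (measurableSet_cornerSimplex _)]
  rw [Measure.volume_eq_prod]
  refine (integral_prod_symm _ hind').trans ?_
  refine integral_congr_ae (Eventually.of_forall fun s => ?_)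
  by_cases hs : s ∈ cornerSimplex m
  · have h1 : ∀ t : ℝ, (cornerSimplex (m + 1)).indicator H (e (t, s)) =
        (Icc 0 (1 - ∑ j, s j)).indicator (fun t => H (Fin.cons t s)) t := fun t => by
      rw [happ]
      have : (Fin.cons t s : Fin (m + 1) → ℝ) ∈ cornerSimplex (m + 1) ↔
          t ∈ Icc 0 (1 - ∑ j, s j) := by
        simp only [cornerSimplex, mem_ofPred_eq, Fin.forall_fin_succ, Fin.cons_zero, Fin.cons_succ,
          Fin.sum_univ_succ, mem_Icc]
        constructor
        · rintro ⟨⟨h1, -⟩, h2⟩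
          exact ⟨h1, by linarith⟩
        · rintro ⟨h1, h2⟩
          exact ⟨⟨h1, hs.1⟩, by linarith⟩
      by_cases ht : t ∈ Icc 0 (1 - ∑ j, s j)
      · rw [indicator_of_mem (this.2 ht), indicator_of_mem ht]
      · rw [indicator_of_notMem (mt this.1 ht), indicator_of_notMem ht]
    have hle : (0 : ℝ) ≤ 1 - ∑ j, s j := sub_nonneg.2 hs.2
    simp only [Function.comp_apply, h1]
    rw [integral_indicator measurableSet_Icc, integral_Icc_eq_integral_Ioc,
      ← intervalIntegral.integral_of_le hle, indicator_of_mem hs]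
    have hcurve : ∀ t : ℝ, HasDerivAt (fun t : ℝ => (Fin.cons t s : Fin (m + 1) → ℝ))
        (Pi.single 0 1) t := fun t => by
      rw [hasDerivAt_pi]
      intro i
      refine Fin.cases ?_ (fun j => ?_) i
      · simp only [Fin.cons_zero, Pi.single_eq_same]
        exact hasDerivAt_id t
      · simp only [Fin.cons_succ, ne_eq, Fin.succ_ne_zero, not_false_eq_true, Pi.single_eq_of_ne]
        exact hasDerivAt_const t (s j)
    have hccurve : Continuous fun t : ℝ => (Fin.cons t s : Fin (m + 1) → ℝ) :=
      continuous_iff_continuousAt.2 fun t => (hcurve t).continuousAt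
    exact intervalIntegral.integral_eq_sub_of_hasDerivAt
      (f := fun t => G (Fin.cons t s))
      (fun t _ => ((hG.differentiable one_ne_zero _).hasFDerivAt).comp_hasDerivAt t (hcurve t))
      ((hHc.comp hccurve).intervalIntegrable _ _)
  · rw [indicator_of_notMem hs]
    have h1 : ∀ t : ℝ, (cornerSimplex (m + 1)).indicator H (e (t, s)) = 0 := fun t => by
      rw [happ, indicator_of_notMem]
      rintro ⟨h1, h2⟩
      simp only [Fin.forall_fin_succ, Fin.cons_zero, Fin.cons_succ, Fin.sum_univ_succ] at h1 h2
      exact hs ⟨h1.2, by linarith [h1.1]⟩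
    simp [h1]

end
end OldroydB

namespace OldroydB
noncomputable section

variable {m : ℕ}

/-! ### The divergence theorem on a simplex -/

/-- Base times height: comparison of the Jacobians of a simplex and of one of its faces. -/
lemma normDet_edgeMap_eq_mul_norm {e n : Pt (m + 1)} {b : Fin m → Pt (m + 1)}
    (hb : LinearIndependent ℝ b) (he : inner ℝ n e ^ 2 = 1) (hn : ∀ j, inner ℝ n (b j) = 0) :
    (edgeMap b).normDet = (edgeMap (Fin.cons e b : Fin (m + 1) → Pt (m + 1))).normDet * ‖n‖ := by
  set A : Matrix (Fin (m + 1)) (Fin (m + 1)) ℝ :=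
    Matrix.of fun i l => (Fin.cons e b : Fin (m + 1) → Pt (m + 1)) i l with hA
  set A' : Matrix (Fin (m + 1)) (Fin (m + 1)) ℝ :=
    Matrix.of fun i l => (Fin.cons n b : Fin (m + 1) → Pt (m + 1)) i l with hA'
  have hmul : ∀ v w : Fin (m + 1) → Pt (m + 1),
      (Matrix.of fun i l => v i l) * (Matrix.of fun i l => w i l).transpose =
        Matrix.of fun i j => inner ℝ (v i) (w j) := fun v w => by
    ext i j
    simp [Matrix.mul_apply, PiLp.inner_apply, mul_comm]
  have hDsq : (edgeMap (Fin.cons e b : Fin (m + 1) → Pt (m + 1))).normDet ^ 2 = A.det ^ 2 := by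
    rw [normDet_edgeMap_sq, sq, ← Matrix.det_transpose A]
    nth_rewrite 1 [Matrix.det_transpose]
    rw [← Matrix.det_mul, hA, hmul]
    rfl
  have hJ := normDet_edgeMap_sq b
  set J := (edgeMap b).normDet
  set D := (edgeMap (Fin.cons e b : Fin (m + 1) → Pt (m + 1))).normDet
  -- Orthogonality of `n` to the `b_j` leaves a single entry in the first row, whose cofactor is the
  -- Gram determinant of `b`.
  have hrow : ∀ w : Pt (m + 1), (Matrix.of fun i j =>
      inner ℝ ((Fin.cons n b : Fin (m + 1) → Pt (m + 1)) i)
        ((Fin.cons w b : Fin (m + 1) → Pt (m + 1)) j) : Matrix _ _ ℝ).det =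
      inner ℝ n w * J ^ 2 := fun w => by
    rw [Matrix.det_succ_row_zero, Fin.sum_univ_succ, Finset.sum_eq_zero, hJ]
    · simp only [Matrix.of_apply, Fin.cons_zero, add_zero]
      simp only [Fin.val_zero, pow_zero, one_mul]
      congr 1
    · intro j _
      simp [hn]
  have h1 : A'.det * A.det = inner ℝ n e * J ^ 2 := by
    rw [← Matrix.det_transpose A, ← Matrix.det_mul, hA, hA', hmul, hrow]
  have h2 : A'.det * A'.det = ‖n‖ ^ 2 * J ^ 2 := by
    nth_rewrite 2 [← Matrix.det_transpose A']
    rw [← Matrix.det_mul, hA', hmul, hrow, real_inner_self_eq_norm_sq]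
  have hJpos : 0 < J := normDet_edgeMap_pos hb
  -- The determinant of `A'` is eliminated by comparing the square of `h1` with `h2`.
  have h3 : J ^ 2 * J ^ 2 = J ^ 2 * (D * ‖n‖) ^ 2 := by
    rw [mul_pow, hDsq]
    calc J ^ 2 * J ^ 2 = (inner ℝ n e * J ^ 2) ^ 2 := by rw [mul_pow, he]; ring
      _ = (A'.det * A'.det) * A.det ^ 2 := by rw [← h1]; ring
      _ = _ := by rw [h2]; ring
  have h4 : J ^ 2 = (D * ‖n‖) ^ 2 := mul_left_cancel₀ (by positivity) h3
  exact (sq_eq_sq₀ hJpos.le (mul_nonneg (LinearMap.normDet_nonneg _) (norm_nonneg _))).1 h4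

/-- A shear: subtracting the first row from the others does not change the determinant. -/
lemma normDet_edgeMap_cons_sub (e : Pt (m + 1)) (b : Fin m → Pt (m + 1)) :
    (edgeMap (Fin.cons e (fun j => b j - e) : Fin (m + 1) → Pt (m + 1))).normDet =
      (edgeMap (Fin.cons e b : Fin (m + 1) → Pt (m + 1))).normDet := by
  have hgram : ∀ v : Fin (m + 1) → Pt (m + 1), (Matrix.gram ℝ v).det =
      (Matrix.of fun i l => v i l : Matrix _ _ ℝ).det ^ 2 := fun v => by
    have h : Matrix.gram ℝ v = (Matrix.of fun i l => v i l : Matrix _ _ ℝ) *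
        (Matrix.of fun i l => v i l : Matrix _ _ ℝ).transpose := by
      ext i j
      simp [Matrix.mul_apply, PiLp.inner_apply, mul_comm]
    rw [h, Matrix.det_mul, Matrix.det_transpose, sq]
  rw [← sq_eq_sq₀ (LinearMap.normDet_nonneg _) (LinearMap.normDet_nonneg _), normDet_edgeMap_sq,
    normDet_edgeMap_sq, hgram, hgram]
  congr 1
  refine Matrix.det_eq_of_forall_row_eq_smul_add_const (Fin.cons 0 fun _ => -1) 0 rfl fun i j => ?_
  refine Fin.cases ?_ (fun i => ?_) i
  · simp
  · simp [sub_eq_add_neg]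

/-- The face of the simplex with vertices `v` opposite to `v i`. -/
def simplexFace (v : Fin (m + 2) → Pt (m + 1)) (i : Fin (m + 2)) : Set (Pt (m + 1)) :=
  convexHull ℝ (v '' {i}ᶜ)

lemma simplexFace_eq (v : Fin (m + 2) → Pt (m + 1)) (i : Fin (m + 2)) :
    simplexFace v i = convexHull ℝ (range fun j => v (i.succAbove j)) := by
  rw [simplexFace, ← Fin.range_succAbove i, ← range_comp]
  rfl

/-- `n i` are the gradients of the barycentric coordinates of the simplex with vertices `v`. -/
def IsDualTo (n v : Fin (m + 2) → Pt (m + 1)) : Prop :=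
  ∀ i j k, inner ℝ (n i) (v j - v k) = (if i = j then (1 : ℝ) else 0) - if i = k then 1 else 0

lemma linearIndependent_sub {v : Fin (m + 2) → Pt (m + 1)} (hv : AffineIndependent ℝ v)
    (i : Fin (m + 2)) : LinearIndependent ℝ fun j => v (i.succAbove j) - v i := by
  have h := (affineIndependent_iff_linearIndependent_vsub ℝ v i).1 hv
  exact h.comp (fun j => ⟨i.succAbove j, Fin.succAbove_ne i j⟩)
    fun a b hab => Fin.succAbove_right_injective (p := i) (congrArg Subtype.val hab)

/-- Parametrise the simplex from `v 0` with `v 1 - v 0` as first edge and apply the fundamental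
theorem in that direction. The upper end of each slice sweeps the face opposite `v 0`, the lower end
the face opposite `v 1`; base times height converts the Jacobian of the simplex into those of the
faces. -/
lemma setIntegral_fderiv_edge_aux {v n : Fin (m + 2) → Pt (m + 1)} (hv : AffineIndependent ℝ v)
    (hn : IsDualTo n v) {f : Pt (m + 1) → ℝ} (hf : ContDiff ℝ 1 f) :
    ∫ x in convexHull ℝ (range v), fderiv ℝ f x (v 1 - v 0) =
      ‖n 0‖⁻¹ * (∫ x in simplexFace v 0, f x ∂μHE[m]) -
        ‖n 1‖⁻¹ * ∫ x in simplexFace v 1, f x ∂μHE[m] := by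
  set e := v 1 - v 0 with he
  set b : Fin m → Pt (m + 1) := fun j => v j.succ.succ - v 0 with hb
  set b' : Fin m → Pt (m + 1) := fun j => v j.succ.succ - v 1 with hb'
  have hcons : (fun j : Fin (m + 1) => v j.succ - v 0) =
      (Fin.cons e b : Fin (m + 1) → Pt (m + 1)) := by
    ext1 j
    refine Fin.cases ?_ (fun j => ?_) j
    · rfl
    · rfl
  have hli : LinearIndependent ℝ (Fin.cons e b : Fin (m + 1) → Pt (m + 1)) := by
    rw [← hcons]
    simpa using linearIndependent_sub hv 0
  have hlib : LinearIndependent ℝ b := by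
    have := hli.comp Fin.succ (Fin.succ_injective _)
    simpa [Function.comp_def] using this
  have hlib' : LinearIndependent ℝ b' := by
    have h := (linearIndependent_sub hv 1).comp Fin.succ (Fin.succ_injective _)
    have h2 : (fun j : Fin (m + 1) => v ((1 : Fin (m + 2)).succAbove j) - v 1) ∘ Fin.succ = b' := by
      ext1 j
      simp only [Function.comp_apply, hb']
      congr 2
    rwa [h2] at h
  set D := (edgeMap (Fin.cons e b : Fin (m + 1) → Pt (m + 1))).normDet with hD
  have hDpos : 0 < D := normDet_edgeMap_pos hli
  have hJ1 : (edgeMap b).normDet = D * ‖n 1‖ :=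
    normDet_edgeMap_eq_mul_norm hlib (by rw [he, hn]; simp) fun j => by
      rw [hb, hn]
      have : (1 : Fin (m + 2)) ≠ j.succ.succ := by
        rw [← Fin.succ_zero_eq_one]; exact fun h => (Fin.succ_ne_zero j) (Fin.succ_injective _ h).symm
      simp [this]
  have hJ0 : (edgeMap b').normDet = D * ‖n 0‖ := by
    have h := normDet_edgeMap_eq_mul_norm (e := e) (n := n 0) hlib' (by rw [he, hn]; simp) fun j => by
      rw [hb', hn]
      simp [(Fin.succ_ne_zero _).symm]
    rw [h, hD, ← normDet_edgeMap_cons_sub e b]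
    congr 4
    ext1 j
    simp [hb, hb', he]
  have hface1 : simplexFace v 1 = param (v 0) b '' cornerSimplex m := by
    rw [simplexFace_eq, ← image_param_cornerSimplex]
    congr 1
  have hface0 : simplexFace v 0 = param (v 1) b' '' cornerSimplex m := by
    rw [simplexFace_eq, ← image_param_cornerSimplex]
    congr 1
  have hK := image_param_cornerSimplex v
  rw [hcons] at hK
  have hfd : Continuous fun x => fderiv ℝ f x e :=
    (hf.continuous_fderiv one_ne_zero).clm_apply continuous_const
  have hvol : ∫ x in convexHull ℝ (range v), fderiv ℝ f x e =
      D * ∫ s in cornerSimplex (m + 1), fderiv ℝ f (param (v 0) (Fin.cons e b) s) e := by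
    rw [← EuclideanSpace.euclideanHausdorffMeasure_eq_volume, ← hK, setIntegral_image_param _ _ _ hfd]
  set G : (Fin (m + 1) → ℝ) → ℝ := fun s => f (param (v 0) (Fin.cons e b) s) with hG
  have hpar : ContDiff ℝ 1 (param (v 0) (Fin.cons e b : Fin (m + 1) → Pt (m + 1))) := by
    unfold param; fun_prop
  have hGc : ContDiff ℝ 1 G := hf.comp hpar
  have hfderivG : ∀ s, fderiv ℝ G s (Pi.single 0 1) =
      fderiv ℝ f (param (v 0) (Fin.cons e b) s) e := fun s => by
    have h1 : HasLineDerivAt ℝ (param (v 0) (Fin.cons e b : Fin (m + 1) → Pt (m + 1))) e s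
        (Pi.single 0 1) := by
      have : ∀ t : ℝ, param (v 0) (Fin.cons e b : Fin (m + 1) → Pt (m + 1))
          (s + t • (Pi.single 0 1 : Fin (m + 1) → ℝ)) =
          param (v 0) (Fin.cons e b : Fin (m + 1) → Pt (m + 1)) s + t • e := fun t => by
        simp [param, add_smul, Fin.sum_univ_succ]
        abel
      rw [HasLineDerivAt]
      simp only [this]
      simpa using ((hasDerivAt_id (0 : ℝ)).smul_const e).const_add
        (param (v 0) (Fin.cons e b : Fin (m + 1) → Pt (m + 1)) s)
    have h2 : fderiv ℝ (param (v 0) (Fin.cons e b : Fin (m + 1) → Pt (m + 1))) s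
        (Pi.single 0 1) = e := by
      rw [← (hpar.differentiable one_ne_zero s).lineDeriv_eq_fderiv]
      exact h1.lineDeriv
    have h3 := (hf.differentiable one_ne_zero
      (param (v 0) (Fin.cons e b) s)).hasFDerivAt.comp s
      (hpar.differentiable one_ne_zero s).hasFDerivAt
    have h4 : fderiv ℝ G s = _ := h3.fderiv
    rw [h4, ContinuousLinearMap.comp_apply, h2]
  have hG0 : ∀ s : Fin m → ℝ, G (Fin.cons 0 s) = f (param (v 0) b s) := fun s => by
    simp [hG, param, Fin.sum_univ_succ]
  have hG1 : ∀ s : Fin m → ℝ, G (Fin.cons (1 - ∑ j, s j) s) = f (param (v 1) b' s) := fun s => by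
    simp only [hG, param, Fin.sum_univ_succ, Fin.cons_zero, Fin.cons_succ]
    congr 1
    simp only [hb, hb', he, smul_sub, Finset.sum_sub_distrib, ← Finset.sum_smul, sub_smul, one_smul]
    abel
  have hn1 : ‖n 1‖ ≠ 0 := fun h => by
    have := hn 1 1 0
    rw [norm_eq_zero.1 h] at this
    simp at this
  have hn0 : ‖n 0‖ ≠ 0 := fun h => by
    have := hn 0 0 1
    rw [norm_eq_zero.1 h] at this
    simp at this
  rw [hvol, hface0, hface1, setIntegral_image_param _ _ _ hf.continuous,
    setIntegral_image_param _ _ _ hf.continuous, hJ0, hJ1]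
  simp_rw [← hfderivG]
  rw [setIntegral_cornerSimplex_fderiv hGc]
  simp_rw [hG0, hG1]
  field_simp

lemma setIntegral_fderiv_edge {v n : Fin (m + 2) → Pt (m + 1)} (hv : AffineIndependent ℝ v)
    (hn : IsDualTo n v) {f : Pt (m + 1) → ℝ} (hf : ContDiff ℝ 1 f) {a b : Fin (m + 2)}
    (hab : a ≠ b) :
    ∫ x in convexHull ℝ (range v), fderiv ℝ f x (v a - v b) =
      ‖n b‖⁻¹ * (∫ x in simplexFace v b, f x ∂μHE[m]) -
        ‖n a‖⁻¹ * ∫ x in simplexFace v a, f x ∂μHE[m] := by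
  obtain ⟨σ, h0, h1⟩ : ∃ σ : Equiv.Perm (Fin (m + 2)), σ 0 = b ∧ σ 1 = a := by
    -- The first swap sends `0` to `b`; the second carries the image of `1` to `a` and leaves `b`
    -- fixed.
    refine ⟨Equiv.swap (Equiv.swap 0 b 1) a * Equiv.swap 0 b, ?_, ?_⟩
    · rw [Equiv.Perm.mul_apply, Equiv.swap_apply_left, Equiv.swap_apply_of_ne_of_ne _ hab.symm]
      intro h
      have := (Equiv.swap 0 b).injective ((Equiv.swap_apply_left (0 : Fin (m + 2)) b).trans h)
      simp at this
    · rw [Equiv.Perm.mul_apply, Equiv.swap_apply_left]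
  have h := setIntegral_fderiv_edge_aux (v := v ∘ σ) (n := n ∘ σ)
    (hv.comp_embedding σ.toEmbedding)
    (fun i j k => by simpa [σ.injective.eq_iff] using hn (σ i) (σ j) (σ k)) hf
  have hface : ∀ i, simplexFace (v ∘ σ) i = simplexFace v (σ i) := fun i => by
    rw [simplexFace, simplexFace, image_comp, image_compl_eq σ.bijective, image_singleton]
  rw [σ.surjective.range_comp, hface, hface] at h
  simpa only [Function.comp_apply, h0, h1] using h

/-- The divergence theorem on a simplex. -/
theorem setIntegral_divg_eq {v n : Fin (m + 2) → Pt (m + 1)} (hv : AffineIndependent ℝ v)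
    (hn : IsDualTo n v) (hrep : ∀ x : Pt (m + 1), x = ∑ a, inner ℝ (n a) x • v a)
    (hsum : ∑ a, n a = 0) {W : Pt (m + 1) → Pt (m + 1)} (hW : ContDiff ℝ 1 W) :
    ∫ x in convexHull ℝ (range v), divg W x =
      -∑ a, ‖n a‖⁻¹ * ∫ x in simplexFace v a, inner ℝ (n a) (W x) ∂μHE[m] := by
  have hcomp : IsCompact (convexHull ℝ (range v)) := (finite_range v).isCompact_convexHull ℝ
  have hinner : ∀ a, ContDiff ℝ 1 fun x => inner ℝ (n a) (W x) := fun a =>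
    contDiff_const.inner ℝ hW
  have hfd : ∀ a x w, fderiv ℝ (fun x => inner ℝ (n a) (W x)) x w =
      inner ℝ (n a) (fderiv ℝ W x w) := fun a x w => by
    have h := (innerSL ℝ (n a)).hasFDerivAt.comp x
      (hW.differentiable one_ne_zero x).hasFDerivAt
    have h2 : fderiv ℝ (fun x => inner ℝ (n a) (W x)) x = (innerSL ℝ (n a)).comp (fderiv ℝ W x) :=
      h.fderiv
    rw [h2]; rfl
  -- The divergence is `∑ ∂_{v_a} (n_a · W)`. Because the `n_a` sum to zero, `v a` may be replaced
  -- by `v a - v 0`, so only derivatives along edges occur.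
  have hdiv : ∀ x, divg W x =
      ∑ a, fderiv ℝ (fun x => inner ℝ (n a) (W x)) x (v a - v 0) := fun x => by
    have h0 : ∑ a, inner ℝ (n a) (fderiv ℝ W x (v 0)) = 0 := by
      rw [← sum_inner, hsum, inner_zero_left]
    simp only [hfd, map_sub, inner_sub_right, Finset.sum_sub_distrib, h0, sub_zero]
    have h1 : ∀ i, (fderiv ℝ W x (EuclideanSpace.single i 1)) i =
        ∑ a, n a i * (fderiv ℝ W x (v a)) i := fun i => by
      conv_lhs => rw [hrep (EuclideanSpace.single i (1 : ℝ)), map_sum]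
      simp [EuclideanSpace.inner_single_right]
    simp only [divg, Matrix.trace, Matrix.diag_apply, grad, Matrix.of_apply, h1]
    rw [Finset.sum_comm]
    refine Finset.sum_congr rfl fun a _ => ?_
    simp [PiLp.inner_apply, mul_comm]
  have hint : ∀ a, IntegrableOn (fun x => fderiv ℝ (fun x => inner ℝ (n a) (W x)) x (v a - v 0))
      (convexHull ℝ (range v)) := fun a =>
    (((hinner a).continuous_fderiv one_ne_zero).clm_apply
      continuous_const).continuousOn.integrableOn_compact hcomp
  simp_rw [hdiv]
  rw [integral_finsetSum _ fun a _ => hint a, Fin.sum_univ_succ]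
  have hface : ∀ a : Fin (m + 1), ∫ x in convexHull ℝ (range v),
      fderiv ℝ (fun x => inner ℝ (n a.succ) (W x)) x (v a.succ - v 0) =
      ‖n 0‖⁻¹ * (∫ x in simplexFace v 0, inner ℝ (n a.succ) (W x) ∂μHE[m]) -
      ‖n a.succ‖⁻¹ * ∫ x in simplexFace v a.succ, inner ℝ (n a.succ) (W x) ∂μHE[m] := fun a =>
    setIntegral_fderiv_edge hv hn (hinner a.succ) (Fin.succ_ne_zero a)
  have hfin : μHE[m] (simplexFace v 0) < ⊤ := by
    rw [simplexFace_eq, ← image_param_cornerSimplex, euclideanHausdorffMeasure_image_param]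
    exact ENNReal.mul_lt_top ENNReal.ofReal_lt_top (isCompact_cornerSimplex m).measure_lt_top
  have hcface : IsCompact (simplexFace v 0) :=
    ((toFinite _).image v).isCompact_convexHull ℝ
  have hintface : ∀ a, IntegrableOn (fun x => inner ℝ (n a) (W x)) (simplexFace v 0) μHE[m] :=
    fun a => (hinner a).continuous.continuousOn.integrableOn_of_subset_isCompact hcface
      hcface.measurableSet Subset.rfl hfin.ne
  -- On the face opposite `v 0` the contributions of all the other indices add up to minus the
  -- missing one, again because the `n_a` sum to zero.
  have h0 : ∑ a : Fin (m + 1), ∫ x in simplexFace v 0, inner ℝ (n a.succ) (W x) ∂μHE[m] =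
      -∫ x in simplexFace v 0, inner ℝ (n 0) (W x) ∂μHE[m] := by
    rw [← integral_finsetSum _ fun a _ => hintface _, ← integral_neg]
    refine integral_congr_ae (Eventually.of_forall fun x => ?_)
    have : ∑ a, inner ℝ (n a) (W x) = 0 := by rw [← sum_inner, hsum, inner_zero_left]
    rw [Fin.sum_univ_succ] at this
    simp only
    linarith
  have hsplit := Fin.sum_univ_succ fun a =>
    ‖n a‖⁻¹ * ∫ x in simplexFace v a, inner ℝ (n a) (W x) ∂μHE[m]
  simp_rw [hface]
  rw [Finset.sum_sub_distrib, ← Finset.mul_sum, h0, hsplit]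
  simp only [sub_self, map_zero, integral_zero]
  ring

end
end OldroydB

/-! ### Barycentric gradients, faces, and one-sided limits across a face. -/

namespace OldroydB
noncomputable section

variable {m NK : ℕ}

namespace Mesh

/-- The gradient of the barycentric coordinate `λ_a` of `K_k`. -/
def dual {d : ℕ} (T : Mesh d NK) (k : Fin NK) (a : Fin (d + 1)) : Pt d :=
  (InnerProductSpace.toDual ℝ (Pt d)).symm
    (LinearMap.toContinuousLinearMap ((T.basis k).coord a).linear)

lemma inner_dual {d : ℕ} (T : Mesh d NK) (k : Fin NK) (a : Fin (d + 1)) (x : Pt d) :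
    inner ℝ (T.dual k a) x = ((T.basis k).coord a).linear x := by
  rw [dual, InnerProductSpace.toDual_symm_apply]; rfl

lemma coord_add {d : ℕ} (T : Mesh d NK) (k : Fin NK) (a : Fin (d + 1)) (x y : Pt d) :
    (T.basis k).coord a (x + y) = (T.basis k).coord a x + inner ℝ (T.dual k a) y := by
  have h := ((T.basis k).coord a).map_vadd x y
  rw [vadd_eq_add, vadd_eq_add] at h
  rw [add_comm x, h, inner_dual, add_comm]

lemma inner_dual_sub {d : ℕ} (T : Mesh d NK) (k : Fin NK) (a : Fin (d + 1)) (x y : Pt d) :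
    inner ℝ (T.dual k a) (x - y) = (T.basis k).coord a x - (T.basis k).coord a y := by
  have h := T.coord_add k a y (x - y)
  rw [add_sub_cancel] at h
  linarith

lemma continuous_coord {d : ℕ} (T : Mesh d NK) (k : Fin NK) (a : Fin (d + 1)) :
    Continuous ((T.basis k).coord a) :=
  continuous_iff_continuousAt.2 fun x => (hasFDerivAt_affineMap _ x).continuousAt

variable (T : Mesh (m + 1) NK)

lemma isDualTo (k : Fin NK) : IsDualTo (T.dual k) (T.elt k).points := fun i j l => by
  rw [inner_dual_sub, ← T.basis_apply, ← T.basis_apply, AffineBasis.coord_apply,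
    AffineBasis.coord_apply]

lemma sum_dual (k : Fin NK) : ∑ a, T.dual k a = 0 := by
  refine ext_inner_right ℝ fun x => ?_
  have h : ∀ a, inner ℝ (T.dual k a) x = (T.basis k).coord a x - (T.basis k).coord a 0 := fun a => by
    rw [← inner_dual_sub, sub_zero]
  rw [sum_inner, inner_zero_left]
  simp_rw [h]
  rw [Finset.sum_sub_distrib, (T.basis k).sum_coord_apply_eq_one,
    (T.basis k).sum_coord_apply_eq_one, sub_self]

lemma sum_inner_dual_smul (k : Fin NK) (x : Pt (m + 1)) :
    x = ∑ a, inner ℝ (T.dual k a) x • (T.elt k).points a := by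
  have hrep : ∀ y : Pt (m + 1), ∑ a, (T.basis k).coord a y • (T.elt k).points a = y := fun y => by
    have := (T.basis k).affineCombination_coord_eq_self y
    rwa [Finset.affineCombination_eq_linear_combination _ _ _
      ((T.basis k).sum_coord_apply_eq_one y)] at this
  have h : ∀ a, inner ℝ (T.dual k a) x = (T.basis k).coord a x - (T.basis k).coord a 0 := fun a => by
    rw [← inner_dual_sub, sub_zero]
  simp_rw [h, sub_smul]
  rw [Finset.sum_sub_distrib, hrep, hrep, sub_zero]

lemma dual_ne_zero (k : Fin NK) (a : Fin (m + 2)) : T.dual k a ≠ 0 := fun h => by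
  obtain ⟨b, hb⟩ := exists_ne a
  have := T.isDualTo k a a b
  rw [h] at this
  simp [hb.symm] at this

lemma face_eq_simplexFace (k : Fin NK) (i : Fin (m + 2)) :
    T.face k i = simplexFace (T.elt k).points i := rfl

lemma face_subset_closedElt (k : Fin NK) (i : Fin (m + 2)) : T.face k i ⊆ T.closedElt k :=
  convexHull_mono (image_subset_range _ _)

lemma coord_eq_zero_of_mem_face {k : Fin NK} {i : Fin (m + 2)} {x : Pt (m + 1)}
    (hx : x ∈ T.face k i) : (T.basis k).coord i x = 0 := by
  have hsub : T.face k i ⊆ (T.basis k).coord i ⁻¹' {0} := by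
    apply convexHull_min
    · rintro _ ⟨j, hj, rfl⟩
      have hij : i ≠ j := fun h => hj h.symm
      simp [← T.basis_apply, (T.basis k).coord_apply_ne hij]
    · exact (convex_singleton (0 : ℝ)).affine_preimage _
  exact hsub hx

lemma point_mem_face (k : Fin NK) {i j : Fin (m + 2)} (h : j ≠ i) :
    (T.elt k).points j ∈ T.face k i :=
  subset_convexHull _ _ ⟨j, h, rfl⟩

lemma face_injective (k : Fin NK) : Function.Injective (T.face k) := fun i j h => by
  by_contra hij
  have h1 : (T.elt k).points i ∈ T.face k i := h ▸ T.point_mem_face k hij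
  have := T.coord_eq_zero_of_mem_face h1
  simp [← T.basis_apply] at this

lemma isCompact_face (k : Fin NK) (i : Fin (m + 2)) : IsCompact (T.face k i) :=
  ((toFinite _).image _).isCompact_convexHull ℝ

/-- Points of the relative interior of the face opposite to the vertex `i` of `K_k`. -/
def relintFace (k : Fin NK) (i : Fin (m + 2)) : Set (Pt (m + 1)) :=
  {x | (T.basis k).coord i x = 0 ∧ ∀ j ≠ i, 0 < (T.basis k).coord j x}

end Mesh

lemma volume_affine_zero_set {k : ℕ} (a : ℝ) (β : Fin k → ℝ) (h : ∃ s : Fin k → ℝ, a + ∑ j, s j * β j ≠ 0) :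
    volume {s : Fin k → ℝ | a + ∑ j, s j * β j = 0} = 0 := by
  set A : AffineSubspace ℝ (Fin k → ℝ) :=
    { carrier := {s | a + ∑ j, s j * β j = 0}
      smul_vsub_vadd_mem' := fun c p q r hp hq hr => by
        simp only [mem_ofPred_eq] at *
        have : ∑ j, (c • (p -ᵥ q) +ᵥ r) j * β j =
            c * (∑ j, p j * β j - ∑ j, q j * β j) + ∑ j, r j * β j := by
          rw [← Finset.sum_sub_distrib, Finset.mul_sum, ← Finset.sum_add_distrib]
          refine Finset.sum_congr rfl fun j _ => ?_
          simp
          ring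
        rw [this]
        linear_combination c * hp - c * hq + hr } with hA
  have : A ≠ ⊤ := fun htop => by
    obtain ⟨s, hs⟩ := h
    have : s ∈ A := by rw [htop]; trivial
    exact hs this
  exact Measure.addHaar_affineSubspace volume A this

namespace Mesh
variable (T : Mesh (m + 1) NK)

lemma exists_param_face (k : Fin NK) (i : Fin (m + 2)) :
    ∃ (c : Pt (m + 1)) (b : Fin m → Pt (m + 1)), T.face k i = param c b '' cornerSimplex m := by
  rw [face_eq_simplexFace, simplexFace_eq, ← image_param_cornerSimplex]
  exact ⟨_, _, rfl⟩

lemma measure_face_lt_top (k : Fin NK) (i : Fin (m + 2)) : μHE[m] (T.face k i) < ⊤ := by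
  obtain ⟨c, b, h⟩ := T.exists_param_face k i
  rw [h, euclideanHausdorffMeasure_image_param]
  exact ENNReal.mul_lt_top ENNReal.ofReal_lt_top (isCompact_cornerSimplex m).measure_lt_top

lemma integrableOn_face (k : Fin NK) (i : Fin (m + 2)) {f : Pt (m + 1) → ℝ} (hf : Continuous f) :
    IntegrableOn f (T.face k i) μHE[m] :=
  hf.continuousOn.integrableOn_of_subset_isCompact (T.isCompact_face k i)
    (T.isCompact_face k i).measurableSet Subset.rfl (T.measure_face_lt_top k i).ne

/-- The rest of the face lies where another barycentric coordinate vanishes. In the parameters of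
the face that coordinate is affine and equals `1` at its own vertex, so its zero set is null. -/
lemma ae_mem_relintFace (k : Fin NK) (i : Fin (m + 2)) :
    ∀ᵐ x ∂((μHE[m] : Measure (Pt (m + 1))).restrict (T.face k i)), x ∈ T.relintFace k i := by
  rw [ae_restrict_iff' (T.isCompact_face k i).measurableSet]
  have h : ∀ᵐ x ∂(μHE[m] : Measure (Pt (m + 1))), ∀ j ≠ i, x ∈ T.face k i →
      (T.basis k).coord j x ≠ 0 := by
    rw [ae_all_iff]
    intro j
    by_cases hj : j = i
    · simp [hj]
    obtain ⟨c, b, hF⟩ := T.exists_param_face k i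
    have hcoord : ∀ s, (T.basis k).coord j (param c b s) =
        (T.basis k).coord j c + ∑ l, s l * inner ℝ (T.dual k j) (b l) := fun s => by
      rw [param, coord_add, inner_sum]
      simp_rw [real_inner_smul_right]
    have h0 : μHE[m] (param c b '' {s | (T.basis k).coord j c +
        ∑ l, s l * inner ℝ (T.dual k j) (b l) = 0}) = 0 := by
      rw [euclideanHausdorffMeasure_image_param, volume_affine_zero_set, mul_zero]
      have hp := T.point_mem_face k hj
      rw [hF] at hp
      obtain ⟨s, -, hs⟩ := hp
      refine ⟨s, ?_⟩
      rw [← hcoord, hs, ← T.basis_apply, (T.basis k).coord_apply_eq]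
      exact one_ne_zero
    filter_upwards [measure_eq_zero_iff_ae_notMem.1 h0] with x hx _ hxF hzero
    rw [hF] at hxF
    obtain ⟨s, -, rfl⟩ := hxF
    exact hx ⟨s, by rw [mem_ofPred_eq, ← hcoord, hzero], rfl⟩
  filter_upwards [h] with x hx hxF
  refine ⟨T.coord_eq_zero_of_mem_face hxF, fun j hj => lt_of_le_of_ne ?_ (hx j hj hxF).symm⟩
  have := T.face_subset_closedElt k i hxF
  rw [closedElt_eq] at this
  exact this j

variable {T}

/-- At such a point the `i`-th coordinate is zero and varies linearly along `y`, while the others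
are positive and stay so for small `δ`. A general filter serves both the downstream and the upstream
limits. -/
lemma relintFace.eventually_mem {k : Fin NK} {i : Fin (m + 2)} {x y : Pt (m + 1)}
    (hx : x ∈ T.relintFace k i) (l : Filter ℝ) (hl : l ≤ 𝓝 0)
    (hpos : ∀ᶠ δ in l, 0 < δ * inner ℝ (T.dual k i) y) :
    ∀ᶠ δ : ℝ in l, x + δ • y ∈ T.openElt k := by
  have h : ∀ᶠ δ : ℝ in l, ∀ j ≠ i, 0 < (T.basis k).coord j (x + δ • y) := by
    rw [eventually_all]
    intro j
    by_cases hj : j = i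
    · simp [hj]
    have hc : ContinuousAt (fun δ : ℝ => (T.basis k).coord j (x + δ • y)) 0 :=
      ((T.continuous_coord k j).comp (by fun_prop)).continuousAt
    have := hc.eventually_const_lt (u := 0) (by simpa using hx.2 j hj)
    exact (this.filter_mono hl).mono fun δ h _ => h
  filter_upwards [h, hpos] with δ h1 h2
  rw [openElt_eq]
  intro j
  by_cases hj : j = i
  · subst hj
    rw [coord_add, hx.1, zero_add, real_inner_smul_right]
    exact h2
  · exact h1 j hj

lemma relintFace.eventually_downstream {k : Fin NK} {i : Fin (m + 2)} {x y : Pt (m + 1)}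
    (hx : x ∈ T.relintFace k i) (hy : 0 < inner ℝ (T.dual k i) y) :
    ∀ᶠ δ : ℝ in 𝓝[>] 0, x + δ • y ∈ T.openElt k := by
  refine relintFace.eventually_mem hx _ nhdsWithin_le_nhds ?_
  filter_upwards [self_mem_nhdsWithin] with δ hδ using mul_pos hδ hy

lemma relintFace.eventually_upstream {k : Fin NK} {i : Fin (m + 2)} {x y : Pt (m + 1)}
    (hx : x ∈ T.relintFace k i) (hy : inner ℝ (T.dual k i) y < 0) :
    ∀ᶠ δ : ℝ in 𝓝[<] 0, x + δ • y ∈ T.openElt k := by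
  refine relintFace.eventually_mem hx _ nhdsWithin_le_nhds ?_
  filter_upwards [self_mem_nhdsWithin] with δ hδ using mul_pos_of_neg_of_neg hδ hy

end Mesh

lemma downstream_eq {d : ℕ} {T : Mesh d NK} {w : Pt d → Pt d} {φ : Pt d → Mat d} {k : Fin NK}
    {A : Mat d} (hφ : ∀ z ∈ T.openElt k, φ z = A) {x : Pt d}
    (h : ∀ᶠ δ : ℝ in 𝓝[>] 0, x + δ • w x ∈ T.openElt k) : downstream w φ x = A :=
  Tendsto.limUnder_eq (tendsto_const_nhds.congr' (h.mono fun _ hδ => (hφ _ hδ).symm))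

lemma upstream_eq {d : ℕ} {T : Mesh d NK} {w : Pt d → Pt d} {φ : Pt d → Mat d} {k : Fin NK}
    {A : Mat d} (hφ : ∀ z ∈ T.openElt k, φ z = A) {x : Pt d}
    (h : ∀ᶠ δ : ℝ in 𝓝[<] 0, x + δ • w x ∈ T.openElt k) : upstream w φ x = A :=
  Tendsto.limUnder_eq (tendsto_const_nhds.congr' (h.mono fun _ hδ => (hφ _ hδ).symm))

namespace Mesh
variable (T : Mesh (m + 1) NK)

lemma unitNormal_spec (k : Fin NK) (i : Fin (m + 2)) :
    ‖unitNormal (T.face k i)‖ = 1 ∧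
      ∀ x ∈ T.face k i, ∀ y ∈ T.face k i, inner ℝ (unitNormal (T.face k i)) (x - y) = 0 := by
  refine Classical.epsilon_spec (p := fun n : Pt (m + 1) => ‖n‖ = 1 ∧
    ∀ x ∈ T.face k i, ∀ y ∈ T.face k i, inner ℝ n (x - y) = 0)
    ⟨‖T.dual k i‖⁻¹ • T.dual k i, ?_, fun x hx y hy => ?_⟩
  · rw [norm_smul, norm_inv, norm_norm, inv_mul_cancel₀ (norm_ne_zero_iff.2 (T.dual_ne_zero k i))]
  · rw [real_inner_smul_left, inner_dual_sub, T.coord_eq_zero_of_mem_face hx,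
      T.coord_eq_zero_of_mem_face hy, sub_zero, mul_zero]

/-- The chosen normal is known only through its defining property. Expanding a vector along the
edges issuing from a vertex `c` of the face, the normal sees only the component towards the opposite
vertex, so it is proportional to the barycentric gradient. -/
lemma exists_dual_eq_smul_unitNormal (k : Fin NK) (i : Fin (m + 2)) :
    ∃ α : ℝ, α ≠ 0 ∧ T.dual k i = α • unitNormal (T.face k i) := by
  obtain ⟨hN, hperp⟩ := T.unitNormal_spec k i
  set N := unitNormal (T.face k i)
  obtain ⟨c, hc⟩ := exists_ne i
  set t := inner ℝ N ((T.elt k).points i - (T.elt k).points c) with ht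
  have hNt : N = t • T.dual k i := by
    refine ext_inner_right ℝ fun x => ?_
    rw [real_inner_smul_left]
    have hx : x = ∑ a, inner ℝ (T.dual k a) x • ((T.elt k).points a - (T.elt k).points c) := by
      simp_rw [smul_sub]
      rw [Finset.sum_sub_distrib, ← Finset.sum_smul, ← sum_inner, sum_dual, inner_zero_left,
        zero_smul, sub_zero]
      exact T.sum_inner_dual_smul k x
    conv_lhs => rw [hx, inner_sum]
    rw [Finset.sum_eq_single i]
    · rw [real_inner_smul_right, ← ht, mul_comm]
    · intro a _ ha
      rw [real_inner_smul_right, hperp _ (T.point_mem_face k ha) _ (T.point_mem_face k hc),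
        mul_zero]
    · simp
  have ht0 : t ≠ 0 := fun h => by
    rw [hNt, h, zero_smul, norm_zero] at hN
    exact zero_ne_one hN
  exact ⟨t⁻¹, inv_ne_zero ht0, by rw [hNt, smul_smul, inv_mul_cancel₀ ht0, one_smul]⟩

/-- Two elements on the same side of a common face coincide. -/
lemma eq_of_relintFace_of_pos {k l : Fin NK} {i j : Fin (m + 2)} {x y : Pt (m + 1)}
    (hk : x ∈ T.relintFace k i) (hl : x ∈ T.relintFace l j)
    (hyk : 0 < inner ℝ (T.dual k i) y) (hyl : 0 < inner ℝ (T.dual l j) y) : k = l := by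
  obtain ⟨δ, h1, h2⟩ := ((relintFace.eventually_downstream hk hyk).and
    (relintFace.eventually_downstream hl hyl)).exists
  by_contra h
  exact Set.disjoint_left.1 (T.disjoint_openElt h) h1 h2

/-- A face through which one can leave an element inside the domain is shared. -/
lemma face_mem_internalFaces {k : Fin NK} {i : Fin (m + 2)} {x : Pt (m + 1)}
    (hx : x ∈ T.relintFace k i) (hxF : x ∈ T.face k i) (hxd : x ∈ T.domain) :
    T.face k i ∈ T.internalFaces := by
  have hcont : Continuous fun δ : ℝ => x + δ • (-T.dual k i) := by fun_prop
  have hev : ∀ᶠ δ : ℝ in 𝓝[>] 0, x + δ • (-T.dual k i) ∈ T.domain := by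
    refine Eventually.filter_mono nhdsWithin_le_nhds ?_
    exact hcont.continuousAt.eventually_mem (T.isOpen_domain.mem_nhds (by simpa using hxd))
  -- Just beyond the face one is still in the domain, hence in some closed element, and one of the
  -- finitely many occurs arbitrarily close to `x`.
  obtain ⟨l, hl⟩ : ∃ l, ∃ᶠ δ : ℝ in 𝓝[>] 0, x + δ • (-T.dual k i) ∈ T.closedElt l := by
    by_contra! hc
    have hall := eventually_all.2 hc
    obtain ⟨δ, h1, h2⟩ := (hev.and hall).exists
    obtain ⟨l, hl⟩ := mem_iUnion.1 (T.domain_subset h1)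
    exact h2 l hl
  have hxl : x ∈ T.closedElt l := by
    refine (T.isClosed_closedElt l).mem_of_frequently_of_tendsto hl ?_
    have := (hcont.tendsto 0).mono_left (nhdsWithin_le_nhds (s := Ioi 0))
    simpa using this
  have hkl : k ≠ l := by
    rintro rfl
    obtain ⟨δ, h1, h2⟩ := (hl.and_eventually self_mem_nhdsWithin).exists
    rw [closedElt_eq] at h1
    have h3 := h1 i
    rw [coord_add, hx.1, zero_add, real_inner_smul_right, inner_neg_right,
      real_inner_self_eq_norm_sq] at h3
    have h4 : 0 < ‖T.dual k i‖ := norm_pos_iff.2 (T.dual_ne_zero k i)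
    have h5 : 0 < δ := h2
    have : 0 < δ * ‖T.dual k i‖ ^ 2 := by positivity
    linarith
  have hxk := T.face_subset_closedElt k i hxF
  have hmem : ∀ j ≠ i, (T.elt k).points j ∈ range (T.elt l).points := fun j hj =>
    T.point_mem_of_coord_pos hxk hxl (hx.2 j hj)
  have hsub : (T.elt k).points '' {i}ᶜ ⊆ range (T.elt l).points := by
    rintro _ ⟨j, hj, rfl⟩; exact hmem j hj
  -- All vertices of the face belong to `K_l`; counting leaves exactly one vertex of `K_l` outside,
  -- so the face is the one opposite to it.
  set A : Set (Fin (m + 2)) := (T.elt l).points ⁻¹' ((T.elt k).points '' {i}ᶜ) with hA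
  have himg : (T.elt l).points '' A = (T.elt k).points '' {i}ᶜ := image_preimage_eq_of_subset hsub
  have hcard : A.ncard = m + 1 := by
    rw [← ncard_image_of_injective A (T.elt l).independent.injective, himg,
      ncard_image_of_injective _ (T.elt k).independent.injective, ncard_compl, ncard_singleton,
      Nat.card_eq_fintype_card, Fintype.card_fin]
    omega
  have hcard2 : Aᶜ.ncard = 1 := by
    rw [ncard_compl, hcard, Nat.card_eq_fintype_card, Fintype.card_fin]; omega
  obtain ⟨j, hj⟩ := ncard_eq_one.1 hcard2
  refine ⟨k, l, hkl, ⟨i, rfl⟩, j, ?_⟩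
  have hAj : A = {j}ᶜ := by rw [← hj, compl_compl]
  rw [face, face, ← himg, hAj]

end Mesh
end
end OldroydB

/-! ### Fluxes through faces and dissipativity of the upwind form. -/

namespace OldroydB
noncomputable section

variable {m NK : ℕ}

namespace Mesh
variable (T : Mesh (m + 1) NK)

/-- The normal flux density of `w` entering `K_k` through its face opposite to the vertex `i`. -/
def flux (w : Pt (m + 1) → Pt (m + 1)) (k : Fin NK) (i : Fin (m + 2)) (x : Pt (m + 1)) : ℝ :=
  ‖T.dual k i‖⁻¹ * inner ℝ (T.dual k i) (w x)

lemma continuous_flux {w : Pt (m + 1) → Pt (m + 1)} (hw : Continuous w) (k : Fin NK)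
    (i : Fin (m + 2)) : Continuous (T.flux w k i) := by
  unfold flux; fun_prop

lemma flux_pos_iff {w : Pt (m + 1) → Pt (m + 1)} {k : Fin NK} {i : Fin (m + 2)} {x : Pt (m + 1)} :
    0 < T.flux w k i x ↔ 0 < inner ℝ (T.dual k i) (w x) :=
  mul_pos_iff_of_pos_left (inv_pos.2 (norm_pos_iff.2 (T.dual_ne_zero k i)))

lemma flux_neg_iff {w : Pt (m + 1) → Pt (m + 1)} {k : Fin NK} {i : Fin (m + 2)} {x : Pt (m + 1)} :
    T.flux w k i x < 0 ↔ inner ℝ (T.dual k i) (w x) < 0 :=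
  smul_neg_iff_of_pos_left (inv_pos.2 (norm_pos_iff.2 (T.dual_ne_zero k i)))

lemma abs_flux (w : Pt (m + 1) → Pt (m + 1)) (k : Fin NK) (i : Fin (m + 2)) (x : Pt (m + 1)) :
    |inner ℝ (w x) (unitNormal (T.face k i))| = |T.flux w k i x| := by
  obtain ⟨α, hα, h⟩ := T.exists_dual_eq_smul_unitNormal k i
  have hN := (T.unitNormal_spec k i).1
  rw [flux, h, norm_smul, hN, mul_one, real_inner_smul_left, abs_mul, abs_mul, abs_inv,
    Real.norm_eq_abs, abs_abs, ← mul_assoc, inv_mul_cancel₀ (abs_ne_zero.2 hα), one_mul,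
    real_inner_comm]

/-- Two distinct elements lie on opposite sides of a common face. -/
lemma flux_eq_neg_flux {k l : Fin NK} {i j : Fin (m + 2)} (hkl : k ≠ l)
    (hF : T.face k i = T.face l j) {x : Pt (m + 1)} (hk : x ∈ T.relintFace k i)
    (hl : x ∈ T.relintFace l j) (w : Pt (m + 1) → Pt (m + 1)) (z : Pt (m + 1)) :
    T.flux w l j z = -T.flux w k i z := by
  obtain ⟨α, hα, h⟩ := T.exists_dual_eq_smul_unitNormal k i
  obtain ⟨β, hβ, h'⟩ := T.exists_dual_eq_smul_unitNormal l j
  have hN := (T.unitNormal_spec k i).1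
  rw [← hF] at h'
  set N := unitNormal (T.face k i)
  have hNN : inner ℝ N N = 1 := by rw [real_inner_self_eq_norm_sq, hN, one_pow]
  have hαβ : α * β < 0 := by
    by_contra! hc
    have hc' : 0 < α * β := lt_of_le_of_ne hc (mul_ne_zero hα hβ).symm
    -- If both gradients had the same orientation, the direction `α • N` would enter both elements.
    refine hkl (T.eq_of_relintFace_of_pos (y := α • N) hk hl ?_ ?_)
    · rw [h, real_inner_smul_left, real_inner_smul_right, hNN, mul_one]
      exact mul_self_pos.2 hα
    · rw [h', real_inner_smul_left, real_inner_smul_right, hNN, mul_one, mul_comm]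
      exact hc'
  rw [flux, flux, h, h', norm_smul, norm_smul, hN, mul_one, mul_one, real_inner_smul_left,
    real_inner_smul_left, Real.norm_eq_abs, Real.norm_eq_abs]
  rcases mul_neg_iff.1 hαβ with ⟨h1, h2⟩ | ⟨h1, h2⟩
  · rw [abs_of_pos h1, abs_of_neg h2]; field_simp
  · rw [abs_of_neg h1, abs_of_pos h2]; field_simp

/-- A common face belongs to no third element. -/
lemma eq_or_eq_of_face_eq {k l k' : Fin NK} {i j i' : Fin (m + 2)} (hkl : k ≠ l)
    (hF : T.face k i = T.face l j) (hF' : T.face k' i' = T.face k i) {x : Pt (m + 1)}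
    (hk : x ∈ T.relintFace k i) (hl : x ∈ T.relintFace l j) (hk' : x ∈ T.relintFace k' i') :
    (k', i') = (k, i) ∨ (k', i') = (l, j) := by
  by_cases h1 : k' = k
  · subst h1
    rw [T.face_injective k' hF']
    exact Or.inl rfl
  by_cases h2 : k' = l
  · subst h2
    rw [T.face_injective k' (hF'.trans hF)]
    exact Or.inr rfl
  exfalso
  -- With three distinct elements the fluxes would be pairwise opposite, hence zero; but the flux of
  -- the gradient itself is positive.
  have e1 := T.flux_eq_neg_flux h1 hF' hk' hk (fun _ => T.dual k i) x
  have e2 := T.flux_eq_neg_flux h2 (hF'.trans hF) hk' hl (fun _ => T.dual k i) x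
  have e3 := T.flux_eq_neg_flux hkl hF hk hl (fun _ => T.dual k i) x
  have e4 : 0 < T.flux (fun _ => T.dual k i) k i x := by
    rw [flux_pos_iff, real_inner_self_eq_norm_sq]
    have := norm_pos_iff.2 (T.dual_ne_zero k i)
    positivity
  linarith

variable {T} {Wi ε : ℝ} {ψ : Pt (m + 1) → Mat (m + 1)} {w : Pt (m + 1) → Pt (m + 1)}

/-- The integrand of the upwind form. -/
def jumpIntegrand (T : Mesh (m + 1) NK) (Wi ε : ℝ) (ψ : Pt (m + 1) → Mat (m + 1))
    (w : Pt (m + 1) → Pt (m + 1)) (F : Set (Pt (m + 1))) (x : Pt (m + 1)) : ℝ :=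
  |inner ℝ (w x) (unitNormal F)| *
    ddot (jump w (T.interp ψ) x) (downstream w (stressTest T Wi ε ψ) x)

/-- The test function is evaluated downstream, exactly where the tangent inequality needs the
gradient of the entropy: the integrand dominates `|flux|` times downstream minus upstream entropy.
The inward fluxes of the two neighbours are opposite, so this is the sum of each entropy times its
own inward flux. -/
lemma le_setIntegral_jumpIntegrand (hWi : 0 < Wi) (hε : 0 ≤ ε) (hψ : ∀ x, (ψ x).IsSymm)
    (hw : Continuous w) {k l : Fin NK} {i j : Fin (m + 2)} (hkl : k ≠ l)
    (hF : T.face k i = T.face l j) :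
    ε / (2 * Wi) * (entropy (ψ (T.barycenter k)) * ∫ x in T.face k i, T.flux w k i x ∂μHE[m]) +
      ε / (2 * Wi) * (entropy (ψ (T.barycenter l)) * ∫ x in T.face k i, T.flux w l j x ∂μHE[m]) ≤
    ∫ x in T.face k i, jumpIntegrand T Wi ε ψ w (T.face k i) x ∂μHE[m] := by
  set c := ε / (2 * Wi) with hc
  have hc0 : 0 ≤ c := by positivity
  set a := fun k => ψ (T.barycenter k) with ha
  set A : Fin NK → Fin NK → ℝ := fun k l =>
    ddot (a k - a l) (c • (NormedSpace.exp (a k) - 1)) with hA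
  have hAle : ∀ k l, c * (entropy (a k) - entropy (a l)) ≤ A k l := fun k l => by
    rw [hA]
    simp only [ddot_smul_right]
    exact mul_le_mul_of_nonneg_left (entropy_sub_le (hψ _) (hψ _)) hc0
  set h : Pt (m + 1) → ℝ := fun x =>
    |T.flux w k i x| * (if 0 < T.flux w k i x then A k l else A l k) with hh
  have hgoodl := T.ae_mem_relintFace l j
  rw [← hF] at hgoodl
  have hchi : ∀ k, ∀ z ∈ T.openElt k, T.interp ψ z = a k := fun k z hz => T.interp_of_mem ψ hz
  have hphi : ∀ k, ∀ z ∈ T.openElt k,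
      stressTest T Wi ε ψ z = c • (NormedSpace.exp (a k) - 1) := fun k z hz =>
    stressTest_of_mem hz Wi ε ψ
  have heq : (fun x => jumpIntegrand T Wi ε ψ w (T.face k i) x)
      =ᵐ[(μHE[m] : Measure (Pt (m + 1))).restrict (T.face k i)] h := by
    filter_upwards [T.ae_mem_relintFace k i, hgoodl] with x hk hl
    have hneg := T.flux_eq_neg_flux hkl hF hk hl w x
    rw [jumpIntegrand, abs_flux, hh]
    simp only
    rcases lt_trichotomy (T.flux w k i x) 0 with hlt | h0 | hgt
    · have hlpos : 0 < T.flux w l j x := by linarith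
      have hu := relintFace.eventually_upstream hk ((T.flux_neg_iff).1 hlt)
      have hd := relintFace.eventually_downstream hl ((T.flux_pos_iff).1 hlpos)
      rw [if_neg hlt.not_gt, jump, downstream_eq (hchi l) hd, upstream_eq (hchi k) hu,
        downstream_eq (hphi l) hd]
    -- Where the flux vanishes the one-sided values are uncontrolled, but their weight is zero.
    · rw [h0, abs_zero, zero_mul, zero_mul]
    · have hlneg : T.flux w l j x < 0 := by linarith
      have hu := relintFace.eventually_upstream hl ((T.flux_neg_iff).1 hlneg)
      have hd := relintFace.eventually_downstream hk ((T.flux_pos_iff).1 hgt)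
      rw [if_pos hgt, jump, downstream_eq (hchi k) hd, upstream_eq (hchi l) hu,
        downstream_eq (hphi k) hd]
  have hik : IntegrableOn (T.flux w k i) (T.face k i) μHE[m] :=
    T.integrableOn_face k i (T.continuous_flux hw k i)
  have hil : IntegrableOn (T.flux w l j) (T.face k i) μHE[m] :=
    T.integrableOn_face k i (T.continuous_flux hw l j)
  have hih : IntegrableOn h (T.face k i) μHE[m] := by
    refine Integrable.mul_bdd (c := max |A k l| |A l k|)
      (T.integrableOn_face k i (T.continuous_flux hw k i).abs) ?_
      (Eventually.of_forall fun x => ?_)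
    · exact (Measurable.ite (measurableSet_lt measurable_const
        (T.continuous_flux hw k i).measurable) measurable_const
        measurable_const).aestronglyMeasurable
    · by_cases hx : 0 < T.flux w k i x
      · rw [if_pos hx]; exact le_max_left _ _
      · rw [if_neg hx]; exact le_max_right _ _
  rw [integral_congr_ae heq, ← integral_const_mul, ← integral_const_mul, ← integral_const_mul,
    ← integral_const_mul, ← integral_add ((hik.const_mul _).const_mul _)
    ((hil.const_mul _).const_mul _)]
  refine integral_mono_ae (((hik.const_mul _).const_mul _).add ((hil.const_mul _).const_mul _))
    hih ?_
  filter_upwards [T.ae_mem_relintFace k i, hgoodl] with x hk hl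
  have hneg := T.flux_eq_neg_flux hkl hF hk hl w x
  simp only [hneg, hh]
  by_cases hx : 0 < T.flux w k i x
  · rw [if_pos hx, abs_of_pos hx]
    have := mul_le_mul_of_nonneg_left (hAle k l) hx.le
    linarith
  · rw [if_neg hx, abs_of_nonpos (not_lt.1 hx)]
    have := mul_le_mul_of_nonneg_left (hAle l k) (neg_nonneg.2 (not_lt.1 hx))
    linarith

open Classical in
-- An internal face is represented by exactly two pairs (element, local index), so the face
-- inequality takes the form of a sum over all pairs.
lemma sum_face_le_setIntegral_jumpIntegrand (hWi : 0 < Wi) (hε : 0 ≤ ε)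
    (hψ : ∀ x, (ψ x).IsSymm) (hw : Continuous w) {F : Set (Pt (m + 1))}
    (hF : F ∈ T.internalFaces) :
    ∑ q : Fin NK × Fin (m + 2), (if T.face q.1 q.2 = F then
        ε / (2 * Wi) * (entropy (ψ (T.barycenter q.1)) *
          ∫ x in T.face q.1 q.2, T.flux w q.1 q.2 x ∂μHE[m]) else 0) ≤
      ∫ x in F, jumpIntegrand T Wi ε ψ w F x ∂μHE[m] := by
  obtain ⟨k, l, hkl, ⟨i, rfl⟩, j, hF⟩ := hF
  -- A common point of the relative interiors is extracted from almost-everywhere statements, which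
  -- needs positive measure; on a null face both sides are zero.
  by_cases h0 : μHE[m] (T.face k i) = 0
  · rw [setIntegral_measure_zero _ h0]
    refine (Finset.sum_eq_zero fun q _ => ?_).le
    split_ifs with hq
    · rw [hq, setIntegral_measure_zero _ h0, mul_zero, mul_zero]
    · rfl
  refine le_trans (le_of_eq ?_) (le_setIntegral_jumpIntegrand hWi hε hψ hw hkl hF)
  have hne : NeBot (ae ((μHE[m] : Measure (Pt (m + 1))).restrict (T.face k i))) := by
    rw [ae_neBot]
    exact fun h => h0 (by simpa using congrArg (fun μ => μ univ) h)
  have hgoodl := T.ae_mem_relintFace l j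
  rw [← hF] at hgoodl
  have hfilter : Finset.univ.filter (fun q : Fin NK × Fin (m + 2) =>
      T.face q.1 q.2 = T.face k i) = {(k, i), (l, j)} := by
    ext ⟨k', i'⟩
    simp only [Finset.mem_filter, Finset.mem_univ, true_and, Finset.mem_insert,
      Finset.mem_singleton]
    constructor
    · intro hq
      have hgood := T.ae_mem_relintFace k' i'
      rw [hq] at hgood
      obtain ⟨x, h1, h2, h3⟩ := ((T.ae_mem_relintFace k i).and (hgoodl.and hgood)).exists
      exact T.eq_or_eq_of_face_eq hkl hF hq h1 h2 h3
    · rintro (h | h)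
      · obtain ⟨rfl, rfl⟩ := Prod.mk.inj h; rfl
      · obtain ⟨rfl, rfl⟩ := Prod.mk.inj h; exact hF.symm
  rw [← Finset.sum_filter, hfilter, Finset.sum_pair (fun h => hkl (Prod.mk.inj h).1)]
  simp only [← hF]

/-- Almost every point of a face that is not shared lies outside the open domain, where the velocity
is zero. -/
lemma setIntegral_flux_eq_zero (hw : w ∈ T.velocitySpace) {k : Fin NK} {i : Fin (m + 2)}
    (hF : T.face k i ∉ T.internalFaces) : ∫ x in T.face k i, T.flux w k i x ∂μHE[m] = 0 := by
  refine integral_eq_zero_of_ae ?_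
  filter_upwards [T.ae_mem_relintFace k i,
    ae_restrict_mem (T.isCompact_face k i).measurableSet] with x hx hxF
  have : w x = 0 := hw.2.2 x fun hxd => hF (T.face_mem_internalFaces hx hxF hxd)
  simp [flux, this]

lemma sum_setIntegral_flux_eq_zero (hw : w ∈ T.velocitySpace)
    (hdiv : ∀ k, ∀ x ∈ T.openElt k, divg w x = 0) (k : Fin NK) :
    ∑ i, ∫ x in T.face k i, T.flux w k i x ∂μHE[m] = 0 := by
  obtain ⟨P, -, hP⟩ := velocitySpace.exists_poly hw k
  -- The polynomial extension from one element supplies the global smoothness that the velocity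
  -- lacks; it agrees with the velocity on the closed element, faces included.
  set W : Pt (m + 1) → Pt (m + 1) := fun x =>
    WithLp.toLp 2 fun i => MvPolynomial.eval (fun i => x i) (P i) with hW
  have hWc : ContDiff ℝ 1 W := by
    rw [contDiff_euclidean]
    exact fun i => contDiff_eval (P i)
  have hwW : ∀ x ∈ T.closedElt k, w x = W x := fun x hx => by
    ext i
    exact hP x hx i
  have h := setIntegral_divg_eq (T.elt k).independent (T.isDualTo k) (T.sum_inner_dual_smul k)
    (T.sum_dual k) hWc
  have h0 : ∫ x in convexHull ℝ (range (T.elt k).points), divg W x = 0 := by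
    have hae : T.openElt k =ᵐ[volume] T.closedElt k := by
      filter_upwards [measure_eq_zero_iff_ae_notMem.1 (T.volume_closedElt_diff k)] with x hx
      refine propext ⟨fun h => T.openElt_subset k h, fun h => ?_⟩
      by_contra hc
      exact hx ⟨h, hc⟩
    change ∫ x in T.closedElt k, divg W x = 0
    rw [← setIntegral_congr_set hae]
    refine setIntegral_eq_zero_of_forall_eq_zero fun x hx => ?_
    rw [← hdiv k x hx, divg, divg]
    congr 1
    ext i j
    simp only [grad, Matrix.of_apply]
    have : W =ᶠ[𝓝 x] w := by
      filter_upwards [(T.isOpen_openElt k).mem_nhds hx] with y hy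
      exact (hwW y (T.openElt_subset k hy)).symm
    rw [this.fderiv_eq]
  rw [h0] at h
  have h2 : ∑ i, ∫ x in T.face k i, T.flux w k i x ∂μHE[m] =
      ∑ a, ‖T.dual k a‖⁻¹ * ∫ x in simplexFace (T.elt k).points a,
        inner ℝ (T.dual k a) (W x) ∂μHE[m] := by
    refine Finset.sum_congr rfl fun a _ => ?_
    rw [← integral_const_mul]
    refine setIntegral_congr_fun (T.isCompact_face k a).measurableSet fun x hx => ?_
    simp only [flux, hwW x (T.face_subset_closedElt k a hx)]
  rw [h2]
  linarith

lemma finite_internalFaces : T.internalFaces.Finite := by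
  refine (finite_range fun q : Fin NK × Fin (m + 2) => T.face q.1 q.2).subset ?_
  rintro _ ⟨k, _, _, ⟨i, rfl⟩, _⟩
  exact ⟨(k, i), rfl⟩

/-- The upwind form is dissipative. -/
theorem jumpForm_nonneg (hWi : 0 < Wi) (hε : 0 ≤ ε) (hψ : ∀ x, (ψ x).IsSymm)
    (hw : w ∈ T.velocitySpace) (hdiv : ∀ k, ∀ x ∈ T.openElt k, divg w x = 0) :
    0 ≤ jumpForm T w (T.interp ψ) (stressTest T Wi ε ψ) := by
  classical
  have hsum : jumpForm T w (T.interp ψ) (stressTest T Wi ε ψ) =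
      ∑ F ∈ (finite_internalFaces (T := T)).toFinset,
        ∫ x in F, jumpIntegrand T Wi ε ψ w F x ∂μHE[m] :=
    finsum_mem_eq_finite_toFinset_sum _ _
  rw [hsum]
  refine le_trans (le_of_eq ?_) (Finset.sum_le_sum fun F hF =>
    sum_face_le_setIntegral_jumpIntegrand hWi hε hψ hw.1
      ((finite_internalFaces (T := T)).mem_toFinset.1 hF))
  -- Each pair (element, shared face) is now counted once. Unshared faces contribute zero and can be
  -- added, which completes the boundary of every element.
  rw [Finset.sum_comm]
  simp only [Finset.sum_ite_eq, Finite.mem_toFinset]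
  symm
  calc _ = ∑ q : Fin NK × Fin (m + 2), ε / (2 * Wi) * (entropy (ψ (T.barycenter q.1)) *
          ∫ x in T.face q.1 q.2, T.flux w q.1 q.2 x ∂μHE[m]) := by
        refine Finset.sum_congr rfl fun q _ => ?_
        split_ifs with hq
        · rfl
        · rw [setIntegral_flux_eq_zero hw hq, mul_zero, mul_zero]
    _ = 0 := by
        rw [Fintype.sum_prod_type]
        refine Finset.sum_eq_zero fun k _ => ?_
        dsimp only
        rw [← Finset.mul_sum, ← Finset.mul_sum, sum_setIntegral_flux_eq_zero hw hdiv, mul_zero,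
          mul_zero]

end Mesh
end
end OldroydB

namespace OldroydB
noncomputable section

variable {d NK : ℕ} {T : Mesh d NK}

/-! ### The stress spaces -/

namespace Mesh

lemma polyDisc_zero_subset (m : ℕ) : T.polyDisc 0 ⊆ T.polyDisc m := fun _ hf k => by
  obtain ⟨P, hP, h⟩ := hf k
  exact ⟨P, hP.trans (Nat.zero_le m), h⟩

lemma zero_mem_polyDisc (m : ℕ) : (fun _ => 0) ∈ T.polyDisc m := fun _ =>
  ⟨0, by simp, fun x _ => by simp⟩

lemma polyCont1AddConst_subset : T.polyCont1AddConst ⊆ T.polyDisc 1 := by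
  rintro f ⟨g, hg, c, hc, h⟩ k
  obtain ⟨P, hP, hP'⟩ := hg.2 k
  obtain ⟨Q, hQ, hQ'⟩ := hc k
  refine ⟨P + Q, (MvPolynomial.totalDegree_add P Q).trans (max_le hP (hQ.trans zero_le_one)),
    fun x hx => ?_⟩
  rw [h, hP' x hx, hQ' x hx, map_add]

lemma polyDisc_zero_subset_polyCont1AddConst : T.polyDisc 0 ⊆ T.polyCont1AddConst := fun f hf =>
  ⟨fun _ => 0, ⟨continuousOn_const, zero_mem_polyDisc 1⟩, f, hf, fun x => (zero_add (f x)).symm⟩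

lemma symFields_mono {V W : Set (Pt d → ℝ)} (h : V ⊆ W) : symFields V ⊆ symFields W :=
  fun _ hφ => ⟨fun i j => h (hφ.1 i j), hφ.2⟩

/-- These two inclusions are all that matters about the stress space: it contains the piecewise
constant test function, and its members are elementwise affine, as the barycenter rule requires. -/
lemma symFields_bounds {S : Set (Pt d → Mat d)}
    (hS : S = symFields (T.polyDisc 1) ∨ S = symFields T.polyCont1AddConst) :
    symFields (T.polyDisc 0) ⊆ S ∧ S ⊆ symFields (T.polyDisc 1) := by
  rcases hS with rfl | rfl
  · exact ⟨symFields_mono (polyDisc_zero_subset 1), Subset.rfl⟩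
  · exact ⟨symFields_mono polyDisc_zero_subset_polyCont1AddConst,
      symFields_mono polyCont1AddConst_subset⟩

lemma zero_mem_symFields (m : ℕ) : (fun _ => 0) ∈ symFields (T.polyDisc m) :=
  ⟨fun _ _ => zero_mem_polyDisc m, fun _ => Matrix.isSymm_zero⟩

lemma zero_mem_velocitySpace : (fun _ => 0) ∈ T.velocitySpace :=
  ⟨continuous_const, fun _ _ => ⟨0, by simp, fun x _ => by simp⟩, fun _ _ => rfl⟩

end Mesh

lemma stressTest_mem_symFields {Wi ε : ℝ} {ψ : Pt d → Mat d} (hψ : ∀ x, (ψ x).IsSymm) :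
    stressTest T Wi ε ψ ∈ Mesh.symFields (T.polyDisc 0) := by
  refine ⟨fun i j k => ⟨MvPolynomial.C
    (((ε / (2 * Wi)) • (NormedSpace.exp (ψ (T.barycenter k)) - 1 : Mat d)) i j),
    (MvPolynomial.totalDegree_C _).le, fun x hx => ?_⟩, fun x => ?_⟩
  · beta_reduce
    rw [stressTest_of_mem hx, MvPolynomial.eval_C]
  · exact ((Mesh.interp_isSymm (fun y => isSymm_exp (hψ y)) x).sub Matrix.isSymm_one).smul _

/-! ### Incompressibility -/

lemma volumeForm_zero_zero (Re Wi ε dt : ℝ) (u₀ u : Pt d → Pt d) (Ψ₀ ψ Ω B : Pt d → Mat d)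
    (p q : Pt d → ℝ) :
    volumeForm T Re Wi ε dt u₀ Ψ₀ u p ψ Ω B (fun _ => 0) q (fun _ => 0) =
      ∫ x in T.domain, q x * divg u x := by
  have hg : ∀ x : Pt d, grad (fun _ : Pt d => (0 : Pt d)) x = 0 := fun x => by
    ext i j
    simp [grad]
  simp [volumeForm, divg, hg, ddot]

lemma jumpForm_zero (w : Pt d → Pt d) (ψ : Pt d → Mat d) :
    jumpForm T w ψ (fun _ => 0) = 0 := by
  have h : ∀ x, downstream w (fun _ => (0 : Mat d)) x = 0 := fun x => tendsto_const_nhds.limUnder_eq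
  simp [jumpForm, h, ddot]

lemma IsDiscreteSequence.divg_eq_zero {S : Set (Pt d → Mat d)} {NT : ℕ} {u : ℕ → Pt d → Pt d}
    {p : ℕ → Pt d → ℝ} {ψ : ℕ → Pt d → Mat d} (h : IsDiscreteSequence T S NT u p ψ)
    (hstep : ∀ n < NT, ∀ q ∈ T.polyDisc 1, ∫ x in T.domain, q x * divg (u (n + 1)) x = 0)
    {n : ℕ} (hn : n ≤ NT) (k : Fin NK) : ∀ x ∈ T.openElt k, divg (u n) x = 0 := by
  refine Mesh.divg_eq_zero_of_integral_eq_zero (h.1 n hn).1 ?_ k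
  cases n with
  | zero => exact h.2
  | succ n => exact hstep n hn

/-! ### The free energy estimate -/

lemma integrableOn_interp (ψ : Pt d → Mat d) (g : Mat d → ℝ) :
    IntegrableOn (fun x => g (T.interp ψ x)) T.domain :=
  (Mesh.PwCont.interp ψ g).integrableOn

lemma discreteEnergy_eq (Re Wi ε : ℝ) (u : ℕ → Pt d → Pt d) (ψ : ℕ → Pt d → Mat d) (n : ℕ) :
    discreteEnergy T Re Wi ε u ψ n = Re / 2 * (∫ x in T.domain, ‖u n x‖ ^ 2)
      + ε / (2 * Wi) * ∫ x in T.domain, entropy (T.interp (ψ n) x) := rfl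

lemma dissipation_nonneg {Wi ε : ℝ} (hε₀ : 0 ≤ ε) (hε₁ : ε < 1) (u : Pt d → Pt d)
    {ψ : Pt d → Mat d} (hψ : ∀ x, (ψ x).IsSymm) (x : Pt d) : 0 ≤ dissipation T Wi ε u ψ x :=
  add_nonneg (mul_nonneg (by linarith) (ddot_self_nonneg _))
    (mul_nonneg (by positivity) (trace_exp_add_exp_neg_nonneg (Mesh.interp_isSymm hψ x)))

theorem freeEnergyEstimate_of_step {Re Wi ε dt : ℝ} (hRe : 0 ≤ Re) (hε₀ : 0 ≤ ε)
    (hε₁ : ε < 1) (hdt : 0 < dt) {NT : ℕ} {u : ℕ → Pt d → Pt d} {ψ : ℕ → Pt d → Mat d}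
    (hψ : ∀ n ≤ NT, ∀ x, (ψ n x).IsSymm)
    (h : ∀ n < NT, discreteEnergy T Re Wi ε u ψ (n + 1) - discreteEnergy T Re Wi ε u ψ n
      + (∫ x in T.domain, Re / 2 * ‖u (n + 1) x - u n x‖ ^ 2)
      + dt * (∫ x in T.domain, dissipation T Wi ε (u (n + 1)) (ψ (n + 1)) x) ≤ 0) :
    FreeEnergyEstimate T Re Wi ε dt NT u ψ := by
  refine ⟨h, fun m n hmn hn => ?_⟩
  induction n, hmn using Nat.le_induction with
  | base => exact le_rfl
  | succ n _ ih =>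
    have h1 : 0 ≤ ∫ x in T.domain, Re / 2 * ‖u (n + 1) x - u n x‖ ^ 2 :=
      integral_nonneg fun x => by positivity
    have h2 : 0 ≤ ∫ x in T.domain, dissipation T Wi ε (u (n + 1)) (ψ (n + 1)) x :=
      integral_nonneg (dissipation_nonneg hε₀ hε₁ _ (hψ _ hn))
    have := h n hn
    have := mul_nonneg hdt.le h2
    linarith [ih (Nat.le_of_succ_le hn)]

/-- Here `e` is the entropy of the transported field and `V` the value of the volume form: for
characteristics `e` may be smaller than the old entropy and `V = 0`; for discontinuous Galerkin `e`
is the old entropy and `V` is minus the jump form. -/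
lemma step_le_of_le {Re Wi ε dt : ℝ} (hWi : 0 < Wi) (hε : 0 ≤ ε) (hdt : 0 < dt)
    {u : ℕ → Pt d → Pt d} {ψ : ℕ → Pt d → Mat d} {n : ℕ} {D e : ℝ}
    (he : e ≤ ∫ x in T.domain, entropy (T.interp (ψ n) x)) {V : ℝ} (hV : V ≤ 0)
    (h : dt⁻¹ * (Re / 2 * (∫ x in T.domain, ‖u (n + 1) x‖ ^ 2)
        - Re / 2 * (∫ x in T.domain, ‖u n x‖ ^ 2)
        + (∫ x in T.domain, Re / 2 * ‖u (n + 1) x - u n x‖ ^ 2)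
        + ε / (2 * Wi) * ((∫ x in T.domain, entropy (T.interp (ψ (n + 1)) x)) - e)) + D ≤ V) :
    discreteEnergy T Re Wi ε u ψ (n + 1) - discreteEnergy T Re Wi ε u ψ n
      + (∫ x in T.domain, Re / 2 * ‖u (n + 1) x - u n x‖ ^ 2) + dt * D ≤ 0 := by
  have h1 := mul_le_mul_of_nonneg_left (h.trans hV) hdt.le
  rw [mul_add, ← mul_assoc, mul_inv_cancel₀ hdt.ne', one_mul, mul_zero] at h1
  have h2 := mul_le_mul_of_nonneg_left he (show 0 ≤ ε / (2 * Wi) by positivity)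
  rw [discreteEnergy_eq, discreteEnergy_eq]
  linarith

theorem IsCharacteristicSolution.freeEnergyEstimate (hd : d = 2 ∨ d = 3) {S : Set (Pt d → Mat d)}
    (hS : S = Mesh.symFields (T.polyDisc 1) ∨ S = Mesh.symFields T.polyCont1AddConst)
    {Re Wi ε dt : ℝ} (hRe : 0 ≤ Re) (hWi : 0 < Wi) (hε₀ : 0 ≤ ε) (hε₁ : ε < 1) (hdt : 0 < dt)
    {NT : ℕ} {u : ℕ → Pt d → Pt d} {p : ℕ → Pt d → ℝ} {ψ : ℕ → Pt d → Mat d}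
    (h : IsCharacteristicSolution T S Re Wi ε dt NT u p ψ) :
    FreeEnergyEstimate T Re Wi ε dt NT u ψ := by
  obtain ⟨hS₀, hS₁⟩ := Mesh.symFields_bounds hS
  obtain ⟨hseq, hstep⟩ := h
  have hdiv : ∀ n ≤ NT, ∀ k, ∀ x ∈ T.openElt k, divg (u n) x = 0 := fun n hn =>
    hseq.divg_eq_zero (fun n hn q hq => by
      obtain ⟨X, Ω, B, N, -, -, h⟩ := hstep n hn
      -- Zero velocity and stress tests isolate the incompressibility constraint.
      have := h _ Mesh.zero_mem_velocitySpace q hq _ (hS₀ (Mesh.zero_mem_symFields 0))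
      rwa [volumeForm_zero_zero, eq_comm] at this) hn
  have hψ : ∀ n ≤ NT, ∀ x, (ψ n x).IsSymm := fun n hn => (hS₁ (hseq.1 n hn).2.2).2
  refine freeEnergyEstimate_of_step hRe hε₀ hε₁ hdt hψ fun n hn => ?_
  obtain ⟨X, Ω, B, N, hX, hdec, h⟩ := hstep n hn
  have hn₁ : n + 1 ≤ NT := hn
  obtain ⟨hu₁, hp₁, hψ₁⟩ := hseq.1 _ hn₁
  have hu₀ := (hseq.1 n hn.le).1
  have hab : (n : ℝ) * dt ≤ (n + 1) * dt := by nlinarith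
  have hmain := le_volumeForm (Re := Re) hWi hε₀ hdt (p (n + 1)) (hψ _ hn₁) (hS₁ hψ₁).1 hu₀ hu₁
    (hdiv n hn.le) (hdiv _ hn₁) hdec
    (Ψ₀ := fun x => T.interp (ψ n) (X (n * dt) x)) (fun x => Mesh.interp_isSymm (hψ n hn.le) _)
    (fun i j => hX.integrableOn_comp hd hu₀ (hdiv n hn.le) hab
      (integrableOn_interp (ψ n) fun s => s i j))
    (hX.integrableOn_comp hd hu₀ (hdiv n hn.le) hab (integrableOn_interp (ψ n) entropy))
  exact step_le_of_le hWi hε₀ hdt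
    (hX.setIntegral_comp_le hd hu₀ (hdiv n hn.le) hab (integrableOn_interp (ψ n) entropy)
      fun x => entropy_nonneg (Mesh.interp_isSymm (hψ n hn.le) x))
    (h _ hu₁ _ hp₁ _ (hS₀ (stressTest_mem_symFields (hψ _ hn₁)))).ge hmain

theorem IsDGSolution.freeEnergyEstimate {m : ℕ} {T : Mesh (m + 1) NK}
    {S : Set (Pt (m + 1) → Mat (m + 1))}
    (hS : S = Mesh.symFields (T.polyDisc 1) ∨ S = Mesh.symFields T.polyCont1AddConst)
    {Re Wi ε dt : ℝ} (hRe : 0 ≤ Re) (hWi : 0 < Wi) (hε₀ : 0 ≤ ε) (hε₁ : ε < 1) (hdt : 0 < dt)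
    {NT : ℕ} {u : ℕ → Pt (m + 1) → Pt (m + 1)} {p : ℕ → Pt (m + 1) → ℝ}
    {ψ : ℕ → Pt (m + 1) → Mat (m + 1)}
    (h : IsDGSolution T S Re Wi ε dt NT u p ψ) :
    FreeEnergyEstimate T Re Wi ε dt NT u ψ := by
  obtain ⟨hS₀, hS₁⟩ := Mesh.symFields_bounds hS
  obtain ⟨hseq, hstep⟩ := h
  have hdiv : ∀ n ≤ NT, ∀ k, ∀ x ∈ T.openElt k, divg (u n) x = 0 := fun n hn =>
    hseq.divg_eq_zero (fun n hn q hq => by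
      obtain ⟨Ω, B, N, -, h⟩ := hstep n hn
      have := h _ Mesh.zero_mem_velocitySpace q hq _ (hS₀ (Mesh.zero_mem_symFields 0))
      rwa [volumeForm_zero_zero, jumpForm_zero, add_zero, eq_comm] at this) hn
  have hψ : ∀ n ≤ NT, ∀ x, (ψ n x).IsSymm := fun n hn => (hS₁ (hseq.1 n hn).2.2).2
  refine freeEnergyEstimate_of_step hRe hε₀ hε₁ hdt hψ fun n hn => ?_
  obtain ⟨Ω, B, N, hdec, h⟩ := hstep n hn
  have hn₁ : n + 1 ≤ NT := hn
  obtain ⟨hu₁, hp₁, hψ₁⟩ := hseq.1 _ hn₁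
  have hu₀ := (hseq.1 n hn.le).1
  have hmain := le_volumeForm (Re := Re) hWi hε₀ hdt (p (n + 1)) (hψ _ hn₁) (hS₁ hψ₁).1 hu₀ hu₁
    (hdiv n hn.le) (hdiv _ hn₁) hdec (Ψ₀ := T.interp (ψ n)) (Mesh.interp_isSymm (hψ n hn.le))
    (fun i j => integrableOn_interp (ψ n) fun s => s i j) (integrableOn_interp (ψ n) entropy)
  have hjump := Mesh.jumpForm_nonneg hWi hε₀ (hψ _ hn₁) hu₀ (hdiv n hn.le)
  have heq := h _ hu₁ _ hp₁ _ (hS₀ (stressTest_mem_symFields (Wi := Wi) (ε := ε) (hψ _ hn₁)))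
  exact step_le_of_le hWi hε₀ hdt le_rfl (by linarith) hmain

end
end OldroydB

theorem mainTheorem6 (d NK : ℕ) (hd : d = 2 ∨ d = 3) (T : OldroydB.Mesh d NK)
    (S : Set (OldroydB.Pt d → OldroydB.Mat d))
    (hS : S = OldroydB.Mesh.symFields (T.polyDisc 1) ∨
      S = OldroydB.Mesh.symFields T.polyCont1AddConst)
    (Re Wi ε : ℝ) (hRe : 0 ≤ Re) (hWi : 0 < Wi) (hε₀ : 0 ≤ ε) (hε₁ : ε < 1)
    (tEnd dt : ℝ) (NT : ℕ) (htEnd : 0 < tEnd) (hNT : 0 < NT) (hdt : dt = tEnd / NT)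
    (u : ℕ → OldroydB.Pt d → OldroydB.Pt d) (p : ℕ → OldroydB.Pt d → ℝ)
    (ψ : ℕ → OldroydB.Pt d → OldroydB.Mat d) :
    (OldroydB.IsCharacteristicSolution T S Re Wi ε dt NT u p ψ →
      OldroydB.FreeEnergyEstimate T Re Wi ε dt NT u ψ) ∧
    (OldroydB.IsDGSolution T S Re Wi ε dt NT u p ψ →
      OldroydB.FreeEnergyEstimate T Re Wi ε dt NT u ψ) := by
  have hdt' : 0 < dt := hdt ▸ div_pos htEnd (Nat.cast_pos.2 hNT)
  -- Writing `d = m + 1` turns the surface dimension `d - 1` into `m`.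
  obtain ⟨m, rfl⟩ : ∃ m, d = m + 1 := Nat.exists_eq_succ_of_ne_zero (by omega)
  exact ⟨fun h => h.freeEnergyEstimate hd hS hRe hWi hε₀ hε₁ hdt',
    fun h => h.freeEnergyEstimate hS hRe hWi hε₀ hε₁ hdt'⟩
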